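/- Notation. Let $\varphi_e$ be the $e$-th partial computable function, $X'=\{e:\varphi_e^X(e)\downarrow\}$ the Turing jump of $X\subseteq\mathbb N$, and $\equiv_1$ one-one equivalence. Let $<_{\mathcal O}$ be the least relation on $\mathbb N$ such that (i) $1<_{\mathcal O}2$; (ii) if $a<_{\mathcal O}b$ then $b<_{\mathcal O}2^b$; (iii) if $\varphi_e$ is total and $\varphi_e(n)<_{\mathcal O}\varphi_e(n+1)$ for all $n$, then $\varphi_e(n)<_{\mathcal O}3\cdot5^e$ for all $n$; (iv) $<_{\mathcal O}$ is transitive. Kleene's $\mathcal O$ is the field of $<_{\mathcal O}$; for $a\in\mathcal O$ let $|a|_{\mathcal O}$ be the order type of $\{b:b<_{\mathcal O}a\}$, and let $\omega_1^{CK}$ be the least ordinal that is not of the form $|a|_{\mathcal O}$. Put $H_1=\emptyset$, $H_{2^b}=(H_b)'$, $H_{3\cdot5^e}=\{\langle x,n\rangle:x\in H_{\varphi_e(n)}\}$. For an infinite ordinal $\alpha<\omega_1^{CK}$, a set $X\subseteq\mathbb N$ is $\Sigma_\alpha$-complete if $X\equiv_1H_{2^a}$ for every $a\in\mathcal O$ with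 $|a|_{\mathcal O}=\alpha$. A code for a continuous partial function from $[0,1]$ to $\mathbb R$ is a set $\Phi\subseteq\mathbb N\times(\mathbb Q\cap[0,1])\times\mathbb Q^+\times\mathbb Q\times\mathbb Q^+$ such that, writing $(a,r)\Phi(b,s)$ for $\exists n\,(n,a,r,b,s)\in\Phi$: (1) if $(a,r)\Phi(b,s)$ and $(a,r)\Phi(b',s')$ then $|b-b'|\le s+s'$; (2) if $(a,r)\Phi(b,s)$ and $|a-a'|+r'<r$ (with $a'\in\mathbb Q\cap[0,1]$, $r'\in\mathbb Q^+$), then $(a',r')\Phi(b,s)$; (3) if $(a,r)\Phi(b,s)$ and $|b-b'|+s<s'$, then $(a,r)\Phi(b',s')$. The index $e$ encodes $f_e:[0,1]\to\mathbb R$ if $\varphi_e$ is the characteristic function of (the set of integer codes of the elements of) such a $\Phi$, for every $x\in[0,1]$ and $\varepsilon>0$ there are $(a,r)\Phi(b,s)$ with $|x-a|<r$ and $s<\varepsilon$, and $|f_e(x)-b|\le s$ whenever $x\in[0,1]$, $(a,r)\Phi(b,s)$ and $|x-a|<r$. For $f\in C[0,1]$ let $\Delta_f(x,y)=\frac{f(x)-f(y)}{x-y}$,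 and for closed $P\subseteq[0,1]$ and $\varepsilon>0$ let $P'_{f,\varepsilon}$ be the set of $x\in P$ such that for every $\delta>0$ there are rationals $p<q$ and $r<s$ in $B(x,\delta)\cap[0,1]$ with $[p,q]\cap[r,s]\cap P\ne\emptyset$ and $|\Delta_f(p,q)-\Delta_f(r,s)|\ge\varepsilon$. Let $P^0_{f,\varepsilon}=[0,1]$, $P^{\alpha+1}_{f,\varepsilon}=(P^\alpha_{f,\varepsilon})'_{f,\varepsilon}$, and $P^\lambda_{f,\varepsilon}=\bigcap_{\alpha<\lambda}P^\alpha_{f,\varepsilon}$ for limit $\lambda$. For differentiable $f$, the Kechris--Woodin rank $|f|_{KW}$ is the least ordinal $\alpha$ such that $P^\alpha_{f,\varepsilon}=\emptyset$ for all $\varepsilon>0$. Let $D_\alpha$ be the set of all $e$ that encode a function $f_e\in C[0,1]$ which is differentiable on $[0,1]$ with $|f_e|_{KW}<\alpha$. Theorem. For every limit ordinal $\lambda<\omega_1^{CK}$, the set $D_\lambda$ is $\Sigma_\lambda$-complete. -/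

import Mathlib

noncomputable section

open Set

namespace KW

/-! ### Partial computable functions, with and without an oracle -/

/-- `φ_e`, the partial computable function with index `e`. -/
def phi (e : ℕ) : ℕ →. ℕ :=
  (Denumerable.ofNat Nat.Partrec.Code e).eval

/-- Programs with an oracle: the programs `Nat.Partrec.Code` together with an instruction that
queries the oracle. -/
inductive OCode : Type
  | zero : OCode
  | succ : OCode
  | left : OCode
  | right : OCode
  | oracle : OCode
  | pair : OCode → OCode → OCode
  | comp : OCode → OCode → OCode
  | prec : OCode → OCode → OCode
  | rfind' : OCode → OCode

namespace OCode

/-- The standard numbering of the oracle programs; it is a bijection. -/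
def ofNat : ℕ → OCode
  | 0 => zero
  | 1 => succ
  | 2 => left
  | 3 => right
  | 4 => oracle
  | n + 5 =>
    let m := n.div2.div2
    have hm : m < n + 5 := by
      simp only [m, Nat.div2_val]
      omega
    have _m1 : m.unpair.1 < n + 5 := lt_of_le_of_lt m.unpair_left_le hm
    have _m2 : m.unpair.2 < n + 5 := lt_of_le_of_lt m.unpair_right_le hm
    match n.bodd, n.div2.bodd with
    | false, false => pair (ofNat m.unpair.1) (ofNat m.unpair.2)
    | false, true => comp (ofNat m.unpair.1) (ofNat m.unpair.2)
    | true, false => prec (ofNat m.unpair.1) (ofNat m.unpair.2)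
    | true, true => rfind' (ofNat m)
  decreasing_by all_goals first | exact _m1 | exact _m2 | exact hm

open Classical in
/-- The partial function computed by a program with oracle `X`. -/
def eval (X : Set ℕ) : OCode → ℕ →. ℕ
  | zero => pure 0
  | succ => Nat.succ
  | left => ↑fun n : ℕ => n.unpair.1
  | right => ↑fun n : ℕ => n.unpair.2
  | oracle => ↑fun n : ℕ => if n ∈ X then 1 else 0
  | pair cf cg => fun n => Nat.pair <$> eval X cf n <*> eval X cg n
  | comp cf cg => fun n => eval X cg n >>= eval X cf
  | prec cf cg =>
    Nat.unpaired fun a n =>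
      n.rec (eval X cf a) fun y IH => do
        let i ← IH
        eval X cg (Nat.pair a (Nat.pair y i))
  | rfind' cf =>
    Nat.unpaired fun a m =>
      (Nat.rfind fun n => (fun m => m = 0) <$> eval X cf (Nat.pair a (n + m))).map (· + m)

end OCode

/-- The Turing jump `X' = {e : φ_e^X(e)↓}`. -/
def jump (X : Set ℕ) : Set ℕ :=
  {e | ((OCode.ofNat e).eval X e).Dom}

/-! ### Kleene's `𝓞` and the sets `H_a` -/

/-- The relation `<_𝓞`. -/
inductive LtO : ℕ → ℕ → Prop
  | one : LtO 1 2
  | succ {a b : ℕ} : LtO a b → LtO b (2 ^ b)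
  | lim {e : ℕ} (f : ℕ → ℕ) (hf : ∀ n, f n ∈ phi e n) (hlt : ∀ n, LtO (f n) (f (n + 1)))
      (n : ℕ) : LtO (f n) (3 * 5 ^ e)
  | trans {a b c : ℕ} : LtO a b → LtO b c → LtO a c

/-- Kleene's `𝓞`, the field of `<_𝓞`. -/
def kleeneO : Set ℕ :=
  {a | ∃ b, LtO a b ∨ LtO b a}

/-- `a ∈ 𝓞` is a notation for `α`, i.e. `|a|_𝓞 = α`: the set of `<_𝓞`-predecessors of `a`, ordered
by `<_𝓞`, has order type `α`. -/
def IsNotation (a : ℕ) (α : Ordinal.{0}) : Prop :=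
  a ∈ kleeneO ∧
    Nonempty ((fun x y : {b : ℕ // LtO b a} => LtO x y) ≃r (fun x y : Set.Iio α => x < y))

/-- The ordinals that have a notation in `𝓞`. -/
def IsConstructive (α : Ordinal.{0}) : Prop :=
  ∃ a, IsNotation a α

/-- `ω₁^CK`, the least ordinal that is not constructive. -/
def omega1CK : Ordinal.{0} :=
  sInf {α | ¬ IsConstructive α}

/-- The graph of `a ↦ H_a`. -/
inductive IsH : ℕ → Set ℕ → Prop
  | one : IsH 1 ∅
  | succ {b : ℕ} {X : Set ℕ} : IsH b X → IsH (2 ^ b) (jump X)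
  | lim {e : ℕ} (f : ℕ → ℕ) (hf : ∀ n, f n ∈ phi e n) (Y : ℕ → Set ℕ)
      (hY : ∀ n, IsH (f n) (Y n)) :
      IsH (3 * 5 ^ e) {m | ∃ x n, m = Nat.pair x n ∧ x ∈ Y n}

/-- The set `H_a`: `H_1 = ∅`, `H_{2^b} = (H_b)'` and `H_{3·5^e} = {⟨x, n⟩ : x ∈ H_{φ_e(n)}}`.
The graph `IsH` is single-valued and is defined at each `a ∈ 𝓞`, see `isH_iff`. -/
def H (a : ℕ) : Set ℕ :=
  {x | ∃ X, IsH a X ∧ x ∈ X}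

/-- `X` is `Σ_α`-complete, for an infinite ordinal `α < ω₁^CK`: `X ≡₁ H_{2^a}` for every notation
`a` of `α`. -/
def IsSigmaComplete (α : Ordinal.{0}) (X : Set ℕ) : Prop :=
  ∀ a, IsNotation a α → OneOneEquiv (fun n => n ∈ X) (fun n => n ∈ H (2 ^ a))

/-! ### Codes for continuous functions on `[0,1]` -/

/-- `(a,r) Φ (b,s)`. -/
def Rel (Φ : Set (ℕ × ℚ × ℚ × ℚ × ℚ)) (a r b s : ℚ) : Prop :=
  ∃ n, (n, a, r, b, s) ∈ Φ

/-- `Φ` is a code for a continuous partial function from `[0,1]` to `ℝ`. -/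
structure IsFunctionCode (Φ : Set (ℕ × ℚ × ℚ × ℚ × ℚ)) : Prop where
  range : ∀ n a r b s, (n, a, r, b, s) ∈ Φ → (0 ≤ a ∧ a ≤ 1) ∧ 0 < r ∧ 0 < s
  compat : ∀ a r b s b' s', Rel Φ a r b s → Rel Φ a r b' s' → |b - b'| ≤ s + s'
  shrink : ∀ a r b s a' r', Rel Φ a r b s → 0 ≤ a' → a' ≤ 1 → 0 < r' →
    |a - a'| + r' < r → Rel Φ a' r' b s
  enlarge : ∀ a r b s b' s', Rel Φ a r b s → |b - b'| + s < s' → Rel Φ a r b' s'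

/-- The integer code of a rational number. -/
def codeRat (q : ℚ) : ℕ :=
  Nat.pair (Encodable.encode q.num) q.den

/-- The integer code of a quintuple. -/
def codeQuint : ℕ × ℚ × ℚ × ℚ × ℚ → ℕ
  | (n, a, r, b, s) =>
    Nat.pair n (Nat.pair (codeRat a) (Nat.pair (codeRat r) (Nat.pair (codeRat b) (codeRat s))))

/-- `φ_e` is the characteristic function of the set of integers `S`. -/
def ComputesSet (e : ℕ) (S : Set ℕ) : Prop :=
  ∀ k, (k ∈ S → 1 ∈ phi e k) ∧ (k ∉ S → 0 ∈ phi e k)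

/-- `Φ` represents the function `f` on all of `[0,1]`: each point of `[0,1]` is in the domain of
the partial function coded by `Φ`, and `f` takes the coded value there. -/
def Represents (Φ : Set (ℕ × ℚ × ℚ × ℚ × ℚ)) (f : ℝ → ℝ) : Prop :=
  ∀ x ∈ Icc (0 : ℝ) 1,
    (∀ ε : ℝ, 0 < ε → ∃ a r b s : ℚ, Rel Φ a r b s ∧ |x - a| < r ∧ (s : ℝ) < ε) ∧
    (∀ a r b s : ℚ, Rel Φ a r b s → |x - a| < r → |f x - b| ≤ s)

/-- `φ_e` encodes the function `f` on `[0,1]`, i.e. `f = f_e` there. The values of `f` outside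
`[0,1]` play no role, here and below. -/
def Encodes (e : ℕ) (f : ℝ → ℝ) : Prop :=
  ∃ Φ, IsFunctionCode Φ ∧ ComputesSet e (codeQuint '' Φ) ∧ Represents Φ f

/-! ### The differentiability rank -/

/-- The secant slope `Δ_f(x,y)`. -/
def secant (f : ℝ → ℝ) (x y : ℝ) : ℝ :=
  (f x - f y) / (x - y)

/-- The derivative operation `P ↦ P'_{f,ε}`. -/
def kwDeriv (f : ℝ → ℝ) (ε : ℝ) (P : Set ℝ) : Set ℝ :=
  {x | x ∈ P ∧ ∀ δ : ℚ, 0 < δ → ∃ p q r s : ℚ, p < q ∧ r < s ∧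
    (∀ t ∈ ({p, q, r, s} : Set ℚ), (t : ℝ) ∈ Metric.ball x δ ∩ Icc 0 1) ∧
    (Icc (p : ℝ) q ∩ Icc (r : ℝ) s ∩ P).Nonempty ∧
    ε ≤ |secant f p q - secant f r s|}

/-- The sets `P^α_{f,ε}`. -/
def hierarchy (f : ℝ → ℝ) (ε : ℝ) (α : Ordinal.{0}) : Set ℝ :=
  Ordinal.limitRecOn (motive := fun _ => Set ℝ) α (Icc 0 1) (fun _ P => kwDeriv f ε P)
    (fun l _ P => ⋂ (β : Ordinal.{0}) (h : β < l), P β h)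

/-- `|f|_KW = α`: the ordinal `α` is least such that `P^α_{f,ε} = ∅` for all `ε > 0`. -/
def HasRank (f : ℝ → ℝ) (α : Ordinal.{0}) : Prop :=
  IsLeast {β | ∀ ε : ℝ, 0 < ε → hierarchy f ε β = ∅} α

/-- `D_α`: the indices of the computable differentiable functions on `[0,1]` of rank `< α`. -/
def D (α : Ordinal.{0}) : Set ℕ :=
  {e | ∃ f : ℝ → ℝ, Encodes e f ∧ DifferentiableOn ℝ f (Icc 0 1) ∧ ∃ β < α, HasRank f β}

/-! ### The sets `H_a` are well defined -/

theorem two_pow_ne (b e : ℕ) : 2 ^ b ≠ 3 * 5 ^ e := fun h => by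
  have h3 : 3 ∣ 2 ^ b := ⟨_, h⟩
  have := Nat.Prime.dvd_of_dvd_pow Nat.prime_three h3
  omega

theorem IsH.ne_zero {a : ℕ} {X : Set ℕ} (h : IsH a X) : a ≠ 0 := by
  cases h <;> positivity

theorem IsH.unique {a : ℕ} {X : Set ℕ} (h : IsH a X) : ∀ {Y}, IsH a Y → X = Y := by
  induction h with
  | one =>
    intro Z hZ
    generalize hc : 1 = c at hZ
    cases hZ with
    | one => rfl
    | succ h => exact absurd (Nat.pow_eq_one.1 hc.symm) (by simpa using h.ne_zero)
    | lim f hf Y hY => omega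
  | @succ b X hb ih =>
    intro Z hZ
    generalize hc : 2 ^ b = c at hZ
    cases hZ with
    | one => exact absurd (Nat.pow_eq_one.1 hc) (by simpa using hb.ne_zero)
    | succ h =>
      obtain rfl := Nat.pow_right_injective le_rfl hc
      rw [ih h]
    | lim f hf Y hY => exact absurd hc (two_pow_ne _ _)
  | @lim e f hf Y hY ih =>
    intro Z hZ
    generalize hc : 3 * 5 ^ e = c at hZ
    cases hZ with
    | one => omega
    | succ h => exact absurd hc.symm (two_pow_ne _ _)
    | @lim e' f' hf' Y' hY' =>
      have he : e = e' := by
        have : 5 ^ e = 5 ^ e' := by omega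
        exact Nat.pow_right_injective (by norm_num) this
      subst he
      have hff : f = f' := funext fun n => Part.mem_unique (hf n) (hf' n)
      subst hff
      have hYY : Y = Y' := funext fun n => ih n (hY' n)
      rw [hYY]

theorem LtO.exists_isH {a b : ℕ} (h : LtO a b) : (∃ X, IsH a X) ∧ ∃ X, IsH b X := by
  induction h with
  | one => exact ⟨⟨_, .one⟩, ⟨_, IsH.succ .one⟩⟩
  | succ _ ih => exact ⟨ih.2, let ⟨_, h⟩ := ih.2; ⟨_, h.succ⟩⟩
  | lim f hf _ n ih =>
    choose Y hY using fun n => (ih n).1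
    exact ⟨⟨_, hY n⟩, ⟨_, IsH.lim f hf Y hY⟩⟩
  | trans _ _ ih₁ ih₂ => exact ⟨ih₁.1, ih₂.2⟩

theorem isH_iff {a : ℕ} (ha : a ∈ kleeneO) (X : Set ℕ) : IsH a X ↔ H a = X := by
  have key : ∀ {Y}, IsH a Y → H a = Y := fun {Y} hY => by
    ext x
    exact ⟨fun ⟨Z, hZ, hx⟩ => hZ.unique hY ▸ hx, fun hx => ⟨Y, hY, hx⟩⟩
  refine ⟨key, ?_⟩
  rintro rfl
  obtain ⟨b, h | h⟩ := ha
  · obtain ⟨Y, hY⟩ := h.exists_isH.1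
    rwa [key hY]
  · obtain ⟨Y, hY⟩ := h.exists_isH.2
    rwa [key hY]

end KW

end

-- A notation of a limit `λ` has the form `a = 3·5^e`, where `φ_e` lists notations `f n` whose ranks
-- are cofinal in `λ` (`IsNotation.eq_lim`, `IsFund.lt_nrank`). By `mem_D_iff`, differentiability is
-- automatic once the hierarchy dies out. So `e ∈ D_λ` says only that `e` encodes a function and
-- that some level `β < λ` of its hierarchy is empty for all `ε`. The two one-one reductions are
-- proved separately.
--
-- Upper bound (`D_reducible`). By compactness, `P^{γ+1}` misses a compact rational interval iff
-- there is `i` such that, for all rational `[p,q]`, `[r,s]` with endpoints within `1/i` of a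
-- rational point of that interval, either `P^γ` misses `[p,q] ∩ [r,s]` or the two slopes are close
-- (`Holds.of_step`, `Holds.exists_step`). Closeness of slopes is an existential statement about the
-- code. One derivative therefore costs one block `∃∀`, that is two jumps. Being an index of a total
-- function code is of the form `∀∃` (`forall_encTest_iff`). `exists_isSat` turns such recursively
-- specified statements, uniformly in the notation `c`, into membership questions about `H_{2^c}`;
-- at a limit notation the existential quantifier also chooses a smaller notation. As `2·β < λ` for
-- `β < λ`, membership in `D_λ` becomes a question about `H_{2^a}`.
--
-- Lower bound (`H_two_pow_reducible`). To each `x` belongs a game in which a player defends the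
-- claim `x ∉ H_{2^a}`. A claim about a jump or an effective union is reduced, by a challenge and a
-- response, to claims about sets lower down; the player loses on making an absurd claim. Positions
-- form a tree, and every position at which the absurd claim has not been made contributes a bump to
-- a function on `[0,1]`. The bumps of the children accumulate, from the right, at the right end `pt
-- σ` of the bump of their parent, and are quadratically small compared with their distance to it,
-- so the function is differentiable at `pt σ`. The point `pt σ` survives a derivative if the points
-- of infinitely many children with bumps survive the previous ones (`pt_mem_hierarchy`). It is
-- removed at stage `β + 1` if the intervals of all children are exhausted by that stage and almost
-- all of them strictly earlier (`thin_of_children`).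
--
-- If the claim is true, there is always a good response, so some positions have infinitely many
-- good children for ever and no level of the hierarchy is empty (`hierarchy_nonempty_of_true`). If
-- it is false, a halting computation refutes it. Its finitely many oracle questions concern
-- finitely many columns `H_{f n}`, and induction along the notation bounds the rank by an ordinal
-- below `λ` (`bounds_of_not_trueClaim`).

attribute [fun_prop] Primrec

/-! ### Effectivity: primitive recursion in compositional form, and rational arithmetic. -/

namespace KW

open Encodable

/-! ### Primitive recursive functions: lemmas in compositional form -/

section Toolkit

variable {α β γ σ : Type*} [Primcodable α] [Primcodable β] [Primcodable γ] [Primcodable σ]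

@[fun_prop] theorem primrec_id : Primrec (fun x : α => x) := Primrec.id

@[fun_prop] theorem primrec_const (c : β) : Primrec (fun _ : α => c) := Primrec.const c

@[fun_prop] theorem primrec_comp {f : β → γ} {g : α → β} (hf : Primrec f) (hg : Primrec g) :
    Primrec (fun x => f (g x)) := hf.comp hg

@[fun_prop] theorem primrec_fst {f : α → β × γ} (hf : Primrec f) : Primrec (fun x => (f x).1) :=
  Primrec.fst.comp hf

@[fun_prop] theorem primrec_snd {f : α → β × γ} (hf : Primrec f) : Primrec (fun x => (f x).2) :=
  Primrec.snd.comp hf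

@[fun_prop] theorem primrec_mk {f : α → β} {g : α → γ} (hf : Primrec f) (hg : Primrec g) :
    Primrec (fun x => (f x, g x)) := Primrec.pair hf hg

@[fun_prop] theorem primrec_nat_add {f g : α → ℕ} (hf : Primrec f) (hg : Primrec g) :
    Primrec (fun x => f x + g x) := Primrec.nat_add.comp hf hg

@[fun_prop] theorem primrec_nat_sub {f g : α → ℕ} (hf : Primrec f) (hg : Primrec g) :
    Primrec (fun x => f x - g x) := Primrec.nat_sub.comp hf hg

@[fun_prop] theorem primrec_nat_mul {f g : α → ℕ} (hf : Primrec f) (hg : Primrec g) :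
    Primrec (fun x => f x * g x) := Primrec.nat_mul.comp hf hg

@[fun_prop] theorem primrec_nat_div {f g : α → ℕ} (hf : Primrec f) (hg : Primrec g) :
    Primrec (fun x => f x / g x) := Primrec.nat_div.comp hf hg

@[fun_prop] theorem primrec_nat_mod {f g : α → ℕ} (hf : Primrec f) (hg : Primrec g) :
    Primrec (fun x => f x % g x) := Primrec.nat_mod.comp hf hg

@[fun_prop] theorem primrec_nat_pair {f g : α → ℕ} (hf : Primrec f) (hg : Primrec g) :
    Primrec (fun x => Nat.pair (f x) (g x)) := Primrec₂.natPair.comp hf hg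

@[fun_prop] theorem primrec_nat_unpair {f : α → ℕ} (hf : Primrec f) :
    Primrec (fun x => (f x).unpair) := Primrec.unpair.comp hf

/-- The code of an element of a `Primcodable` type. -/
def enc {δ : Type*} [h : Primcodable δ] (x : δ) : ℕ := @encode δ h.toEncodable x

/-- The element of a `Primcodable` type with a given code. -/
def dec (δ : Type*) [h : Primcodable δ] (n : ℕ) : Option δ := @decode δ h.toEncodable n

@[simp] theorem dec_enc {δ : Type*} [Primcodable δ] (x : δ) : dec δ (enc x) = some x :=
  Encodable.encodek x

theorem enc_injective {δ : Type*} [Primcodable δ] : Function.Injective (enc : δ → ℕ) :=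
  Encodable.encode_injective

@[fun_prop] theorem primrec_enc {f : α → β} (hf : Primrec f) :
    Primrec (fun x => enc (f x)) := Primrec.encode.comp hf

@[fun_prop] theorem primrec_dec {f : α → ℕ} (hf : Primrec f) :
    Primrec (fun x => dec β (f x)) := Primrec.decode.comp hf

@[fun_prop] theorem primrec_some {f : α → β} (hf : Primrec f) :
    Primrec (fun x => some (f x)) := Primrec.option_some.comp hf

@[fun_prop] theorem primrec_getD {f : α → Option β} {g : α → β} (hf : Primrec f)
    (hg : Primrec g) : Primrec (fun x => (f x).getD (g x)) := Primrec.option_getD.comp hf hg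

@[fun_prop] theorem primrec_isSome {f : α → Option β} (hf : Primrec f) :
    Primrec (fun x => (f x).isSome) := Primrec.option_isSome.comp hf

@[fun_prop] theorem primrec_option_bind {f : α → Option β} {g : α → β → Option γ}
    (hf : Primrec f) (hg : Primrec (fun p : α × β => g p.1 p.2)) :
    Primrec (fun x => (f x).bind (g x)) := Primrec.option_bind hf hg

@[fun_prop] theorem primrec_option_elim {f : α → Option β} {d : α → γ} {g : α → β → γ}
    (hf : Primrec f) (hd : Primrec d) (hg : Primrec (fun p : α × β => g p.1 p.2)) :
    Primrec (fun x => (f x).elim (d x) (g x)) :=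
  (Primrec.option_casesOn hf hd hg).of_eq fun x => by cases f x <;> rfl

@[fun_prop] theorem primrec_and {f g : α → Bool} (hf : Primrec f) (hg : Primrec g) :
    Primrec (fun x => f x && g x) := Primrec.and.comp hf hg

@[fun_prop] theorem primrec_or {f g : α → Bool} (hf : Primrec f) (hg : Primrec g) :
    Primrec (fun x => f x || g x) := Primrec.or.comp hf hg

@[fun_prop] theorem primrec_not {f : α → Bool} (hf : Primrec f) :
    Primrec (fun x => !(f x)) := Primrec.not.comp hf

@[fun_prop] theorem primrec_cond {c : α → Bool} {f g : α → β} (hc : Primrec c) (hf : Primrec f)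
    (hg : Primrec g) : Primrec (fun x => bif c x then f x else g x) := Primrec.cond hc hf hg

@[fun_prop] theorem primrec_decide_eq {f g : α → β} {d : ∀ x, Decidable (f x = g x)}
    (hf : Primrec f) (hg : Primrec g) : Primrec (fun x => @decide (f x = g x) (d x)) := by
  classical
  exact (Primrec.eq.comp hf hg).decide.of_eq fun x => by congr

@[fun_prop] theorem primrec_nat_beq {f g : α → ℕ} (hf : Primrec f) (hg : Primrec g) :
    Primrec (fun x => f x == g x) := by
  have : Primrec (fun x => decide (f x = g x)) := by fun_prop
  exact this.of_eq fun x => by rw [Bool.eq_iff_iff]; simp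

@[fun_prop] theorem primrec_decide_lt {f g : α → ℕ} (hf : Primrec f) (hg : Primrec g) :
    Primrec (fun x => decide (f x < g x)) := (Primrec.nat_lt.comp hf hg).decide

@[fun_prop] theorem primrec_decide_le {f g : α → ℕ} (hf : Primrec f) (hg : Primrec g) :
    Primrec (fun x => decide (f x ≤ g x)) := (Primrec.nat_le.comp hf hg).decide

@[fun_prop] theorem primrec_nat_rec {n : α → ℕ} {f : α → β} {g : α → ℕ → β → β}
    (hn : Primrec n) (hf : Primrec f) (hg : Primrec (fun p : α × ℕ × β => g p.1 p.2.1 p.2.2)) :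
    Primrec (fun x => Nat.rec (motive := fun _ => β) (f x) (g x) (n x)) :=
  Primrec.nat_rec' hn hf (h := fun a p => g a p.1 p.2) hg

@[fun_prop] theorem primrec_nat_pow {f g : α → ℕ} (hf : Primrec f) (hg : Primrec g) :
    Primrec (fun x => f x ^ g x) := by
  have : Primrec (fun x => Nat.rec (motive := fun _ => ℕ) 1 (fun _ ih => ih * f x) (g x)) := by
    fun_prop
  refine this.of_eq fun x => ?_
  induction g x with
  | zero => rfl
  | succ n ih => simp only [ih, pow_succ]

@[fun_prop] theorem primrec_cons {f : α → β} {g : α → List β} (hf : Primrec f)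
    (hg : Primrec g) : Primrec (fun x => f x :: g x) := Primrec.list_cons.comp hf hg

@[fun_prop] theorem primrec_append {f g : α → List β} (hf : Primrec f)
    (hg : Primrec g) : Primrec (fun x => f x ++ g x) := Primrec.list_append.comp hf hg

@[fun_prop] theorem primrec_length {f : α → List β} (hf : Primrec f) :
    Primrec (fun x => (f x).length) := Primrec.list_length.comp hf

@[fun_prop] theorem primrec_range {f : α → ℕ} (hf : Primrec f) :
    Primrec (fun x => List.range (f x)) := Primrec.list_range.comp hf

@[fun_prop] theorem primrec_getElem? {f : α → List β} {g : α → ℕ} (hf : Primrec f)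
    (hg : Primrec g) : Primrec (fun x => (f x)[g x]?) := Primrec.list_getElem?.comp hf hg

@[fun_prop] theorem primrec_map {f : α → List β} {g : α → β → γ} (hf : Primrec f)
    (hg : Primrec (fun p : α × β => g p.1 p.2)) : Primrec (fun x => (f x).map (g x)) :=
  Primrec.list_map hf hg

@[fun_prop] theorem primrec_flatMap {f : α → List β} {g : α → β → List γ} (hf : Primrec f)
    (hg : Primrec (fun p : α × β => g p.1 p.2)) : Primrec (fun x => (f x).flatMap (g x)) :=
  Primrec.list_flatMap hf hg

@[fun_prop] theorem primrec_foldr {l : α → List β} {d : α → γ} {g : α → β → γ → γ}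
    (hl : Primrec l) (hd : Primrec d) (hg : Primrec (fun p : α × β × γ => g p.1 p.2.1 p.2.2)) :
    Primrec (fun x => (l x).foldr (g x) (d x)) :=
  Primrec.list_foldr hl hd (h := fun a p => g a p.1 p.2) hg

@[fun_prop] theorem primrec_list_rec {l : α → List β} {d : α → γ} {g : α → β → List β → γ → γ}
    (hl : Primrec l) (hd : Primrec d)
    (hg : Primrec (fun p : α × β × List β × γ => g p.1 p.2.1 p.2.2.1 p.2.2.2)) :
    Primrec (fun x => List.rec (motive := fun _ => γ) (d x) (g x) (l x)) :=
  Primrec.list_rec hl hd (h := fun a p => g a p.1 p.2.1 p.2.2) hg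

@[fun_prop] theorem primrec_any {l : α → List β} {p : α → β → Bool} (hl : Primrec l)
    (hp : Primrec (fun q : α × β => p q.1 q.2)) : Primrec (fun x => (l x).any (p x)) := by
  have : Primrec (fun x => (l x).foldr (fun b r => p x b || r) false) := by fun_prop
  exact this.of_eq fun x => by induction l x <;> simp_all

@[fun_prop] theorem primrec_all {l : α → List β} {p : α → β → Bool} (hl : Primrec l)
    (hp : Primrec (fun q : α × β => p q.1 q.2)) : Primrec (fun x => (l x).all (p x)) := by
  have : Primrec (fun x => (l x).foldr (fun b r => p x b && r) true) := by fun_prop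
  exact this.of_eq fun x => by induction l x <;> simp_all

@[fun_prop] theorem primrec_decide_mem {f : α → β} {l : α → List β}
    {d : ∀ x, Decidable (f x ∈ l x)} (hf : Primrec f) (hl : Primrec l) :
    Primrec (fun x => @decide (f x ∈ l x) (d x)) := by
  classical
  have : Primrec (fun x => (l x).any fun b => decide (f x = b)) := by fun_prop
  exact this.of_eq fun x => by rw [Bool.eq_iff_iff]; simp

/-- For functions such as the gcd or the code of a fraction in lowest terms: a decidable graph and a
bound on the value replace an explicit recursion. -/
theorem primrec_of_bounded_graph {f b : α → ℕ} (hb : Primrec b) (hfb : ∀ x, f x ≤ b x)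
    (hg : Primrec (fun p : α × ℕ => decide (f p.1 = p.2))) : Primrec f :=
  Primrec.of_graph ⟨b, hb, hfb⟩ ⟨fun _ => inferInstance, hg⟩

@[fun_prop] theorem primrec_nat_gcd {f g : α → ℕ} (hf : Primrec f) (hg : Primrec g) :
    Primrec (fun x => Nat.gcd (f x) (g x)) := by
  refine primrec_of_bounded_graph (b := fun x => f x + g x) (by fun_prop) (fun x => ?_) ?_
  · rcases Nat.eq_zero_or_pos (f x) with h | h
    · simp [h]
    · exact (Nat.gcd_le_left _ h).trans (Nat.le_add_right _ _)
  -- The graph of the gcd: a common divisor that every common divisor up to the bound divides.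
  -- Remainders express divisibility also for the divisor `0`.
  · have : Primrec (fun p : α × ℕ => decide (f p.1 % p.2 = 0) && decide (g p.1 % p.2 = 0) &&
        (List.range (f p.1 + g p.1 + 1)).all fun d =>
          !(decide (f p.1 % d = 0) && decide (g p.1 % d = 0)) || decide (p.2 % d = 0)) := by
      fun_prop
    refine this.of_eq fun p => ?_
    rw [Bool.eq_iff_iff]
    simp only [Bool.and_eq_true, decide_eq_true_eq, List.all_eq_true, List.mem_range,
      Bool.or_eq_true, Bool.not_eq_true', Bool.and_eq_false_iff, decide_eq_false_iff_not,
      ← Nat.dvd_iff_mod_eq_zero]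
    constructor
    · rintro ⟨⟨h1, h2⟩, h⟩
      refine Nat.dvd_antisymm ?_ (Nat.dvd_gcd h1 h2)
      have hlt : Nat.gcd (f p.1) (g p.1) < f p.1 + g p.1 + 1 := by
        rcases Nat.eq_zero_or_pos (f p.1) with h | h
        · simp [h]
        · have := Nat.gcd_le_left (g p.1) h
          omega
      rcases h _ hlt with (h | h) | h
      · exact absurd (Nat.gcd_dvd_left _ _) h
      · exact absurd (Nat.gcd_dvd_right _ _) h
      · exact h
    · intro h
      rw [← h]
      refine ⟨⟨Nat.gcd_dvd_left _ _, Nat.gcd_dvd_right _ _⟩, fun d _ => ?_⟩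
      by_cases h1 : d ∣ f p.1
      · by_cases h2 : d ∣ g p.1
        · exact Or.inr (Nat.dvd_gcd h1 h2)
        · exact Or.inl (Or.inr h2)
      · exact Or.inl (Or.inl h1)

open Nat.Partrec in
@[fun_prop] theorem primrec_evaln {k n : α → ℕ} {c : α → Code} (hk : Primrec k) (hc : Primrec c)
    (hn : Primrec n) : Primrec (fun x => (c x).evaln (k x) (n x)) :=
  Code.primrec_evaln.comp ((hk.pair hc).pair hn)

@[fun_prop] theorem primrec_ofNat {δ : Type*} [Denumerable δ] {f : α → ℕ} (hf : Primrec f) :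
    Primrec (fun x => Denumerable.ofNat δ (f x)) := (Primrec.ofNat δ).comp hf

end Toolkit

/-! ### Rational arithmetic is primitive recursive -/

/-- The integer with code `n`. -/
def decodeInt (n : ℕ) : ℤ := (n.div2 : ℤ) * (1 - n.bodd.toNat) - (n.div2 + 1) * n.bodd.toNat

theorem encode_ofNat_int (n : ℕ) : encode (Int.ofNat n) = 2 * n := rfl

theorem encode_negSucc_int (n : ℕ) : encode (Int.negSucc n) = 2 * n + 1 := rfl

theorem decodeInt_encode (z : ℤ) : decodeInt (encode z) = z := by
  cases z with
  | ofNat n => rw [encode_ofNat_int]; simp [decodeInt, Nat.div2_val]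
  | negSucc n =>
    rw [encode_negSucc_int]
    simp [decodeInt, Nat.div2_val, Int.negSucc_eq]

theorem encode_decodeInt (n : ℕ) : encode (decodeInt n) = n := by
  obtain ⟨m, rfl | rfl⟩ : ∃ m, n = 2 * m ∨ n = 2 * m + 1 := ⟨n / 2, by omega⟩
  · rw [← encode_ofNat_int, decodeInt_encode]
  · rw [← encode_negSucc_int, decodeInt_encode]

theorem natAbs_decodeInt (n : ℕ) : (decodeInt n).natAbs = (n + 1) / 2 := by
  obtain ⟨m, rfl | rfl⟩ : ∃ m, n = 2 * m ∨ n = 2 * m + 1 := ⟨n / 2, by omega⟩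
  · rw [← encode_ofNat_int, decodeInt_encode, encode_ofNat_int]; simp; omega
  · rw [← encode_negSucc_int, decodeInt_encode, encode_negSucc_int]; simp [Int.natAbs_negSucc]; omega

/-- The natural number `n` is the code of a rational number. -/
def isRatCode (n : ℕ) : Bool :=
  decide (0 < n.unpair.2) && decide (Nat.gcd ((n.unpair.1 + 1) / 2) n.unpair.2 = 1)

@[fun_prop] theorem primrec_isRatCode {α : Type*} [Primcodable α] {f : α → ℕ} (hf : Primrec f) :
    Primrec (fun x => isRatCode (f x)) := by
  unfold isRatCode; fun_prop

theorem isRatCode_codeRat (q : ℚ) : isRatCode (codeRat q) = true := by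
  have h := q.reduced
  rw [Nat.Coprime] at h
  simp [isRatCode, codeRat, q.den_pos, ← natAbs_decodeInt, decodeInt_encode, h]

/-- The rational number with code `n`, if there is one. -/
def decodeRat (n : ℕ) : Option ℚ :=
  if h : 0 < n.unpair.2 ∧ Nat.gcd ((n.unpair.1 + 1) / 2) n.unpair.2 = 1 then
    some ⟨decodeInt n.unpair.1, n.unpair.2, h.1.ne', by
      rw [natAbs_decodeInt]; exact h.2⟩
  else none

theorem codeRat_of_decodeRat {n : ℕ} {q : ℚ} (h : decodeRat n = some q) : codeRat q = n := by
  unfold decodeRat at h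
  split at h
  · obtain rfl := Option.some.inj h
    simp [codeRat, encode_decodeInt]
  · cases h

theorem decodeRat_codeRat (q : ℚ) : decodeRat (codeRat q) = some q := by
  have h := isRatCode_codeRat q
  simp only [isRatCode, Bool.and_eq_true, decide_eq_true_eq] at h
  rw [decodeRat, dif_pos h]
  congr 1
  apply Rat.ext <;> simp [codeRat, decodeInt_encode]

theorem decodeRat_eq_none {n : ℕ} : decodeRat n = none ↔ isRatCode n = false := by
  unfold decodeRat isRatCode
  rw [dite_eq_right_iff, Bool.eq_false_iff]
  simp

/-- Built on `codeRat`, so that the derived code of a quintuple is `codeQuint` by definition. This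
makes the characteristic functions of function codes accessible to the `Primrec` calculus. -/
instance : Primcodable ℚ where
  encode := codeRat
  decode := decodeRat
  encodek := decodeRat_codeRat
  prim := by
    have : Primrec (fun n => bif isRatCode n then n + 1 else 0) := by fun_prop
    refine Primrec.nat_iff.1 (this.of_eq fun n => ?_)
    cases h : decodeRat n with
    | none => rw [decodeRat_eq_none.1 h]; rfl
    | some q =>
      have := codeRat_of_decodeRat h
      have h' : isRatCode n = true := this ▸ isRatCode_codeRat q
      rw [h']
      exact congrArg Nat.succ this.symm

theorem encode_rat (q : ℚ) : @encode ℚ Primcodable.toEncodable q = codeRat q := rfl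

section Rat

variable {α : Type*} [Primcodable α]

@[fun_prop] theorem primrec_codeRat {f : α → ℚ} (hf : Primrec f) :
    Primrec (fun x => codeRat (f x)) := Primrec.encode.comp hf

@[fun_prop] theorem primrec_decodeRat {f : α → ℕ} (hf : Primrec f) :
    Primrec (fun x => decodeRat (f x)) := (Primrec.decode (α := ℚ)).comp hf

/-- The numerator of the positive part. -/
def posNum (q : ℚ) : ℕ := q.num.toNat

/-- The numerator of the negative part. -/
def negNum (q : ℚ) : ℕ := (-q.num).toNat

theorem posNum_sub_negNum (q : ℚ) : (posNum q : ℤ) - negNum q = q.num := by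
  simp [posNum, negNum]

theorem eq_posNum_sub_negNum_div (q : ℚ) : q = ((posNum q : ℚ) - negNum q) / q.den := by
  have h : ((posNum q : ℚ) - negNum q) = q.num := by exact_mod_cast posNum_sub_negNum q
  rw [h, Rat.num_div_den]

theorem encode_num_cases (q : ℚ) :
    (∃ n : ℕ, q.num = n ∧ encode q.num = 2 * n) ∨
      ∃ n : ℕ, q.num = -(n + 1) ∧ encode q.num = 2 * n + 1 := by
  cases h : q.num with
  | ofNat n => exact Or.inl ⟨n, rfl, encode_ofNat_int n⟩
  | negSucc n => exact Or.inr ⟨n, by rw [Int.negSucc_eq], encode_negSucc_int n⟩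

@[fun_prop] theorem primrec_posNum {f : α → ℚ} (hf : Primrec f) :
    Primrec (fun x => posNum (f x)) := by
  have : Primrec (fun x => bif decide ((codeRat (f x)).unpair.1 % 2 = 0) then
      (codeRat (f x)).unpair.1 / 2 else 0) := by fun_prop
  refine this.of_eq fun x => ?_
  simp only [codeRat, Nat.unpair_pair, posNum]
  rcases encode_num_cases (f x) with ⟨n, h, h'⟩ | ⟨n, h, h'⟩ <;> rw [h', h]
  · simp
  · have : (2 * n + 1) % 2 = 1 := by omega
    simp only [this]
    simp
    omega

@[fun_prop] theorem primrec_negNum {f : α → ℚ} (hf : Primrec f) :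
    Primrec (fun x => negNum (f x)) := by
  have : Primrec (fun x => bif decide ((codeRat (f x)).unpair.1 % 2 = 0) then
      0 else ((codeRat (f x)).unpair.1 + 1) / 2) := by fun_prop
  refine this.of_eq fun x => ?_
  simp only [codeRat, Nat.unpair_pair, negNum]
  rcases encode_num_cases (f x) with ⟨n, h, h'⟩ | ⟨n, h, h'⟩ <;> rw [h', h]
  · simp
  · have : (2 * n + 1) % 2 = 1 := by omega
    simp only [this]
    simp
    omega

@[fun_prop] theorem primrec_den {f : α → ℚ} (hf : Primrec f) :
    Primrec (fun x => (f x).den) := by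
  have : Primrec (fun x => (codeRat (f x)).unpair.2) := by fun_prop
  exact this.of_eq fun x => by simp [codeRat]

/-- The rational number `(p - m) / d`. -/
def mkQ (p m d : ℕ) : ℚ := ((p : ℚ) - m) / d

theorem eq_mkQ (q : ℚ) : q = mkQ (posNum q) (negNum q) q.den := eq_posNum_sub_negNum_div q

/-- Cross-multiplication with all terms kept positive turns the graph of `mkQ` into an equation
between natural numbers. All field operations are then reduced to `mkQ`. -/
theorem mkQ_eq_iff {p m d : ℕ} (hd : 0 < d) (q : ℚ) :
    mkQ p m d = q ↔ p * q.den + negNum q * d = posNum q * d + m * q.den := by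
  have h1 : (d : ℚ) ≠ 0 := by positivity
  have h2 : (q.den : ℚ) ≠ 0 := by have := q.den_pos; positivity
  conv_lhs => rw [eq_posNum_sub_negNum_div q]
  rw [mkQ, div_eq_div_iff h1 h2]
  constructor
  · intro h
    have : ((p * q.den + negNum q * d : ℕ) : ℚ) = (posNum q * d + m * q.den : ℕ) := by
      push_cast; linarith
    exact_mod_cast this
  · intro h
    have : ((p * q.den + negNum q * d : ℕ) : ℚ) = (posNum q * d + m * q.den : ℕ) := by
      exact_mod_cast h
    push_cast at this; linarith

/-- Passing to lowest terms does not increase numerator or denominator. The slack covers `d = 0`,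
where the value is `0` with denominator `1`. -/
theorem codeRat_mkQ_le (p m d : ℕ) :
    codeRat (mkQ p m d) ≤ Nat.pair (2 * (p + m) + 2) (d + 2) := by
  have key : (mkQ p m d).num.natAbs ≤ p + m ∧ (mkQ p m d).den ≤ d + 1 := by
    have h : mkQ p m d = Rat.divInt ((p : ℤ) - m) d := by
      rw [Rat.divInt_eq_div, mkQ]; push_cast; rfl
    rcases Nat.eq_zero_or_pos d with rfl | hd
    · simp [mkQ]
    · constructor
      · have h1 : (mkQ p m d).num ∣ ((p : ℤ) - m) := by rw [h]; exact Rat.num_dvd _ (by positivity)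
        by_cases h0 : (p : ℤ) - m = 0
        · rw [h, h0]; simp
        · have := Int.natAbs_le_of_dvd_ne_zero h1 h0
          omega
      · have h1 : ((mkQ p m d).den : ℤ) ∣ d := by rw [h]; exact Rat.den_dvd _ _
        have := Nat.le_of_dvd hd (Int.natCast_dvd_natCast.1 h1)
        omega
  have h2 : encode (mkQ p m d).num ≤ 2 * (mkQ p m d).num.natAbs + 1 := by
    rcases encode_num_cases (mkQ p m d) with ⟨n, h, h'⟩ | ⟨n, h, h'⟩ <;> rw [h', h] <;> omega
  exact ((Nat.pair_lt_pair_left _ (by omega)).trans (Nat.pair_lt_pair_right _ (by omega))).le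

@[fun_prop] theorem primrec_mkQ {p m d : α → ℕ} (hp : Primrec p) (hm : Primrec m)
    (hd : Primrec d) : Primrec (fun x => mkQ (p x) (m x) (d x)) := by
  refine Primrec.encode_iff.1 (primrec_of_bounded_graph
    (b := fun x => Nat.pair (2 * (p x + m x) + 2) (d x + 2)) (by fun_prop)
    (fun x => codeRat_mkQ_le _ _ _) ?_)
  have : Primrec (fun a : α × ℕ => (decodeRat a.2).elim false fun q =>
      bif decide (0 < d a.1) then
        decide (p a.1 * q.den + negNum q * d a.1 = posNum q * d a.1 + m a.1 * q.den)
      else decide (q = 0)) := by fun_prop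
  refine this.of_eq fun a => ?_
  rw [Bool.eq_iff_iff, decide_eq_true_iff]
  cases h : (decodeRat a.2) with
  | none =>
    simp only [Option.elim, Bool.false_eq_true, false_iff]
    intro h'
    rw [← h', encode_rat, decodeRat_codeRat] at h
    cases h
  | some q =>
    have hq : codeRat q = a.2 := codeRat_of_decodeRat h
    have : codeRat (mkQ (p a.1) (m a.1) (d a.1)) = a.2 ↔ mkQ (p a.1) (m a.1) (d a.1) = q := by
      rw [← hq]
      exact (Encodable.encode_injective (α := ℚ)).eq_iff
    rw [encode_rat, this]
    rcases Nat.eq_zero_or_pos (d a.1) with h0 | h0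
    · simp [h0, mkQ, eq_comm]
    · rw [mkQ_eq_iff h0]
      simp [h0]

theorem den_ne (q : ℚ) : (q.den : ℚ) ≠ 0 := by have := q.den_pos; positivity

@[fun_prop] theorem primrec_rat_add {f g : α → ℚ} (hf : Primrec f) (hg : Primrec g) :
    Primrec (fun x => f x + g x) := by
  have : Primrec (fun x => mkQ (posNum (f x) * (g x).den + posNum (g x) * (f x).den)
    (negNum (f x) * (g x).den + negNum (g x) * (f x).den) ((f x).den * (g x).den)) := by fun_prop
  refine this.of_eq fun x => ?_
  conv_rhs => rw [eq_mkQ (f x), eq_mkQ (g x)]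
  have := den_ne (f x)
  have := den_ne (g x)
  simp only [mkQ]
  push_cast
  field_simp
  ring

@[fun_prop] theorem primrec_rat_mul {f g : α → ℚ} (hf : Primrec f) (hg : Primrec g) :
    Primrec (fun x => f x * g x) := by
  have : Primrec (fun x => mkQ (posNum (f x) * posNum (g x) + negNum (f x) * negNum (g x))
    (posNum (f x) * negNum (g x) + negNum (f x) * posNum (g x)) ((f x).den * (g x).den)) := by
    fun_prop
  refine this.of_eq fun x => ?_
  conv_rhs => rw [eq_mkQ (f x), eq_mkQ (g x)]
  have := den_ne (f x)
  have := den_ne (g x)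
  simp only [mkQ]
  push_cast
  field_simp
  ring

@[fun_prop] theorem primrec_rat_neg {f : α → ℚ} (hf : Primrec f) : Primrec (fun x => -f x) := by
  have : Primrec (fun x => mkQ (negNum (f x)) (posNum (f x)) (f x).den) := by fun_prop
  refine this.of_eq fun x => ?_
  conv_rhs => rw [eq_mkQ (f x)]
  simp only [mkQ]
  ring

@[fun_prop] theorem primrec_rat_sub {f g : α → ℚ} (hf : Primrec f) (hg : Primrec g) :
    Primrec (fun x => f x - g x) := by
  simp only [sub_eq_add_neg]; fun_prop

@[fun_prop] theorem primrec_rat_inv {f : α → ℚ} (hf : Primrec f) : Primrec (fun x => (f x)⁻¹) := by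
  have : Primrec (fun x => bif decide (0 < posNum (f x)) then mkQ (f x).den 0 (posNum (f x))
    else mkQ 0 (f x).den (negNum (f x))) := by fun_prop
  refine this.of_eq fun x => ?_
  conv_rhs => rw [eq_mkQ (f x)]
  have hz : posNum (f x) = 0 ∨ negNum (f x) = 0 := by unfold posNum negNum; omega
  rcases Nat.eq_zero_or_pos (posNum (f x)) with h | h
  · simp [h, mkQ, neg_div, inv_neg]
  · simp [h, hz.resolve_left h.ne', mkQ]

@[fun_prop] theorem primrec_rat_div {f g : α → ℚ} (hf : Primrec f) (hg : Primrec g) :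
    Primrec (fun x => f x / g x) := by
  simp only [div_eq_mul_inv]; fun_prop

@[fun_prop] theorem primrec_rat_natCast {f : α → ℕ} (hf : Primrec f) :
    Primrec (fun x => (f x : ℚ)) := by
  have : Primrec (fun x => mkQ (f x) 0 1) := by fun_prop
  exact this.of_eq fun x => by simp [mkQ]

theorem rat_lt_iff (p q : ℚ) :
    p < q ↔ posNum p * q.den + negNum q * p.den < posNum q * p.den + negNum p * q.den := by
  have h1 : (0 : ℚ) < p.den := by have := p.den_pos; positivity
  have h2 : (0 : ℚ) < q.den := by have := q.den_pos; positivity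
  conv_lhs => rw [eq_posNum_sub_negNum_div p, eq_posNum_sub_negNum_div q]
  rw [div_lt_div_iff₀ h1 h2]
  rw [← @Nat.cast_lt ℚ]
  push_cast
  constructor <;> intro h <;> linarith

/-- The order of the rational numbers as a test. -/
def ratLt (p q : ℚ) : Bool := decide (p < q)

/-- The order of the rational numbers as a test. -/
def ratLe (p q : ℚ) : Bool := decide (p ≤ q)

@[simp] theorem ratLt_eq_true {p q : ℚ} : ratLt p q = true ↔ p < q := decide_eq_true_iff

@[simp] theorem ratLe_eq_true {p q : ℚ} : ratLe p q = true ↔ p ≤ q := decide_eq_true_iff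

@[fun_prop] theorem primrec_ratLt {f g : α → ℚ} (hf : Primrec f) (hg : Primrec g) :
    Primrec (fun x => ratLt (f x) (g x)) := by
  simp only [ratLt, rat_lt_iff]; fun_prop

@[fun_prop] theorem primrec_ratLe {f g : α → ℚ} (hf : Primrec f) (hg : Primrec g) :
    Primrec (fun x => ratLe (f x) (g x)) := by
  have : Primrec (fun x => !ratLt (g x) (f x)) := by fun_prop
  exact this.of_eq fun x => by rw [Bool.eq_iff_iff]; simp [ratLt]

@[fun_prop] theorem primrec_rat_max {f g : α → ℚ} (hf : Primrec f) (hg : Primrec g) :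
    Primrec (fun x => max (f x) (g x)) := by
  have : Primrec (fun x => bif ratLe (f x) (g x) then g x else f x) := by fun_prop
  exact this.of_eq fun x => by
    by_cases h : f x ≤ g x
    · simp [ratLe, h]
    · simp [ratLe, h, (not_le.1 h).le]

@[fun_prop] theorem primrec_rat_abs {f : α → ℚ} (hf : Primrec f) : Primrec (fun x => |f x|) := by
  have : Primrec (fun x => max (f x) (-f x)) := by fun_prop
  exact this

end Rat

end KW

/-! ### Kleene's notations, their ranks, and the sets `H_a`. -/

namespace KW

/-! ### The order `<_𝓞` -/

theorem two_pow_inj {a b : ℕ} (h : 2 ^ a = 2 ^ b) : a = b := Nat.pow_right_injective le_rfl h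

theorem three_mul_five_pow_inj {a b : ℕ} (h : 3 * 5 ^ a = 3 * 5 ^ b) : a = b :=
  Nat.pow_right_injective (by norm_num : 2 ≤ 5) (by simpa using h)

theorem LtO.ne_zero {a b : ℕ} (h : LtO a b) : a ≠ 0 ∧ b ≠ 0 := by
  induction h with
  | one => decide
  | succ _ ih => exact ⟨ih.2, by positivity⟩
  | lim f hf _ n ih => exact ⟨(ih n).1, by positivity⟩
  | trans _ _ ih₁ ih₂ => exact ⟨ih₁.1, ih₂.2⟩

/-- `e` is an index of an increasing sequence of notations, with values `f`. -/
def IsFund (e : ℕ) (f : ℕ → ℕ) : Prop :=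
  (∀ n, f n ∈ phi e n) ∧ ∀ n, LtO (f n) (f (n + 1))

theorem IsFund.unique {e : ℕ} {f g : ℕ → ℕ} (hf : IsFund e f) (hg : IsFund e g) : f = g :=
  funext fun n => Part.mem_unique (hf.1 n) (hg.1 n)

theorem IsFund.lt {e : ℕ} {f : ℕ → ℕ} (hf : IsFund e f) (n : ℕ) : LtO (f n) (3 * 5 ^ e) :=
  .lim f hf.1 hf.2 n

/-- Inversion modulo transitivity: after composing, only the last rule that is not transitivity
determines the form of the upper element. -/
theorem LtO.cases_right {a b : ℕ} (h : LtO a b) :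
    (∃ c, b = 2 ^ c ∧ (a = c ∨ LtO a c)) ∨
      ∃ e f, b = 3 * 5 ^ e ∧ IsFund e f ∧ ∃ n, a = f n ∨ LtO a (f n) := by
  induction h with
  | one => exact Or.inl ⟨1, rfl, Or.inl rfl⟩
  | @succ a b _ _ => exact Or.inl ⟨b, rfl, Or.inl rfl⟩
  | @lim e f hf hlt n _ => exact Or.inr ⟨e, f, rfl, ⟨hf, hlt⟩, n, Or.inl rfl⟩
  | trans h₁ _ _ ih₂ =>
    rcases ih₂ with ⟨c, rfl, h⟩ | ⟨e, f, rfl, hf, n, h⟩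
    · exact Or.inl ⟨c, rfl, Or.inr (h.elim (fun h => h ▸ h₁) h₁.trans)⟩
    · exact Or.inr ⟨e, f, rfl, hf, n, Or.inr (h.elim (fun h => h ▸ h₁) h₁.trans)⟩

theorem LtO.of_two_pow {a c : ℕ} (h : LtO a (2 ^ c)) : a = c ∨ LtO a c := by
  rcases h.cases_right with ⟨c', hc, h⟩ | ⟨e, f, hc, -⟩
  · obtain rfl := two_pow_inj hc
    exact h
  · exact absurd hc (two_pow_ne _ _)

theorem LtO.of_lim {a e : ℕ} (h : LtO a (3 * 5 ^ e)) : ∃ f, IsFund e f ∧ ∃ n, LtO a (f n) := by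
  rcases h.cases_right with ⟨c', hc, h⟩ | ⟨e', f, hc, hf, n, h⟩
  · exact absurd hc.symm (two_pow_ne _ _)
  · obtain rfl := three_mul_five_pow_inj hc
    exact ⟨f, hf, n + 1, h.elim (fun h => h ▸ hf.2 n) fun h => h.trans (hf.2 n)⟩

theorem mem_kleeneO_left {a b : ℕ} (h : LtO a b) : a ∈ kleeneO := ⟨b, Or.inl h⟩

theorem mem_kleeneO_right {a b : ℕ} (h : LtO a b) : b ∈ kleeneO := ⟨a, Or.inr h⟩

theorem LtO.cases_field {a b : ℕ} (h : LtO a b) :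
    (b = 1 ∨ (∃ c, b = 2 ^ c ∧ c ∈ kleeneO) ∨ ∃ e f, b = 3 * 5 ^ e ∧ IsFund e f) ∧
    (a = 1 ∨ (∃ c, a = 2 ^ c ∧ c ∈ kleeneO) ∨ ∃ e f, a = 3 * 5 ^ e ∧ IsFund e f) := by
  induction h with
  | one => exact ⟨Or.inr (Or.inl ⟨1, rfl, mem_kleeneO_left .one⟩), Or.inl rfl⟩
  | succ h ih => exact ⟨Or.inr (Or.inl ⟨_, rfl, mem_kleeneO_right h⟩), ih.1⟩
  | @lim e f hf hlt n ih => exact ⟨Or.inr (Or.inr ⟨e, f, rfl, hf, hlt⟩), (ih n).2⟩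
  | trans h₁ _ ih₁ ih₂ => exact ⟨ih₂.1, ih₁.2⟩

theorem kleeneO_cases {a : ℕ} (h : a ∈ kleeneO) :
    a = 1 ∨ (∃ c, a = 2 ^ c ∧ c ∈ kleeneO) ∨ ∃ e f, a = 3 * 5 ^ e ∧ IsFund e f := by
  obtain ⟨b, h | h⟩ := h
  · exact h.cases_field.2
  · exact h.cases_field.1

theorem one_mem_kleeneO : 1 ∈ kleeneO := mem_kleeneO_left .one

theorem IsFund.mem {e : ℕ} {f : ℕ → ℕ} (hf : IsFund e f) : 3 * 5 ^ e ∈ kleeneO :=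
  mem_kleeneO_right (hf.lt 0)

theorem IsFund.apply_mem {e : ℕ} {f : ℕ → ℕ} (hf : IsFund e f) (n : ℕ) : f n ∈ kleeneO :=
  mem_kleeneO_left (hf.lt n)

theorem eq_one_or_exists_lt {a : ℕ} (ha : a ∈ kleeneO) : a = 1 ∨ ∃ z, LtO z a := by
  obtain ⟨b, h | h⟩ := ha
  · induction h with
    | one => exact Or.inl rfl
    | succ h _ => exact Or.inr ⟨_, h⟩
    | lim f hf hlt n ih => exact ih n
    | trans _ _ ih _ => exact ih
  · exact Or.inr ⟨b, h⟩

/-- The successor rule applies only to an element that has a predecessor. The one element of the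
field without a predecessor is `1`, and there the rule `1 <_𝓞 2` takes over. -/
theorem lt_two_pow_of_mem {c : ℕ} (hc : c ∈ kleeneO) : LtO c (2 ^ c) := by
  rcases eq_one_or_exists_lt hc with rfl | ⟨z, hz⟩
  · exact .one
  · exact .succ hz

theorem two_pow_mem {c : ℕ} (hc : c ∈ kleeneO) : 2 ^ c ∈ kleeneO :=
  mem_kleeneO_right (lt_two_pow_of_mem hc)

/-- The exclusion of `0` is essential: `2 ^ 0 = 1` is a notation and `0` is not. -/
theorem mem_of_two_pow_mem {c : ℕ} (hc : 2 ^ c ∈ kleeneO) (h1 : c ≠ 0) : c ∈ kleeneO := by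
  rcases kleeneO_cases hc with h | ⟨c', h, hc'⟩ | ⟨e, f, h, -⟩
  · simp [h1] at h
  · rwa [two_pow_inj h]
  · exact absurd h (two_pow_ne _ _)

theorem zero_notMem_kleeneO : 0 ∉ kleeneO := by
  rintro ⟨b, h | h⟩
  · exact h.ne_zero.1 rfl
  · exact h.ne_zero.2 rfl

theorem not_lt_one {a : ℕ} : ¬ LtO a 1 := by
  intro h
  rcases h.cases_right with ⟨c, hc, h'⟩ | ⟨e, f, hc, -⟩
  · have : c = 0 := by simpa using hc.symm
    subst this
    rcases h' with rfl | h'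
    · exact h.ne_zero.1 rfl
    · exact h'.ne_zero.2 rfl
  · omega

theorem exists_isFund_of_lim_mem {e : ℕ} (h : 3 * 5 ^ e ∈ kleeneO) : ∃ f, IsFund e f := by
  rcases kleeneO_cases h with h | ⟨c', h, -⟩ | ⟨e', f, h, hf⟩
  · omega
  · exact absurd h.symm (two_pow_ne _ _)
  · obtain rfl := three_mul_five_pow_inj h
    exact ⟨f, hf⟩

/-- What lies below `2 ^ c` is `c` or below `c`, and what lies below `3 * 5 ^ e` is below a member
of the sequence, so accessibility passes along each rule. -/
theorem LtO.acc {a b : ℕ} (h : LtO a b) : Acc LtO a ∧ Acc LtO b := by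
  induction h with
  | one =>
    have h1 : Acc LtO 1 := ⟨_, fun _ h => absurd h not_lt_one⟩
    refine ⟨h1, ⟨_, fun a h => ?_⟩⟩
    rcases LtO.of_two_pow (c := 1) h with rfl | h
    · exact h1
    · exact absurd h not_lt_one
  | @succ a b _ ih =>
    refine ⟨ih.2, ⟨_, fun a h => ?_⟩⟩
    rcases h.of_two_pow with rfl | h
    · exact ih.2
    · exact ih.2.inv h
  | @lim e f hf hlt n ih =>
    refine ⟨(ih n).1, ⟨_, fun a h => ?_⟩⟩
    obtain ⟨g, hg, m, h⟩ := h.of_lim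
    obtain rfl : f = g := IsFund.unique ⟨hf, hlt⟩ hg
    exact (ih m).1.inv h
  | trans _ _ ih₁ ih₂ => exact ⟨ih₁.1, ih₂.2⟩

theorem wellFounded_ltO : WellFounded LtO := ⟨fun b => ⟨b, fun _ h => h.acc.1⟩⟩

instance : IsWellFounded ℕ LtO := ⟨wellFounded_ltO⟩

/-- Induction on notations. -/
theorem kleeneO_induction {p : ℕ → Prop} (one : p 1)
    (succ : ∀ c, c ∈ kleeneO → p c → p (2 ^ c))
    (lim : ∀ e f, IsFund e f → (∀ n, p (f n)) → p (3 * 5 ^ e)) {a : ℕ} (ha : a ∈ kleeneO) :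
    p a := by
  induction a using wellFounded_ltO.induction with
  | _ a ih =>
    rcases kleeneO_cases ha with rfl | ⟨c, rfl, hc⟩ | ⟨e, f, rfl, hf⟩
    · exact one
    · exact succ c hc (ih c (lt_two_pow_of_mem hc) hc)
    · exact lim e f hf fun n => ih _ (hf.lt n) (hf.apply_mem n)

/-! ### Ranks of notations -/

/-- The ordinal denoted by a notation. -/
noncomputable def nrank (a : ℕ) : Ordinal.{0} := IsWellFounded.rank LtO a

theorem nrank_lt {a b : ℕ} (h : LtO a b) : nrank a < nrank b := IsWellFounded.rank_lt_of_rel h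

theorem nrank_le_iff {a : ℕ} {α : Ordinal} : nrank a ≤ α ↔ ∀ b, LtO b a → nrank b < α := by
  constructor
  · exact fun h b hb => (nrank_lt hb).trans_le h
  · intro h
    rw [nrank, IsWellFounded.rank_eq]
    refine Ordinal.iSup_le fun b => ?_
    exact Order.succ_le_of_lt (h b.1 b.2)

theorem nrank_one : nrank 1 = 0 :=
  le_antisymm (nrank_le_iff.2 fun _ h => absurd h not_lt_one) bot_le

theorem nrank_two_pow {c : ℕ} (hc : c ∈ kleeneO) : nrank (2 ^ c) = nrank c + 1 := by
  apply le_antisymm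
  · refine nrank_le_iff.2 fun b hb => ?_
    rw [← Order.succ_eq_add_one, Order.lt_succ_iff]
    rcases hb.of_two_pow with rfl | h
    · exact le_rfl
    · exact (nrank_lt h).le
  · exact Order.add_one_le_of_lt (nrank_lt (lt_two_pow_of_mem hc))

theorem IsFund.nrank_lt {e : ℕ} {f : ℕ → ℕ} (hf : IsFund e f) (n : ℕ) :
    nrank (f n) < nrank (3 * 5 ^ e) := KW.nrank_lt (hf.lt n)

theorem IsFund.lt_nrank {e : ℕ} {f : ℕ → ℕ} (hf : IsFund e f) {α : Ordinal}
    (h : α < nrank (3 * 5 ^ e)) : ∃ n, α < nrank (f n) := by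
  by_contra! hn
  refine absurd (nrank_le_iff.2 fun b hb => ?_) (not_le.2 h)
  obtain ⟨g, hg, m, hm⟩ := hb.of_lim
  obtain rfl := hf.unique hg
  exact (KW.nrank_lt hm).trans_le (hn m)

theorem IsFund.isSuccLimit {e : ℕ} {f : ℕ → ℕ} (hf : IsFund e f) :
    Order.IsSuccLimit (nrank (3 * 5 ^ e)) := by
  rw [Ordinal.isSuccLimit_iff, Order.isSuccPrelimit_iff_succ_lt]
  refine ⟨(bot_le.trans_lt (hf.nrank_lt 0)).ne', fun b hb => ?_⟩
  obtain ⟨n, hn⟩ := hf.lt_nrank hb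
  exact (Order.succ_le_of_lt hn).trans_lt (hf.nrank_lt n)

/-- By transitivity the predecessors of some `b <_𝓞 a` are also predecessors of `a`, so the
isomorphism maps them onto the ordinals below the image of `b`. Induction then identifies the
well-founded rank of `b` with that image. -/
theorem IsNotation.nrank_eq {a : ℕ} {α : Ordinal} (h : IsNotation a α) : nrank a = α := by
  obtain ⟨-, ⟨e⟩⟩ := h
  have key : ∀ b (hb : LtO b a), nrank b = (e ⟨b, hb⟩ : Ordinal) := by
    intro b
    induction b using wellFounded_ltO.induction with
    | _ b ih =>
      intro hb
      apply le_antisymm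
      · refine nrank_le_iff.2 fun c hc => ?_
        rw [ih c hc (hc.trans hb)]
        exact e.map_rel_iff.2 (show LtO _ _ from hc)
      · refine le_of_forall_lt fun γ hγ => ?_
        have hγα : γ < α := hγ.trans (e ⟨b, hb⟩).2
        obtain ⟨c, hc⟩ := e.surjective ⟨γ, hγα⟩
        have hcb : LtO c.1 b := e.map_rel_iff.1 (show e c < e ⟨b, hb⟩ by rw [hc]; exact hγ)
        have h := ih c.1 hcb c.2
        have h2 : (e ⟨c.1, c.2⟩ : Ordinal) = γ := by rw [hc]
        rw [h2] at h
        rw [← h]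
        exact nrank_lt hcb
  apply le_antisymm
  · exact nrank_le_iff.2 fun b hb => (key b hb).trans_lt (e ⟨b, hb⟩).2
  · refine le_of_forall_lt fun γ hγ => ?_
    obtain ⟨c, hc⟩ := e.surjective ⟨γ, hγ⟩
    have h := key c.1 c.2
    have h2 : (e ⟨c.1, c.2⟩ : Ordinal) = γ := by rw [hc]
    rw [h2] at h
    rw [← h]
    exact nrank_lt c.2

theorem IsNotation.eq_lim {a : ℕ} {l : Ordinal} (hl : Order.IsSuccLimit l)
    (h : IsNotation a l) : ∃ e f, a = 3 * 5 ^ e ∧ IsFund e f := by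
  have hr := h.nrank_eq
  rcases kleeneO_cases h.1 with rfl | ⟨c, rfl, hc⟩ | h
  · rw [nrank_one] at hr
    exact absurd hr.symm hl.ne_bot
  · rw [nrank_two_pow hc] at hr
    exact absurd hr (hl.isSuccPrelimit.succ_ne _)
  · exact h

/-! ### The sets `H_a` -/

theorem isH_H {a : ℕ} (ha : a ∈ kleeneO) : IsH a (H a) := (isH_iff ha _).2 rfl

theorem H_one : H 1 = ∅ := (isH_iff one_mem_kleeneO _).1 .one

theorem H_two_pow {c : ℕ} (hc : c ∈ kleeneO) : H (2 ^ c) = jump (H c) :=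
  (isH_iff (two_pow_mem hc) _).1 (isH_H hc).succ

theorem IsFund.H_eq {e : ℕ} {f : ℕ → ℕ} (hf : IsFund e f) :
    H (3 * 5 ^ e) = {m | ∃ x n, m = Nat.pair x n ∧ x ∈ H (f n)} :=
  (isH_iff hf.mem _).1 (.lim f hf.1 _ fun n => isH_H (hf.apply_mem n))

theorem IsFund.pair_mem_H {e : ℕ} {f : ℕ → ℕ} (hf : IsFund e f) (x n : ℕ) :
    Nat.pair x n ∈ H (3 * 5 ^ e) ↔ x ∈ H (f n) := by
  rw [hf.H_eq]
  constructor
  · rintro ⟨x', n', h, hx⟩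
    obtain ⟨rfl, rfl⟩ := Nat.pair_eq_pair.1 h
    exact hx
  · exact fun h => ⟨x, n, rfl, h⟩

theorem IsFund.mem_H {e : ℕ} {f : ℕ → ℕ} (hf : IsFund e f) (y : ℕ) :
    y ∈ H (3 * 5 ^ e) ↔ y.unpair.1 ∈ H (f y.unpair.2) := by
  rw [← hf.pair_mem_H, Nat.pair_unpair]

end KW

/-! ### Relative computability: the jump as an existential statement over finite derivations. -/

namespace KW

/-! ### Indices of oracle programs -/

namespace OCode

/-- Index of the program `pair`. -/
def idxPair (i j : ℕ) : ℕ := 4 * Nat.pair i j + 5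

/-- Index of the program `comp`. -/
def idxComp (i j : ℕ) : ℕ := 4 * Nat.pair i j + 7

/-- Index of the program `prec`. -/
def idxPrec (i j : ℕ) : ℕ := 4 * Nat.pair i j + 6

/-- Index of the program `rfind'`. -/
def idxRfind (i : ℕ) : ℕ := 4 * i + 8

theorem div2_div2 (m r : ℕ) (hr : r < 4) : (4 * m + r).div2.div2 = m := by
  simp only [Nat.div2_val]; omega

theorem ofNat_idxPair (i j : ℕ) : ofNat (idxPair i j) = pair (ofNat i) (ofNat j) := by
  have h1 : (4 * Nat.pair i j).bodd = false := by simp [Nat.bodd_mul]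
  have h2 : (4 * Nat.pair i j).div2 = 2 * Nat.pair i j := by simp only [Nat.div2_val]; omega
  have h3 := div2_div2 (Nat.pair i j) 0 (by norm_num)
  rw [add_zero] at h3
  rw [idxPair, ofNat]
  simp only [h1, h3]
  simp [h2, Nat.bodd_mul]

theorem ofNat_idxComp (i j : ℕ) : ofNat (idxComp i j) = comp (ofNat i) (ofNat j) := by
  have h1 : (4 * Nat.pair i j + 2).bodd = false := by simp [Nat.bodd_mul]
  have h2 : (4 * Nat.pair i j + 2).div2 = 2 * Nat.pair i j + 1 := by
    simp only [Nat.div2_val]; omega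
  have h3 := div2_div2 (Nat.pair i j) 2 (by norm_num)
  rw [h2] at h3
  rw [idxComp, show 4 * Nat.pair i j + 7 = 4 * Nat.pair i j + 2 + 5 from rfl, ofNat]
  simp only [h1, h2, h3]
  simp [Nat.bodd_mul]

theorem ofNat_idxPrec (i j : ℕ) : ofNat (idxPrec i j) = prec (ofNat i) (ofNat j) := by
  have h1 : (4 * Nat.pair i j + 1).bodd = true := by simp [Nat.bodd_mul]
  have h2 : (4 * Nat.pair i j + 1).div2 = 2 * Nat.pair i j := by
    simp only [Nat.div2_val]; omega
  have h3 := div2_div2 (Nat.pair i j) 1 (by norm_num)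
  rw [h2] at h3
  rw [idxPrec, show 4 * Nat.pair i j + 6 = 4 * Nat.pair i j + 1 + 5 from rfl, ofNat]
  simp only [h1, h2, h3]
  simp [Nat.bodd_mul]

theorem ofNat_idxRfind (i : ℕ) : ofNat (idxRfind i) = rfind' (ofNat i) := by
  have h1 : (4 * i + 3).bodd = true := by simp [Nat.bodd_mul]
  have h2 : (4 * i + 3).div2 = 2 * i + 1 := by simp only [Nat.div2_val]; omega
  have h3 := div2_div2 i 3 (by norm_num)
  rw [h2] at h3
  rw [idxRfind, show 4 * i + 8 = 4 * i + 3 + 5 from rfl, ofNat]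
  simp only [h1, h2, h3]
  simp [Nat.bodd_mul]

theorem index_cases (m : ℕ) : m = 0 ∨ m = 1 ∨ m = 2 ∨ m = 3 ∨ m = 4 ∨
    (∃ i j, m = idxPair i j) ∨ (∃ i j, m = idxComp i j) ∨ (∃ i j, m = idxPrec i j) ∨
    ∃ i, m = idxRfind i := by
  by_cases h : m < 5
  · omega
  · have hp : Nat.pair ((m - 5) / 4).unpair.1 ((m - 5) / 4).unpair.2 = (m - 5) / 4 :=
      Nat.pair_unpair _
    have h4 : (m - 5) % 4 < 4 := Nat.mod_lt _ (by norm_num)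
    have hdm := Nat.div_add_mod (m - 5) 4
    obtain h | h | h | h : (m - 5) % 4 = 0 ∨ (m - 5) % 4 = 1 ∨ (m - 5) % 4 = 2 ∨ (m - 5) % 4 = 3 := by
      omega
    · right; right; right; right; right; left
      exact ⟨_, _, by rw [idxPair, hp]; omega⟩
    · right; right; right; right; right; right; right; left
      exact ⟨_, _, by rw [idxPrec, hp]; omega⟩
    · right; right; right; right; right; right; left
      exact ⟨_, _, by rw [idxComp, hp]; omega⟩
    · right; right; right; right; right; right; right; right
      exact ⟨(m - 5) / 4, by rw [idxRfind]; omega⟩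

theorem exists_index (c : OCode) : ∃ m, ofNat m = c := by
  induction c with
  | zero => exact ⟨0, by rw [ofNat]⟩
  | succ => exact ⟨1, by rw [ofNat]⟩
  | left => exact ⟨2, by rw [ofNat]⟩
  | right => exact ⟨3, by rw [ofNat]⟩
  | oracle => exact ⟨4, by rw [ofNat]⟩
  | pair f g hf hg =>
    obtain ⟨i, rfl⟩ := hf
    obtain ⟨j, rfl⟩ := hg
    exact ⟨_, ofNat_idxPair i j⟩
  | comp f g hf hg =>
    obtain ⟨i, rfl⟩ := hf
    obtain ⟨j, rfl⟩ := hg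
    exact ⟨_, ofNat_idxComp i j⟩
  | prec f g hf hg =>
    obtain ⟨i, rfl⟩ := hf
    obtain ⟨j, rfl⟩ := hg
    exact ⟨_, ofNat_idxPrec i j⟩
  | rfind' f hf =>
    obtain ⟨i, rfl⟩ := hf
    exact ⟨_, ofNat_idxRfind i⟩

/-! ### One-step unfolding of oracle computations -/

variable {X : Set ℕ}

theorem mem_eval_pair {f g : OCode} {n v : ℕ} :
    v ∈ eval X (pair f g) n ↔ v.unpair.1 ∈ eval X f n ∧ v.unpair.2 ∈ eval X g n := by
  simp only [eval, Seq.seq, Part.map_eq_map, Part.mem_bind_iff, Part.mem_map_iff]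
  constructor
  · rintro ⟨_, ⟨a, ha, rfl⟩, b, hb, rfl⟩
    simpa using ⟨ha, hb⟩
  · rintro ⟨h1, h2⟩
    exact ⟨_, ⟨_, h1, rfl⟩, _, h2, Nat.pair_unpair v⟩

theorem mem_eval_oracle {n v : ℕ} :
    v ∈ eval X oracle n ↔ (n ∈ X ∧ v = 1) ∨ (n ∉ X ∧ v = 0) := by
  classical
  rw [eval]
  by_cases h : n ∈ X
  · simp only [h, if_true, Part.one_def, Part.mem_some_iff]
    simp
  · simp only [h, if_false, Part.zero_def, Part.mem_some_iff]
    simp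

theorem mem_eval_comp {f g : OCode} {n v : ℕ} :
    v ∈ eval X (comp f g) n ↔ ∃ w, w ∈ eval X g n ∧ v ∈ eval X f w := by
  show v ∈ (eval X g n).bind (eval X f) ↔ _
  exact Part.mem_bind_iff

theorem mem_eval_prec_zero {f g : OCode} {a v : ℕ} :
    v ∈ eval X (prec f g) (Nat.pair a 0) ↔ v ∈ eval X f a := by
  simp [eval]

theorem mem_eval_prec_succ {f g : OCode} {a y v : ℕ} :
    v ∈ eval X (prec f g) (Nat.pair a (y + 1)) ↔
      ∃ i, i ∈ eval X (prec f g) (Nat.pair a y) ∧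
        v ∈ eval X g (Nat.pair a (Nat.pair y i)) := by
  simp [eval]

theorem mem_eval_rfind {f : OCode} {a m v : ℕ} :
    v ∈ eval X (rfind' f) (Nat.pair a m) ↔
      m ≤ v ∧ 0 ∈ eval X f (Nat.pair a v) ∧
        ∀ j, m ≤ j → j < v → ∃ u, u + 1 ∈ eval X f (Nat.pair a j) := by
  have hE : eval X (rfind' f) (Nat.pair a m) =
      (Nat.rfind fun n => (eval X f (Nat.pair a (n + m))).map fun m => decide (m = 0)).map
        (· + m) := by
    simp only [eval, Nat.unpaired, Nat.unpair_pair]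
    rfl
  rw [hE, Part.mem_map_iff]
  constructor
  · rintro ⟨t, ht, rfl⟩
    obtain ⟨h1, h2⟩ := Nat.mem_rfind.1 ht
    obtain ⟨w, hw, hw0⟩ := (Part.mem_map_iff _).1 h1
    have : w = 0 := by simpa using hw0
    subst this
    refine ⟨Nat.le_add_left _ _, hw, fun j hj hjt => ?_⟩
    obtain ⟨w, hw, hw0⟩ := (Part.mem_map_iff _).1 (h2 (m := j - m) (by omega))
    have h0 : w ≠ 0 := by simpa using hw0
    obtain ⟨u, rfl⟩ := Nat.exists_eq_succ_of_ne_zero h0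
    rw [Nat.sub_add_cancel hj] at hw
    exact ⟨u, hw⟩
  · rintro ⟨h1, h2, h3⟩
    refine ⟨v - m, Nat.mem_rfind.2 ⟨(Part.mem_map_iff _).2 ⟨0, by rwa [Nat.sub_add_cancel h1],
      by simp⟩, fun {j} hj => (Part.mem_map_iff _).2 ?_⟩, by omega⟩
    obtain ⟨u, hu⟩ := h3 (j + m) (by omega) (by omega)
    exact ⟨u + 1, hu, by simp⟩

/-! ### Finite derivations of oracle computations -/

/-- Rule for the basic programs; every answer `0` or `1` of the oracle is accepted. -/
def ruleBasic (m n v : ℕ) : Bool :=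
  (decide (m = 0) && decide (v = 0)) ||
  (decide (m = 1) && decide (v = n + 1)) ||
  (decide (m = 2) && decide (v = n.unpair.1)) ||
  (decide (m = 3) && decide (v = n.unpair.2)) ||
  (decide (m = 4) && decide (v ≤ 1))

/-- Rule for `pair`. -/
def rulePair (l : List (ℕ × ℕ × ℕ)) (m i j n v : ℕ) : Bool :=
  decide (m = idxPair i j) && decide ((i, n, v.unpair.1) ∈ l) && decide ((j, n, v.unpair.2) ∈ l)

/-- Rule for `comp`. -/
def ruleComp (l : List (ℕ × ℕ × ℕ)) (m i j n v : ℕ) : Bool :=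
  decide (m = idxComp i j) &&
    l.any fun e => decide ((j, n, e.2.2) ∈ l) && decide ((i, e.2.2, v) ∈ l)

/-- Rule for `prec`. -/
def rulePrec (l : List (ℕ × ℕ × ℕ)) (m i j a k v : ℕ) : Bool :=
  decide (m = idxPrec i j) && ((decide (k = 0) && decide ((i, a, v) ∈ l)) ||
    (decide (0 < k) && l.any fun e => decide ((m, Nat.pair a (k - 1), e.2.2) ∈ l) &&
       decide ((j, Nat.pair a (Nat.pair (k - 1) e.2.2), v) ∈ l)))

/-- Rule for `rfind'`. -/
def ruleRfind (l : List (ℕ × ℕ × ℕ)) (m i a k v : ℕ) : Bool :=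
  decide (m = idxRfind i) && ((decide (v = k) && decide ((i, Nat.pair a k, 0) ∈ l)) ||
     ((l.any fun e => decide ((i, Nat.pair a k, e.2.2) ∈ l) && decide (0 < e.2.2)) &&
      decide ((m, Nat.pair a (k + 1), v) ∈ l)))

/-- The entry `(m, n, v)`, which says that the program with index `m` maps `n` to `v`, follows in
one step from the entries of `l`. -/
def justified (l : List (ℕ × ℕ × ℕ)) (m n v : ℕ) : Bool :=
  ruleBasic m n v ||
  rulePair l m ((m - 5) / 4).unpair.1 ((m - 5) / 4).unpair.2 n v ||
  ruleComp l m ((m - 5) / 4).unpair.1 ((m - 5) / 4).unpair.2 n v ||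
  rulePrec l m ((m - 5) / 4).unpair.1 ((m - 5) / 4).unpair.2 n.unpair.1 n.unpair.2 v ||
  ruleRfind l m ((m - 5) / 4) n.unpair.1 n.unpair.2 v

/-- Each entry of `l` is justified by the later ones. -/
def isDerivation (l : List (ℕ × ℕ × ℕ)) : Bool :=
  List.rec (motive := fun _ => Bool) true
    (fun e l r => justified l e.1 e.2.1 e.2.2 && r) l

section

variable {α : Type*} [Primcodable α] {l : α → List (ℕ × ℕ × ℕ)} {m i j n a k v : α → ℕ}

@[fun_prop] theorem primrec_ruleBasic (hm : Primrec m) (hn : Primrec n) (hv : Primrec v) :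
    Primrec (fun x => ruleBasic (m x) (n x) (v x)) := by
  unfold ruleBasic; fun_prop

@[fun_prop] theorem primrec_rulePair (hl : Primrec l) (hm : Primrec m) (hi : Primrec i)
    (hj : Primrec j) (hn : Primrec n) (hv : Primrec v) :
    Primrec (fun x => rulePair (l x) (m x) (i x) (j x) (n x) (v x)) := by
  unfold rulePair idxPair; fun_prop

@[fun_prop] theorem primrec_ruleComp (hl : Primrec l) (hm : Primrec m) (hi : Primrec i)
    (hj : Primrec j) (hn : Primrec n) (hv : Primrec v) :
    Primrec (fun x => ruleComp (l x) (m x) (i x) (j x) (n x) (v x)) := by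
  unfold ruleComp idxComp; fun_prop

@[fun_prop] theorem primrec_rulePrec (hl : Primrec l) (hm : Primrec m) (hi : Primrec i)
    (hj : Primrec j) (ha : Primrec a) (hk : Primrec k) (hv : Primrec v) :
    Primrec (fun x => rulePrec (l x) (m x) (i x) (j x) (a x) (k x) (v x)) := by
  unfold rulePrec idxPrec; fun_prop

@[fun_prop] theorem primrec_ruleRfind (hl : Primrec l) (hm : Primrec m) (hi : Primrec i)
    (ha : Primrec a) (hk : Primrec k) (hv : Primrec v) :
    Primrec (fun x => ruleRfind (l x) (m x) (i x) (a x) (k x) (v x)) := by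
  unfold ruleRfind idxRfind; fun_prop

@[fun_prop] theorem primrec_justified (hl : Primrec l) (hm : Primrec m) (hn : Primrec n)
    (hv : Primrec v) : Primrec (fun x => justified (l x) (m x) (n x) (v x)) := by
  unfold justified; fun_prop

@[fun_prop] theorem primrec_isDerivation (hl : Primrec l) :
    Primrec (fun x => isDerivation (l x)) := by
  unfold isDerivation; fun_prop

end

/-- The oracle answers used in a derivation are those of `X`. -/
def Correct (X : Set ℕ) (l : List (ℕ × ℕ × ℕ)) : Prop :=
  ∀ e ∈ l, e.1 = 4 → (e.2.2 = 1 ↔ e.2.1 ∈ X)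

theorem justified_idxPair {l : List (ℕ × ℕ × ℕ)} {i j n v : ℕ} :
    justified l (idxPair i j) n v = true ↔ (i, n, v.unpair.1) ∈ l ∧ (j, n, v.unpair.2) ∈ l := by
  have h : (idxPair i j - 5) / 4 = Nat.pair i j := by simp only [idxPair]; omega
  have h0 : ruleBasic (idxPair i j) n v = false := by simp [ruleBasic, idxPair]
  have h1 : idxPair i j ≠ idxComp i j := by simp only [idxPair, idxComp]; omega
  have h2 : idxPair i j ≠ idxPrec i j := by simp only [idxPair, idxPrec]; omega
  have h3 : idxPair i j ≠ idxRfind (Nat.pair i j) := by simp only [idxPair, idxRfind]; omega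
  simp [justified, h, h0, rulePair, ruleComp, rulePrec, ruleRfind, h1, h2, h3]

theorem justified_idxComp {l : List (ℕ × ℕ × ℕ)} {i j n v : ℕ} :
    justified l (idxComp i j) n v = true ↔ ∃ w, (j, n, w) ∈ l ∧ (i, w, v) ∈ l := by
  have h : (idxComp i j - 5) / 4 = Nat.pair i j := by simp only [idxComp]; omega
  have h0 : ruleBasic (idxComp i j) n v = false := by simp [ruleBasic, idxComp]
  have h1 : idxComp i j ≠ idxPair i j := by simp only [idxPair, idxComp]; omega
  have h2 : idxComp i j ≠ idxPrec i j := by simp only [idxComp, idxPrec]; omega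
  have h3 : idxComp i j ≠ idxRfind (Nat.pair i j) := by simp only [idxComp, idxRfind]; omega
  simp only [justified, h, h0, rulePair, ruleComp, rulePrec, ruleRfind, h1, h2, h3,
    Nat.unpair_pair]
  simp only [decide_false, decide_true, Bool.false_and, Bool.true_and, Bool.or_false,
    Bool.false_or, List.any_eq_true, Bool.and_eq_true, decide_eq_true_eq]
  exact ⟨fun ⟨e, _, h⟩ => ⟨e.2.2, h⟩, fun ⟨w, h⟩ => ⟨_, h.1, h⟩⟩

theorem justified_idxPrec {l : List (ℕ × ℕ × ℕ)} {i j a k v : ℕ} :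
    justified l (idxPrec i j) (Nat.pair a k) v = true ↔ (k = 0 ∧ (i, a, v) ∈ l) ∨
      (0 < k ∧ ∃ w, (idxPrec i j, Nat.pair a (k - 1), w) ∈ l ∧
        (j, Nat.pair a (Nat.pair (k - 1) w), v) ∈ l) := by
  have h : (idxPrec i j - 5) / 4 = Nat.pair i j := by simp only [idxPrec]; omega
  have h0 : ruleBasic (idxPrec i j) (Nat.pair a k) v = false := by simp [ruleBasic, idxPrec]
  have h1 : idxPrec i j ≠ idxPair i j := by simp only [idxPair, idxPrec]; omega
  have h2 : idxPrec i j ≠ idxComp i j := by simp only [idxComp, idxPrec]; omega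
  have h3 : idxPrec i j ≠ idxRfind (Nat.pair i j) := by simp only [idxPrec, idxRfind]; omega
  simp only [justified, h, h0, rulePair, ruleComp, rulePrec, ruleRfind, h1, h2, h3,
    Nat.unpair_pair]
  simp only [decide_false, decide_true, Bool.false_and, Bool.true_and, Bool.or_false,
    Bool.false_or, List.any_eq_true, Bool.and_eq_true, decide_eq_true_eq, Bool.or_eq_true]
  exact or_congr Iff.rfl (and_congr Iff.rfl
    ⟨fun ⟨e, _, h⟩ => ⟨e.2.2, h⟩, fun ⟨w, h⟩ => ⟨_, h.1, h⟩⟩)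

theorem justified_idxRfind {l : List (ℕ × ℕ × ℕ)} {i a k v : ℕ} :
    justified l (idxRfind i) (Nat.pair a k) v = true ↔ (v = k ∧ (i, Nat.pair a k, 0) ∈ l) ∨
      ((∃ u, (i, Nat.pair a k, u + 1) ∈ l) ∧ (idxRfind i, Nat.pair a (k + 1), v) ∈ l) := by
  have h : (idxRfind i - 5) / 4 = i := by simp only [idxRfind]; omega
  have h0 : ruleBasic (idxRfind i) (Nat.pair a k) v = false := by simp [ruleBasic, idxRfind]
  have h1 : idxRfind i ≠ idxPair i.unpair.1 i.unpair.2 := by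
    simp only [idxPair, idxRfind, Nat.pair_unpair]; omega
  have h2 : idxRfind i ≠ idxComp i.unpair.1 i.unpair.2 := by
    simp only [idxComp, idxRfind, Nat.pair_unpair]; omega
  have h3 : idxRfind i ≠ idxPrec i.unpair.1 i.unpair.2 := by
    simp only [idxPrec, idxRfind, Nat.pair_unpair]; omega
  simp only [justified, h, h0, rulePair, ruleComp, rulePrec, ruleRfind, h1, h2, h3,
    Nat.unpair_pair]
  simp only [decide_false, decide_true, Bool.false_and, Bool.true_and,
    Bool.false_or, List.any_eq_true, Bool.and_eq_true, decide_eq_true_eq, Bool.or_eq_true]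
  refine or_congr Iff.rfl (and_congr ⟨fun ⟨e, _, h, h'⟩ => ⟨e.2.2 - 1, ?_⟩, fun ⟨w, h⟩ => ?_⟩
    Iff.rfl)
  · rwa [Nat.sub_add_cancel h']
  · exact ⟨_, h, h, Nat.succ_pos _⟩

theorem justified_of_lt {l : List (ℕ × ℕ × ℕ)} {m n v : ℕ} (hm : m < 5) :
    justified l m n v = ruleBasic m n v := by
  have h1 : ∀ i j, m ≠ idxPair i j := fun i j => by simp only [idxPair]; omega
  have h2 : ∀ i j, m ≠ idxComp i j := fun i j => by simp only [idxComp]; omega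
  have h3 : ∀ i j, m ≠ idxPrec i j := fun i j => by simp only [idxPrec]; omega
  have h4 : ∀ i, m ≠ idxRfind i := fun i => by simp only [idxRfind]; omega
  simp [justified, rulePair, ruleComp, rulePrec, ruleRfind, h1, h2, h3, h4]

theorem justified_mono {l l' : List (ℕ × ℕ × ℕ)} (hl : l ⊆ l') {m n v : ℕ}
    (h : justified l m n v = true) : justified l' m n v = true := by
  by_cases hm : m < 5
  · rwa [justified_of_lt hm] at h ⊢
  · obtain ⟨a, k, rfl⟩ : ∃ a k, n = Nat.pair a k := ⟨_, _, (Nat.pair_unpair n).symm⟩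
    rcases index_cases m with rfl | rfl | rfl | rfl | rfl | ⟨i, j, rfl⟩ | ⟨i, j, rfl⟩ |
      ⟨i, j, rfl⟩ | ⟨i, rfl⟩
    iterate 5 omega
    · rw [justified_idxPair] at h ⊢
      exact ⟨hl h.1, hl h.2⟩
    · rw [justified_idxComp] at h ⊢
      exact h.imp fun w h => ⟨hl h.1, hl h.2⟩
    · rw [justified_idxPrec] at h ⊢
      exact h.imp (And.imp_right fun h => hl h)
        (And.imp_right fun h => h.imp fun w h => ⟨hl h.1, hl h.2⟩)
    · rw [justified_idxRfind] at h ⊢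
      exact h.imp (And.imp_right fun h => hl h) (And.imp (fun h => h.imp fun u h => hl h)
        fun h => hl h)

theorem isDerivation_cons {e : ℕ × ℕ × ℕ} {l : List (ℕ × ℕ × ℕ)} :
    isDerivation (e :: l) = true ↔
      justified l e.1 e.2.1 e.2.2 = true ∧ isDerivation l = true := by
  rw [← Bool.and_eq_true]; rfl

theorem isDerivation_append {l₁ l₂ : List (ℕ × ℕ × ℕ)} (h₁ : isDerivation l₁ = true)
    (h₂ : isDerivation l₂ = true) : isDerivation (l₁ ++ l₂) = true := by
  induction l₁ with
  | nil => exact h₂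
  | cons e l ih =>
    rw [isDerivation_cons] at h₁
    rw [List.cons_append, isDerivation_cons]
    exact ⟨justified_mono (List.subset_append_left _ _) h₁.1, ih h₁.2⟩

theorem Correct.append {l₁ l₂ : List (ℕ × ℕ × ℕ)} (h₁ : Correct X l₁) (h₂ : Correct X l₂) :
    Correct X (l₁ ++ l₂) := fun e he => (List.mem_append.1 he).elim (h₁ e) (h₂ e)

theorem Correct.cons {l : List (ℕ × ℕ × ℕ)} {m n v : ℕ} (hm : m ≠ 4) (h : Correct X l) :
    Correct X ((m, n, v) :: l) := by
  intro e he h4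
  rcases List.mem_cons.1 he with rfl | he
  · exact absurd h4 hm
  · exact h e he h4

/-- The head of a derivation is justified by the tail, whose entries are sound by induction. The
oracle enters only through the correctness of the recorded answers. -/
theorem mem_eval_of_isDerivation {l : List (ℕ × ℕ × ℕ)} (hl : isDerivation l = true)
    (hX : Correct X l) : ∀ m n v, (m, n, v) ∈ l → v ∈ eval X (ofNat m) n := by
  induction l with
  | nil => simp
  | cons e l ih =>
    rw [isDerivation_cons] at hl
    have ih' := ih hl.2 fun e he => hX e (List.mem_cons_of_mem _ he)
    intro m n v hmem
    rcases List.mem_cons.1 hmem with h | h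
    · subst h
      have hj := hl.1
      by_cases hm : m < 5
      · rw [justified_of_lt hm] at hj
        have h4 : m = 4 → (v = 1 ↔ n ∈ X) := hX _ hmem
        simp only [ruleBasic, Bool.or_eq_true, Bool.and_eq_true, decide_eq_true_eq] at hj
        rcases hj with (((⟨rfl, rfl⟩ | ⟨rfl, rfl⟩) | ⟨rfl, rfl⟩) | ⟨rfl, rfl⟩) | ⟨rfl, hv⟩
        · rw [ofNat]; simp [eval]; exact Part.mem_some _
        · rw [ofNat]; simp [eval]
        · rw [ofNat]; simp [eval]
        · rw [ofNat]; simp [eval]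
        · rw [ofNat]
          have h4 := h4 rfl
          rw [mem_eval_oracle]
          by_cases h : n ∈ X
          · exact Or.inl ⟨h, h4.2 h⟩
          · have : v ≠ 1 := fun h' => h (h4.1 h')
            exact Or.inr ⟨h, by omega⟩
      · obtain ⟨a, k, rfl⟩ : ∃ a k, n = Nat.pair a k := ⟨_, _, (Nat.pair_unpair n).symm⟩
        rcases index_cases m with rfl | rfl | rfl | rfl | rfl | ⟨i, j, rfl⟩ | ⟨i, j, rfl⟩ |
          ⟨i, j, rfl⟩ | ⟨i, rfl⟩
        iterate 5 omega
        · rw [justified_idxPair] at hj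
          rw [ofNat_idxPair, mem_eval_pair]
          exact ⟨ih' _ _ _ hj.1, ih' _ _ _ hj.2⟩
        · obtain ⟨w, h1, h2⟩ := justified_idxComp.1 hj
          rw [ofNat_idxComp, mem_eval_comp]
          exact ⟨w, ih' _ _ _ h1, ih' _ _ _ h2⟩
        · rcases justified_idxPrec.1 hj with ⟨rfl, h⟩ | ⟨hk, w, h1, h2⟩
          · rw [ofNat_idxPrec, mem_eval_prec_zero]
            exact ih' _ _ _ h
          · obtain ⟨y, rfl⟩ := Nat.exists_eq_succ_of_ne_zero hk.ne'
            have h1 := ih' _ _ _ h1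
            rw [ofNat_idxPrec] at h1 ⊢
            exact mem_eval_prec_succ.2 ⟨w, h1, ih' _ _ _ h2⟩
        · rcases justified_idxRfind.1 hj with ⟨h', h⟩ | ⟨⟨u, h1⟩, h2⟩
          · obtain rfl : v = k := h'
            rw [ofNat_idxRfind, mem_eval_rfind]
            exact ⟨le_rfl, ih' _ _ _ h, fun j h1 h2 => by omega⟩
          · have h2 := ih' _ _ _ h2
            rw [ofNat_idxRfind, mem_eval_rfind] at h2 ⊢
            have hkv : k + 1 ≤ v := h2.1
            refine ⟨by omega, h2.2.1, fun j hj hjv => ?_⟩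
            rcases hj.eq_or_lt with rfl | hj
            · exact ⟨u, ih' _ _ _ h1⟩
            · exact h2.2.2 j hj hjv
    · exact ih' m n v h

/-- Derivations of the parts are concatenated. Subprograms have smaller indices. In the cases of
`prec` and `rfind'` the same index recurs, which calls for an inner induction on the recursion
argument or on the distance to the value found. -/
theorem exists_derivation (m : ℕ) : ∀ n v, v ∈ eval X (ofNat m) n →
    ∃ l, isDerivation l = true ∧ Correct X l ∧ (m, n, v) ∈ l := by
  induction m using Nat.strong_induction_on with
  | _ m ih =>
    intro n v hv
    have basic : m ≠ 4 → ruleBasic m n v = true → m < 5 →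
        ∃ l, isDerivation l = true ∧ Correct X l ∧ (m, n, v) ∈ l := fun h4 h hm =>
      ⟨[(m, n, v)], isDerivation_cons.2 ⟨by rwa [justified_of_lt hm], rfl⟩,
        Correct.cons h4 (by simp [Correct]), by simp⟩
    rcases index_cases m with rfl | rfl | rfl | rfl | rfl | ⟨i, j, rfl⟩ | ⟨i, j, rfl⟩ |
      ⟨i, j, rfl⟩ | ⟨i, rfl⟩
    · refine basic (by decide) ?_ (by decide)
      rw [ofNat, eval] at hv
      simpa [ruleBasic] using Part.mem_some_iff.1 hv
    · refine basic (by decide) ?_ (by decide)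
      rw [ofNat, eval] at hv
      simpa [ruleBasic] using hv
    · refine basic (by decide) ?_ (by decide)
      rw [ofNat, eval] at hv
      simpa [ruleBasic] using hv
    · refine basic (by decide) ?_ (by decide)
      rw [ofNat, eval] at hv
      simpa [ruleBasic] using hv
    · rw [ofNat, mem_eval_oracle] at hv
      refine ⟨[(4, n, v)], isDerivation_cons.2 ⟨?_, rfl⟩, ?_, by simp⟩
      · rw [justified_of_lt (by norm_num)]
        rcases hv with ⟨-, rfl⟩ | ⟨-, rfl⟩ <;> simp [ruleBasic]
      · intro e he _
        obtain rfl := List.mem_singleton.1 he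
        rcases hv with ⟨h, rfl⟩ | ⟨h, rfl⟩ <;> simp [h]
    · rw [ofNat_idxPair, mem_eval_pair] at hv
      have hi : i < idxPair i j := by have := Nat.left_le_pair i j; simp only [idxPair]; omega
      have hj : j < idxPair i j := by have := Nat.right_le_pair i j; simp only [idxPair]; omega
      obtain ⟨l₁, d₁, c₁, m₁⟩ := ih i hi _ _ hv.1
      obtain ⟨l₂, d₂, c₂, m₂⟩ := ih j hj _ _ hv.2
      refine ⟨(idxPair i j, n, v) :: (l₁ ++ l₂), isDerivation_cons.2
        ⟨justified_idxPair.2 ⟨?_, ?_⟩, isDerivation_append d₁ d₂⟩,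
        (c₁.append c₂).cons (by simp only [idxPair]; omega), by simp⟩
      · exact List.mem_append_left _ m₁
      · exact List.mem_append_right _ m₂
    · rw [ofNat_idxComp, mem_eval_comp] at hv
      obtain ⟨w, hw, hv⟩ := hv
      have hi : i < idxComp i j := by have := Nat.left_le_pair i j; simp only [idxComp]; omega
      have hj : j < idxComp i j := by have := Nat.right_le_pair i j; simp only [idxComp]; omega
      obtain ⟨l₁, d₁, c₁, m₁⟩ := ih i hi _ _ hv
      obtain ⟨l₂, d₂, c₂, m₂⟩ := ih j hj _ _ hw
      refine ⟨(idxComp i j, n, v) :: (l₁ ++ l₂), isDerivation_cons.2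
        ⟨justified_idxComp.2 ⟨w, ?_, ?_⟩, isDerivation_append d₁ d₂⟩,
        (c₁.append c₂).cons (by simp only [idxComp]; omega), by simp⟩
      · exact List.mem_append_right _ m₂
      · exact List.mem_append_left _ m₁
    · have hi : i < idxPrec i j := by have := Nat.left_le_pair i j; simp only [idxPrec]; omega
      have hj : j < idxPrec i j := by have := Nat.right_le_pair i j; simp only [idxPrec]; omega
      obtain ⟨a, k, rfl⟩ : ∃ a k, n = Nat.pair a k := ⟨_, _, (Nat.pair_unpair n).symm⟩
      clear basic
      induction k generalizing v with
      | zero =>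
        rw [ofNat_idxPrec, mem_eval_prec_zero] at hv
        obtain ⟨l₁, d₁, c₁, m₁⟩ := ih i hi _ _ hv
        have hd : justified l₁ (idxPrec i j) (Nat.pair a 0) v = true :=
          justified_idxPrec.2 (Or.inl ⟨rfl, m₁⟩)
        exact ⟨(idxPrec i j, Nat.pair a 0, v) :: l₁, isDerivation_cons.2 ⟨hd, d₁⟩,
          c₁.cons (by simp only [idxPrec]; omega), by simp⟩
      | succ k ihk =>
        rw [ofNat_idxPrec, mem_eval_prec_succ] at hv
        obtain ⟨w, hw, hv⟩ := hv
        rw [← ofNat_idxPrec] at hw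
        obtain ⟨l₁, d₁, c₁, m₁⟩ := ihk _ hw
        obtain ⟨l₂, d₂, c₂, m₂⟩ := ih j hj _ _ hv
        have hd : justified (l₁ ++ l₂) (idxPrec i j) (Nat.pair a (k + 1)) v = true := by
          refine justified_idxPrec.2 (Or.inr ⟨Nat.succ_pos _, w, ?_, ?_⟩) <;>
            rw [Nat.add_sub_cancel]
          · exact List.mem_append_left _ m₁
          · exact List.mem_append_right _ m₂
        exact ⟨(idxPrec i j, Nat.pair a (k + 1), v) :: (l₁ ++ l₂), isDerivation_cons.2
          ⟨hd, isDerivation_append d₁ d₂⟩,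
          (c₁.append c₂).cons (by simp only [idxPrec]; omega), by simp⟩
    · have hi : i < idxRfind i := by simp only [idxRfind]; omega
      obtain ⟨a, k, rfl⟩ : ∃ a k, n = Nat.pair a k := ⟨_, _, (Nat.pair_unpair n).symm⟩
      rw [ofNat_idxRfind, mem_eval_rfind] at hv
      obtain ⟨hkv, h0, h1⟩ := hv
      clear basic
      obtain ⟨t, rfl⟩ := Nat.exists_eq_add_of_le hkv
      induction t generalizing k with
      | zero =>
        obtain ⟨l₁, d₁, c₁, m₁⟩ := ih i hi _ _ h0
        exact ⟨(idxRfind i, Nat.pair a k, k + 0) :: l₁, isDerivation_cons.2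
          ⟨justified_idxRfind.2 (Or.inl ⟨rfl, m₁⟩), d₁⟩,
          c₁.cons (by simp only [idxRfind]; omega), by simp⟩
      | succ t iht =>
        have e : k + (t + 1) = k + 1 + t := by omega
        rw [e] at h0 h1 ⊢
        obtain ⟨l₁, d₁, c₁, m₁⟩ := iht (k + 1) (by omega) h0 fun j hj hjv =>
          h1 j (by omega) hjv
        obtain ⟨u, hu⟩ := h1 k le_rfl (by omega)
        obtain ⟨l₂, d₂, c₂, m₂⟩ := ih i hi _ _ hu
        refine ⟨(idxRfind i, Nat.pair a k, k + 1 + t) :: (l₁ ++ l₂), isDerivation_cons.2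
          ⟨justified_idxRfind.2 (Or.inr ⟨⟨u, ?_⟩, ?_⟩), isDerivation_append d₁ d₂⟩,
          (c₁.append c₂).cons (by simp only [idxRfind]; omega), by simp⟩
        · exact List.mem_append_right _ m₂
        · exact List.mem_append_left _ m₁

/-- `l` is a derivation that the program with index `y` halts on input `y`. -/
def haltsBy (l : List (ℕ × ℕ × ℕ)) (y : ℕ) : Bool :=
  isDerivation l && l.any fun e => decide (e.1 = y) && decide (e.2.1 = y)

@[fun_prop] theorem primrec_haltsBy {α : Type*} [Primcodable α] {l : α → List (ℕ × ℕ × ℕ)}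
    {y : α → ℕ} (hl : Primrec l) (hy : Primrec y) : Primrec (fun x => haltsBy (l x) (y x)) := by
  unfold haltsBy; fun_prop

/-- The form of the jump on which the game rests: a decidable property of a finite object `l`,
together with the correctness of finitely many answers. A claim about `X'` is thereby attacked or
defended through claims about `X`. -/
theorem mem_jump_iff {y : ℕ} : y ∈ jump X ↔ ∃ l, haltsBy l y = true ∧ Correct X l := by
  simp only [haltsBy, Bool.and_eq_true, List.any_eq_true, decide_eq_true_eq]
  constructor
  · intro h
    obtain ⟨v, hv⟩ := Part.dom_iff_mem.1 h
    obtain ⟨l, h1, h2, h3⟩ := exists_derivation y _ _ hv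
    exact ⟨l, ⟨h1, _, h3, rfl, rfl⟩, h2⟩
  · rintro ⟨l, ⟨h1, ⟨m, n, v⟩, h3, h4, h5⟩, h2⟩
    obtain rfl : m = y := h4
    obtain rfl : n = m := h5
    exact Part.dom_iff_mem.2 ⟨v, mem_eval_of_isDerivation h1 h2 _ _ _ h3⟩

/-- The oracle questions of a derivation with the answers. -/
def queries (l : List (ℕ × ℕ × ℕ)) : List (ℕ × Bool) :=
  l.flatMap fun e => bif decide (e.1 = 4) then [(e.2.1, decide (e.2.2 = 1))] else []

@[fun_prop] theorem primrec_queries {α : Type*} [Primcodable α] {l : α → List (ℕ × ℕ × ℕ)}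
    (hl : Primrec l) : Primrec (fun x => queries (l x)) := by
  unfold queries; fun_prop

theorem correct_iff_queries {l : List (ℕ × ℕ × ℕ)} :
    Correct X l ↔ ∀ q ∈ queries l, q.2 = true ↔ q.1 ∈ X := by
  simp only [Correct, queries, List.mem_flatMap]
  constructor
  · rintro h q ⟨e, he, hq⟩
    by_cases h4 : e.1 = 4
    · simp only [h4, decide_true, cond_true, List.mem_singleton] at hq
      subst hq
      simpa using h e he h4
    · simp [h4] at hq
  · intro h e he h4
    simpa using h (e.2.1, decide (e.2.2 = 1)) ⟨e, he, by simp [h4]⟩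

end OCode
end KW

/-! ### Analysis of the Kechris–Woodin derivative, and uniqueness of coded functions. -/

namespace KW

open Set Filter Topology

/-! ### The differentiability hierarchy -/

section Hierarchy

variable {f g : ℝ → ℝ} {ε : ℝ}

theorem hierarchy_zero (f : ℝ → ℝ) (ε : ℝ) : hierarchy f ε 0 = Icc 0 1 :=
  Ordinal.limitRecOn_zero ..

theorem hierarchy_succ (f : ℝ → ℝ) (ε : ℝ) (α : Ordinal.{0}) :
    hierarchy f ε (α + 1) = kwDeriv f ε (hierarchy f ε α) :=
  Ordinal.limitRecOn_add_one ..

theorem hierarchy_limit (f : ℝ → ℝ) (ε : ℝ) {l : Ordinal.{0}} (hl : Order.IsSuccLimit l) :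
    hierarchy f ε l = ⋂ (β : Ordinal.{0}) (_ : β < l), hierarchy f ε β :=
  Ordinal.limitRecOn_limit (motive := fun _ => Set ℝ) l _ _ _ hl

theorem kwDeriv_subset (f : ℝ → ℝ) (ε : ℝ) (P : Set ℝ) : kwDeriv f ε P ⊆ P := fun _ h => h.1

theorem kwDeriv_mono {ε' : ℝ} (hε : ε ≤ ε') {P Q : Set ℝ} (h : P ⊆ Q) :
    kwDeriv f ε' P ⊆ kwDeriv f ε Q := by
  rintro x ⟨hx, hd⟩
  refine ⟨h hx, fun δ hδ => ?_⟩
  obtain ⟨p, q, r, s, hpq, hrs, hb, hne, hs⟩ := hd δ hδ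
  exact ⟨p, q, r, s, hpq, hrs, hb, hne.mono (inter_subset_inter_right _ h), hε.trans hs⟩

theorem hierarchy_antitone (f : ℝ → ℝ) (ε : ℝ) : Antitone (hierarchy f ε) := by
  intro α β h
  induction β using Ordinal.limitRecOn with
  | zero =>
    obtain rfl : α = 0 := le_antisymm h bot_le
    exact le_rfl
  | add_one β ih =>
    rcases h.eq_or_lt with rfl | h
    · exact le_rfl
    · have h' : α ≤ β := Order.lt_succ_iff.1 (by rwa [Order.succ_eq_add_one])
      have : hierarchy f ε (β + 1) ⊆ hierarchy f ε β := by
        rw [hierarchy_succ]; exact kwDeriv_subset _ _ _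
      exact this.trans (ih h')
  | limit l hl ih =>
    rcases h.eq_or_lt with rfl | h
    · exact le_rfl
    · rw [hierarchy_limit f ε hl]
      exact iInter₂_subset α h

theorem hierarchy_subset_Icc (f : ℝ → ℝ) (ε : ℝ) (α : Ordinal.{0}) :
    hierarchy f ε α ⊆ Icc 0 1 := by
  rw [← hierarchy_zero f ε]; exact hierarchy_antitone f ε bot_le

theorem hierarchy_mono_eps {ε' : ℝ} (hε : ε ≤ ε') (α : Ordinal.{0}) :
    hierarchy f ε' α ⊆ hierarchy f ε α := by
  induction α using Ordinal.limitRecOn with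
  | zero => simp [hierarchy_zero]
  | add_one β ih => rw [hierarchy_succ, hierarchy_succ]; exact kwDeriv_mono hε ih
  | limit l hl ih =>
    rw [hierarchy_limit f ε hl, hierarchy_limit f ε' hl]
    exact iInter₂_mono ih

theorem kwDeriv_congr (h : ∀ x ∈ Icc (0 : ℝ) 1, f x = g x) (P : Set ℝ) :
    kwDeriv f ε P ⊆ kwDeriv g ε P := by
  rintro x ⟨hx, hd⟩
  refine ⟨hx, fun δ hδ => ?_⟩
  obtain ⟨p, q, r, s, hpq, hrs, hb, hne, hs⟩ := hd δ hδ
  refine ⟨p, q, r, s, hpq, hrs, hb, hne, ?_⟩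
  have e : ∀ t ∈ ({p, q, r, s} : Set ℚ), f t = g t := fun t ht => h _ (hb t ht).2
  unfold secant at hs ⊢
  rwa [← e p (by simp), ← e q (by simp), ← e r (by simp), ← e s (by simp)]

theorem hierarchy_congr (h : ∀ x ∈ Icc (0 : ℝ) 1, f x = g x) (α : Ordinal.{0}) :
    hierarchy f ε α = hierarchy g ε α := by
  induction α using Ordinal.limitRecOn with
  | zero => simp [hierarchy_zero]
  | add_one β ih =>
    rw [hierarchy_succ, hierarchy_succ, ih]
    exact (kwDeriv_congr h _).antisymm (kwDeriv_congr (fun x hx => (h x hx).symm) _)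
  | limit l hl ih =>
    rw [hierarchy_limit f ε hl, hierarchy_limit g ε hl]
    exact iInter₂_congr ih

/-- A witness at scale `δ / 2` for a point within `δ / 2` of `x` is a witness at scale `δ` for `x`.
-/
theorem isClosed_kwDeriv {P : Set ℝ} (hP : IsClosed P) : IsClosed (kwDeriv f ε P) := by
  refine isClosed_of_closure_subset fun x hx => ?_
  refine ⟨hP.closure_subset_iff.2 (kwDeriv_subset f ε P) hx, fun δ hδ => ?_⟩
  have hδ' : (0 : ℝ) < (δ / 2 : ℚ) := by exact_mod_cast half_pos hδ
  obtain ⟨y, hy, hxy⟩ := Metric.mem_closure_iff.1 hx _ hδ'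
  obtain ⟨p, q, r, s, hpq, hrs, hb, hne, hs⟩ := hy.2 (δ / 2) (half_pos hδ)
  refine ⟨p, q, r, s, hpq, hrs, fun t ht => ⟨?_, (hb t ht).2⟩, hne, hs⟩
  have h1 := (hb t ht).1
  rw [Metric.mem_ball] at h1 ⊢
  have h2 := dist_triangle (t : ℝ) y x
  rw [dist_comm] at hxy
  push_cast at h1 hxy
  linarith

theorem isClosed_hierarchy (f : ℝ → ℝ) (ε : ℝ) (α : Ordinal.{0}) :
    IsClosed (hierarchy f ε α) := by
  induction α using Ordinal.limitRecOn with
  | zero => rw [hierarchy_zero]; exact isClosed_Icc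
  | add_one β ih => rw [hierarchy_succ]; exact isClosed_kwDeriv ih
  | limit l hl ih =>
    rw [hierarchy_limit f ε hl]
    exact isClosed_iInter fun β => isClosed_iInter fun h => ih β h

/-- Compactness: a decreasing family of closed sets with empty intersection on `K` is already empty
on `K` at some stage. Limit stages therefore never first remove a compact set. -/
theorem exists_hierarchy_inter_eq_empty {l : Ordinal.{0}} (hl : Order.IsSuccLimit l) {K : Set ℝ}
    (hK : IsCompact K) (h : hierarchy f ε l ∩ K = ∅) : ∃ β < l, hierarchy f ε β ∩ K = ∅ := by
  have h0 : (0 : Ordinal) < l := hl.bot_lt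
  have : Nonempty (Iio l) := ⟨⟨0, h0⟩⟩
  obtain ⟨β, hβ⟩ := hK.elim_directed_family_closed
    (fun β : Iio l => hierarchy f ε β) (fun β => isClosed_hierarchy f ε β)
    (by
      rw [hierarchy_limit f ε hl] at h
      rw [inter_comm, ← h]
      congr 1
      ext x
      simp) (by
      intro a b
      refine ⟨max a b, hierarchy_antitone f ε ?_, hierarchy_antitone f ε ?_⟩
      · exact_mod_cast le_max_left a b
      · exact_mod_cast le_max_right a b)
  exact ⟨β, β.2, by rw [inter_comm]; exact hβ⟩

/-- Strict differentiability controls the slopes over all pairs of points near `x`, so the set `P`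
is irrelevant: each slope is within `ε / 4` of the derivative. -/
theorem notMem_kwDeriv_of_hasStrictDerivAt {f' x : ℝ} (h : HasStrictDerivAt f f' x) (hε : 0 < ε)
    (P : Set ℝ) : x ∉ kwDeriv f ε P := by
  rintro ⟨-, hd⟩
  have hb := h.hasStrictFDerivAt.isLittleO.bound (show 0 < ε / 4 by linarith)
  rw [Filter.eventually_iff, Metric.mem_nhds_iff] at hb
  obtain ⟨δ, hδ, hb⟩ := hb
  obtain ⟨δ', hδ', hδδ'⟩ := exists_rat_btwn hδ
  obtain ⟨p, q, r, s, hpq, hrs, hm, -, hs⟩ := hd δ' (by exact_mod_cast hδ')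
  generalize hS : ({p, q, r, s} : Set ℚ) = S at *
  have hpS : p ∈ S := by simp [← hS]
  have hqS : q ∈ S := by simp [← hS]
  have hrS : r ∈ S := by simp [← hS]
  have hsS : s ∈ S := by simp [← hS]
  have key : ∀ p ∈ S, ∀ q ∈ S, p < q →
      |secant f p q - f'| ≤ ε / 4 := by
    intro p hp q hq hpq
    have hpq' : (p : ℝ) - q < 0 := by have : (p : ℝ) < q := by exact_mod_cast hpq
                                      linarith
    have hmem : ((p : ℝ), (q : ℝ)) ∈ Metric.ball (x, x) δ := by
      rw [← ball_prod_same]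
      exact ⟨Metric.ball_subset_ball hδδ'.le (hm p hp).1,
        Metric.ball_subset_ball hδδ'.le (hm q hq).1⟩
    have h1 := hb hmem
    simp only [mem_ofPred_eq, Real.norm_eq_abs,
      ContinuousLinearMap.toSpanSingleton_apply, smul_eq_mul] at h1
    have h2 : secant f p q - f' = (f p - f q - (p - q) * f') / (p - q) := by
      rw [secant, sub_div _ (((p : ℝ) - q) * f'), mul_div_cancel_left₀ _ hpq'.ne]
    rw [h2, abs_div, div_le_iff₀ (abs_pos.2 hpq'.ne)]
    exact h1
  have h1 := key p hpS q hqS hpq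
  have h2 := key r hrS s hsS hrs
  have h3 := abs_sub_le (secant f p q) f' (secant f r s)
  rw [abs_sub_comm f'] at h3
  linarith

/-- Near an isolated point of `P` the two intervals must both contain `x`, and for intervals around
`x` plain differentiability controls the slopes. This removes points at which the derivative is
discontinuous. -/
theorem notMem_kwDeriv_of_isolated {f' x : ℝ} (h : HasDerivAt f f' x) (hε : 0 < ε) {P : Set ℝ}
    (hP : ∀ᶠ y in 𝓝 x, y ∈ P → y = x) : x ∉ kwDeriv f ε P := by
  rintro ⟨-, hd⟩
  have hb := ((hasDerivAt_iff_isLittleO.1 h).bound (show 0 < ε / 4 by linarith)).and hP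
  rw [Filter.eventually_iff, Metric.mem_nhds_iff] at hb
  obtain ⟨δ, hδ, hb⟩ := hb
  obtain ⟨δ', hδ', hδδ'⟩ := exists_rat_btwn hδ
  obtain ⟨p, q, r, s, hpq, hrs, hm, ⟨y, ⟨hy1, hy2⟩, hyP⟩, hs⟩ := hd δ' (by exact_mod_cast hδ')
  have hmem : ∀ t ∈ ({p, q, r, s} : Set ℚ), (t : ℝ) ∈ Metric.ball x δ := fun t ht =>
    Metric.ball_subset_ball hδδ'.le (hm t ht).1
  have hconv : Convex ℝ (Metric.ball x δ) := convex_ball x δ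
  -- The common point lies between endpoints from the ball, hence in the ball, and isolation makes
  -- it equal to `x`.
  have hy : y ∈ Metric.ball x δ :=
    hconv.ordConnected.out (hmem p (by simp)) (hmem q (by simp)) hy1
  obtain rfl : y = x := (hb hy).2 hyP
  generalize hS : ({p, q, r, s} : Set ℚ) = S at *
  have hpS : p ∈ S := by simp [← hS]
  have hqS : q ∈ S := by simp [← hS]
  have hrS : r ∈ S := by simp [← hS]
  have hsS : s ∈ S := by simp [← hS]
  have key : ∀ p ∈ S, ∀ q ∈ S, p < q →
      y ∈ Icc (p : ℝ) q → |secant f p q - f'| ≤ ε / 4 := by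
    intro p hp q hq hpq hyI
    have hpq' : (p : ℝ) - q < 0 := by have : (p : ℝ) < q := by exact_mod_cast hpq
                                      linarith
    have h1 := (hb (hmem p hp)).1
    have h2 := (hb (hmem q hq)).1
    simp only [Real.norm_eq_abs, smul_eq_mul] at h1 h2
    rw [abs_of_nonpos (sub_nonpos.2 hyI.1)] at h1
    rw [abs_of_nonneg (sub_nonneg.2 hyI.2)] at h2
    have h3 : secant f p q - f' = (f p - f q - (p - q) * f') / (p - q) := by
      rw [secant, sub_div _ (((p : ℝ) - q) * f'), mul_div_cancel_left₀ _ hpq'.ne]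
    rw [h3, abs_div, div_le_iff₀ (abs_pos.2 hpq'.ne), abs_of_neg hpq']
    -- The error is split at the intermediate point `y`; the two errors add up to `ε / 4 * (q - p)`
    -- because `y` lies between `p` and `q`.
    have h4 : f p - f q - (p - q) * f' =
        (f p - f y - (p - y) * f') - (f q - f y - (q - y) * f') := by ring
    rw [h4]
    have h5 := abs_sub (f p - f y - (p - y) * f') (f q - f y - (q - y) * f')
    linarith
  have h1 := key p hpS q hqS hpq hy1
  have h2 := key r hrS s hsS hrs hy2
  have h3 := abs_sub_le (secant f p q) f' (secant f r s)
  rw [abs_sub_comm f'] at h3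
  linarith

/-! ### Functions whose hierarchy vanishes are differentiable -/

/-- The slope is continuous off the diagonal. The rational next to `x` is taken on the side away
from `y`, so that `x` lies in the interval, and the other rational is taken near `y`. -/
theorem exists_secant_close (hc : ContinuousOn f (Icc 0 1)) {x y : ℝ} (hx : x ∈ Icc (0 : ℝ) 1)
    (hy : y ∈ Icc (0 : ℝ) 1) (hxy : x ≠ y) {δ : ℝ} (hyδ : y ∈ Metric.ball x δ) {η : ℝ}
    (hη : 0 < η) : ∃ p q : ℚ, p < q ∧ (p : ℝ) ∈ Metric.ball x δ ∩ Icc 0 1 ∧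
      (q : ℝ) ∈ Metric.ball x δ ∩ Icc 0 1 ∧ x ∈ Icc (p : ℝ) q ∧
      |secant f p q - secant f x y| < η := by
  have hcont : ContinuousWithinAt (fun z : ℝ × ℝ => secant f z.1 z.2) (Icc 0 1 ×ˢ Icc 0 1)
      (x, y) := by
    unfold secant
    refine ContinuousWithinAt.div ?_ (by fun_prop) (sub_ne_zero.2 hxy)
    exact ((hc x hx).comp continuousWithinAt_fst fun z hz => hz.1).sub
      ((hc y hy).comp continuousWithinAt_snd fun z hz => hz.2)
  obtain ⟨ρ, hρ, hclose⟩ := Metric.continuousWithinAt_iff.1 hcont η hη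
  have hδ : 0 < δ := dist_nonneg.trans_lt (Metric.mem_ball.1 hyδ)
  have hr : 0 < min ρ δ := lt_min hρ hδ
  have main : ∀ p q : ℚ, (p : ℝ) ∈ Icc (0 : ℝ) 1 → (q : ℝ) ∈ Icc (0 : ℝ) 1 →
      |(p : ℝ) - x| < ρ → |(q : ℝ) - y| < ρ → |secant f p q - secant f x y| < η := by
    intro p q hp hq h1 h2
    have := hclose (x := ((p : ℝ), (q : ℝ))) ⟨hp, hq⟩ (by
      rw [Prod.dist_eq]; exact max_lt h1 h2)
    exact this
  have hcomm : ∀ a b : ℝ, secant f a b = secant f b a := fun a b => by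
    unfold secant; rw [← neg_sub (f b), ← neg_sub b, neg_div_neg_eq]
  rw [Metric.mem_ball, Real.dist_eq] at hyδ
  rcases lt_or_gt_of_ne hxy with hlt | hgt
  -- If `x = 0` there is no room on the left within `[0,1]`, but then `x` itself is rational.
  · obtain ⟨p, hp0, hpx, hpr⟩ : ∃ p : ℚ, (0 : ℝ) ≤ p ∧ (p : ℝ) ≤ x ∧ x - p < min ρ δ := by
      rcases hx.1.eq_or_lt with h | h
      · exact ⟨0, by simp, by simp [← h], by simpa [← h] using hr⟩
      · obtain ⟨p, h1, h2⟩ := exists_rat_btwn (show max 0 (x - min ρ δ) < x from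
          max_lt h (by linarith))
        exact ⟨p, (le_max_left _ _).trans h1.le, h2.le, by
          have := (le_max_right 0 (x - min ρ δ)).trans_lt h1; linarith⟩
    obtain ⟨q, h1, h2⟩ := exists_rat_btwn (show max x (y - min ρ δ) < y from
      max_lt hlt (by linarith))
    have hxq : x < q := (le_max_left _ _).trans_lt h1
    have hqr : y - min ρ δ < q := (le_max_right _ _).trans_lt h1
    have m1 := min_le_left ρ δ
    have m2 := min_le_right ρ δ
    rw [abs_of_pos (by linarith)] at hyδ
    have hpI : (p : ℝ) ∈ Icc (0 : ℝ) 1 := ⟨hp0, hpx.trans hx.2⟩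
    have hqI : (q : ℝ) ∈ Icc (0 : ℝ) 1 := ⟨hx.1.trans hxq.le, h2.le.trans hy.2⟩
    refine ⟨p, q, by exact_mod_cast hpx.trans_lt hxq, ⟨?_, hpI⟩, ⟨?_, hqI⟩, ⟨hpx, hxq.le⟩,
      main p q hpI hqI ?_ ?_⟩
    · rw [Metric.mem_ball, Real.dist_eq, abs_lt]; constructor <;> linarith
    · rw [Metric.mem_ball, Real.dist_eq, abs_lt]; constructor <;> linarith
    · rw [abs_lt]; constructor <;> linarith
    · rw [abs_lt]; constructor <;> linarith
  · obtain ⟨p, hp1, hpx, hpr⟩ : ∃ p : ℚ, (p : ℝ) ≤ 1 ∧ x ≤ p ∧ p - x < min ρ δ := by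
      rcases hx.2.eq_or_lt with h | h
      · exact ⟨1, by simp, by simp [h], by simpa [h] using hr⟩
      · obtain ⟨p, h1, h2⟩ := exists_rat_btwn (show x < min 1 (x + min ρ δ) from
          lt_min h (by linarith))
        exact ⟨p, h2.le.trans (min_le_left _ _), h1.le, by
          have := h2.trans_le (min_le_right 1 (x + min ρ δ)); linarith⟩
    obtain ⟨q, h1, h2⟩ := exists_rat_btwn (show y < min x (y + min ρ δ) from
      lt_min hgt (by linarith))
    have hxq : q < x := h2.trans_le (min_le_left _ _)
    have hqr : q < y + min ρ δ := h2.trans_le (min_le_right _ _)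
    have m1 := min_le_left ρ δ
    have m2 := min_le_right ρ δ
    rw [abs_of_neg (by linarith)] at hyδ
    have hpI : (p : ℝ) ∈ Icc (0 : ℝ) 1 := ⟨hx.1.trans hpx, hp1⟩
    have hqI : (q : ℝ) ∈ Icc (0 : ℝ) 1 := ⟨hy.1.trans h1.le, hxq.le.trans hx.2⟩
    refine ⟨q, p, by exact_mod_cast hxq.trans_le hpx, ⟨?_, hqI⟩, ⟨?_, hpI⟩, ⟨hxq.le, hpx⟩, ?_⟩
    · rw [Metric.mem_ball, Real.dist_eq, abs_lt]; constructor <;> linarith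
    · rw [Metric.mem_ball, Real.dist_eq, abs_lt]; constructor <;> linarith
    · rw [hcomm]
      refine main p q hpI hqI ?_ ?_
      · rw [abs_lt]; constructor <;> linarith
      · rw [abs_lt]; constructor <;> linarith

theorem exists_mem_hierarchy_notMem_succ {x : ℝ} (hx : x ∈ Icc (0 : ℝ) 1) {β : Ordinal.{0}}
    (hβ : x ∉ hierarchy f ε β) : ∃ γ, x ∈ hierarchy f ε γ ∧ x ∉ hierarchy f ε (γ + 1) := by
  by_contra! h
  refine hβ ?_
  clear hβ
  induction β using Ordinal.limitRecOn with
  | zero => rwa [hierarchy_zero]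
  | add_one β ih => exact h β ih
  | limit l hl ih =>
    rw [hierarchy_limit f ε hl]
    exact mem_iInter₂.2 ih

/-- Let `P^γ` be the last level that contains `x`. Since `x` leaves at the next stage, slopes over
small rational intervals around `x` differ by less than `ε`. By density the same holds, with `≤`,
for slopes from `x`, which are thus Cauchy. -/
theorem differentiableOn_of_hierarchy_eq_empty (hc : ContinuousOn f (Icc 0 1))
    (h : ∀ ε : ℝ, 0 < ε → ∃ β, hierarchy f ε β = ∅) : DifferentiableOn ℝ f (Icc 0 1) := by
  intro x hx
  have key : ∀ ε > 0, ∃ δ > 0, ∀ y ∈ Icc (0 : ℝ) 1, ∀ z ∈ Icc (0 : ℝ) 1, y ≠ x → z ≠ x →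
      y ∈ Metric.ball x δ → z ∈ Metric.ball x δ → |secant f x y - secant f x z| ≤ ε := by
    intro ε hε
    obtain ⟨β, hβ⟩ := h ε hε
    obtain ⟨γ, h1, h2⟩ := exists_mem_hierarchy_notMem_succ hx (β := β) (by rw [hβ]; simp)
    rw [hierarchy_succ] at h2
    have h3 : ¬ ∀ δ : ℚ, 0 < δ → _ := fun h => h2 ⟨h1, h⟩
    push Not at h3
    obtain ⟨δ, hδ, h3⟩ := h3
    refine ⟨δ, by exact_mod_cast hδ, fun y hy z hz hyx hzx hyδ hzδ => ?_⟩
    refine le_of_forall_pos_lt_add fun η hη => ?_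
    obtain ⟨p, q, hpq, hp, hq, hxpq, h4⟩ :=
      exists_secant_close hc hx hy hyx.symm hyδ (half_pos hη)
    obtain ⟨r, s, hrs, hr, hs, hxrs, h5⟩ :=
      exists_secant_close hc hx hz hzx.symm hzδ (half_pos hη)
    have h6 := h3 p q r s hpq hrs (by
      intro t ht
      simp only [mem_insert_iff, mem_singleton_iff] at ht
      rcases ht with rfl | rfl | rfl | rfl <;> assumption) ⟨x, ⟨hxpq, hxrs⟩, h1⟩
    have h7 : secant f x y - secant f x z = -(secant f p q - secant f x y) +
      (secant f p q - secant f r s) + (secant f r s - secant f x z) := by ring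
    rw [h7]
    refine (abs_add_three _ _ _).trans_lt ?_
    rw [abs_neg]
    linarith
  have hslope : ∀ y, slope f x y = secant f x y := fun y => by
    rw [slope_def_field, secant, ← neg_sub (f x), ← neg_sub x, neg_div_neg_eq]
  -- A Cauchy filter has to be proper; for the trivial filter every number would be a derivative.
  by_cases hne : (𝓝[Icc 0 1 \ {x}] x).NeBot
  · have hcau : Cauchy (map (slope f x) (𝓝[Icc 0 1 \ {x}] x)) := by
      rw [Metric.cauchy_iff]
      refine ⟨hne.map _, fun ε hε => ?_⟩
      obtain ⟨δ, hδ, hk⟩ := key (ε / 2) (half_pos hε)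
      refine ⟨slope f x '' (Metric.ball x δ ∩ (Icc 0 1 \ {x})), image_mem_map ?_, ?_⟩
      · rw [inter_comm]
        exact inter_mem_nhdsWithin _ (Metric.ball_mem_nhds x hδ)
      · rintro _ ⟨y, ⟨hy, hyI⟩, rfl⟩ _ ⟨z, ⟨hz, hzI⟩, rfl⟩
        rw [hslope, hslope, Real.dist_eq]
        exact (hk y hyI.1 z hzI.1 hyI.2 hzI.2 hy hz).trans_lt (half_lt_self hε)
    obtain ⟨f', hf'⟩ := cauchy_map_iff_exists_tendsto.1 hcau
    exact (hasDerivWithinAt_iff_tendsto_slope.2 hf').differentiableWithinAt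
  · rw [not_neBot] at hne
    refine (hasDerivWithinAt_iff_tendsto_slope (f' := 0).2 ?_).differentiableWithinAt
    rw [hne]
    exact tendsto_bot

end Hierarchy

/-! ### Coded functions are continuous and determined by their code -/

theorem codeQuint_injective : Function.Injective codeQuint := by
  rintro ⟨n, a, r, b, s⟩ ⟨n', a', r', b', s'⟩ h
  have hc : Function.Injective codeRat := enc_injective (δ := ℚ)
  simp only [codeQuint, Nat.pair_eq_pair] at h
  obtain ⟨rfl, h1, h2, h3, h4⟩ := h
  rw [hc h1, hc h2, hc h3, hc h4]

theorem ComputesSet.unique {e : ℕ} {S T : Set ℕ} (hS : ComputesSet e S) (hT : ComputesSet e T) :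
    S = T := by
  ext k
  constructor
  · intro h
    by_contra h'
    exact one_ne_zero (Part.mem_unique ((hS k).1 h) ((hT k).2 h'))
  · intro h
    by_contra h'
    exact one_ne_zero (Part.mem_unique ((hT k).1 h) ((hS k).2 h'))

theorem Represents.eqOn {Φ : Set (ℕ × ℚ × ℚ × ℚ × ℚ)} {f g : ℝ → ℝ} (hf : Represents Φ f)
    (hg : Represents Φ g) : ∀ x ∈ Icc (0 : ℝ) 1, f x = g x := by
  intro x hx
  refine eq_of_forall_dist_le fun ε hε => ?_
  obtain ⟨a, r, b, s, h1, h2, h3⟩ := (hf x hx).1 (ε / 2) (half_pos hε)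
  have h4 := (hf x hx).2 a r b s h1 h2
  have h5 := (hg x hx).2 a r b s h1 h2
  have h6 := abs_sub_le (f x) b (g x)
  rw [abs_sub_comm (b : ℝ)] at h6
  rw [Real.dist_eq]
  linarith

theorem Encodes.eqOn {e : ℕ} {f g : ℝ → ℝ} (hf : Encodes e f) (hg : Encodes e g) :
    ∀ x ∈ Icc (0 : ℝ) 1, f x = g x := by
  obtain ⟨Φ, -, h1, h2⟩ := hf
  obtain ⟨Ψ, -, h3, h4⟩ := hg
  obtain rfl : Φ = Ψ := codeQuint_injective.image_injective (h1.unique h3)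
  exact h2.eqOn h4

theorem Represents.continuousOn {Φ : Set (ℕ × ℚ × ℚ × ℚ × ℚ)} {f : ℝ → ℝ}
    (hf : Represents Φ f) : ContinuousOn f (Icc 0 1) := by
  intro x hx
  rw [Metric.continuousWithinAt_iff]
  intro ε hε
  obtain ⟨a, r, b, s, h1, h2, h3⟩ := (hf x hx).1 (ε / 2) (half_pos hε)
  refine ⟨r - |x - a|, by linarith, fun {y} hy hyx => ?_⟩
  rw [Real.dist_eq] at hyx ⊢
  have h4 := (hf x hx).2 a r b s h1 h2
  have h5 := (hf y hy).2 a r b s h1 (by have := abs_sub_le y x a; linarith)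
  have h6 := abs_sub_le (f y) b (f x)
  rw [abs_sub_comm (b : ℝ)] at h6
  linarith

/-- Membership in `D_l` only depends on the hierarchy becoming empty below `l`. -/
theorem mem_D_iff {l : Ordinal.{0}} {e : ℕ} :
    e ∈ D l ↔ ∃ f, Encodes e f ∧ ∃ β < l, ∀ ε : ℝ, 0 < ε → hierarchy f ε β = ∅ := by
  constructor
  · rintro ⟨f, hf, -, β, hβ, hr⟩
    exact ⟨f, hf, β, hβ, hr.1⟩
  · rintro ⟨f, hf, β, hβ, h⟩
    refine ⟨f, hf, ?_, sInf {β | ∀ ε : ℝ, 0 < ε → hierarchy f ε β = ∅}, ?_, ?_⟩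
    · obtain ⟨Φ, -, -, hr⟩ := hf
      exact differentiableOn_of_hierarchy_eq_empty hr.continuousOn fun ε hε => ⟨β, h ε hε⟩
    · exact (csInf_le' (show β ∈ {β | ∀ ε : ℝ, 0 < ε → hierarchy f ε β = ∅} from h)).trans_lt hβ
    · exact ⟨csInf_mem (s := {β | ∀ ε : ℝ, 0 < ε → hierarchy f ε β = ∅}) ⟨β, h⟩,
        fun γ hγ => csInf_le' hγ⟩

end KW

/-! ### Functions built from trees: geometry, rank estimates and codes. -/

namespace KW

open Set Filter Topology

/-! ### A smooth bump -/

/-- The bump of height `w / 2` on the interval `[L, L + w]`. -/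
noncomputable def bump (L w x : ℝ) : ℝ := 8 / w ^ 3 * (max ((x - L) * (L + w - x)) 0) ^ 2

theorem hasDerivAt_max_sq (u : ℝ) : HasDerivAt (fun u : ℝ => (max u 0) ^ 2) (2 * max u 0) u := by
  rcases lt_trichotomy u 0 with h | rfl | h
  · rw [max_eq_right h.le, mul_zero]
    refine (hasDerivAt_const u (0 : ℝ)).congr_of_eventuallyEq ?_
    filter_upwards [Iio_mem_nhds h] with v hv
    rw [max_eq_right (le_of_lt hv)]; simp
  · rw [max_self, mul_zero, hasDerivAt_iff_isLittleO]
    rw [Asymptotics.isLittleO_iff]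
    intro c hc
    filter_upwards [Metric.ball_mem_nhds (0 : ℝ) hc] with v hv
    rw [Metric.mem_ball, Real.dist_eq, sub_zero] at hv
    simp only [max_self, sub_zero, smul_zero, Real.norm_eq_abs]
    rw [show (0 : ℝ) ^ 2 = 0 by norm_num, sub_zero, abs_of_nonneg (sq_nonneg _), sq]
    have h1 : max v 0 ≤ |v| := max_le (le_abs_self v) (abs_nonneg v)
    have h0 : 0 ≤ max v 0 := le_max_right _ _
    exact mul_le_mul (h1.trans hv.le) h1 h0 hc.le
  · rw [max_eq_left h.le]
    have : HasDerivAt (fun u : ℝ => u ^ 2) (2 * u) u := by simpa using hasDerivAt_pow 2 u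
    refine this.congr_of_eventuallyEq ?_
    filter_upwards [Ioi_mem_nhds h] with v hv
    rw [max_eq_left (le_of_lt hv)]

theorem hasDerivAt_bump (L w x : ℝ) : HasDerivAt (bump L w)
    (8 / w ^ 3 * (2 * max ((x - L) * (L + w - x)) 0 * (L + w - x - (x - L)))) x := by
  have h1 : HasDerivAt (fun x : ℝ => (x - L) * (L + w - x)) (L + w - x - (x - L)) x := by
    have := ((hasDerivAt_id x).sub_const L).mul ((hasDerivAt_id x).const_sub (L + w))
    refine this.congr_deriv ?_
    simp; ring
  exact ((hasDerivAt_max_sq _).comp x h1).const_mul (8 / w ^ 3)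

theorem hasStrictDerivAt_bump (L w x : ℝ) : ∃ d, HasStrictDerivAt (bump L w) d x :=
  ⟨_, hasStrictDerivAt_of_hasDerivAt_of_continuousAt
    (Eventually.of_forall fun y => hasDerivAt_bump L w y) (by fun_prop)⟩

section

variable {L w : ℝ}

theorem bump_eq_zero (hw : 0 < w) {x : ℝ} (hx : x ≤ L ∨ L + w ≤ x) : bump L w x = 0 := by
  have : (x - L) * (L + w - x) ≤ 0 := by
    rcases hx with h | h
    · exact mul_nonpos_of_nonpos_of_nonneg (by linarith) (by linarith)
    · exact mul_nonpos_of_nonneg_of_nonpos (by linarith) (by linarith)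
  rw [bump, max_eq_right this]; simp

theorem bump_nonneg (hw : 0 < w) (x : ℝ) : 0 ≤ bump L w x := by unfold bump; positivity

theorem max_mul_le (x : ℝ) : max ((x - L) * (L + w - x)) 0 ≤ w ^ 2 / 4 :=
  max_le (by nlinarith [sq_nonneg (2 * x - 2 * L - w)]) (by positivity)

theorem bump_le (hw : 0 < w) (x : ℝ) : bump L w x ≤ w / 2 := by
  have h1 := max_mul_le (L := L) (w := w) x
  have h0 : 0 ≤ max ((x - L) * (L + w - x)) 0 := le_max_right _ _
  have h2 : (max ((x - L) * (L + w - x)) 0) ^ 2 ≤ (w ^ 2 / 4) ^ 2 := pow_le_pow_left₀ h0 h1 2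
  calc bump L w x ≤ 8 / w ^ 3 * (w ^ 2 / 4) ^ 2 := by
        unfold bump; exact mul_le_mul_of_nonneg_left h2 (by positivity)
    _ = w / 2 := by field_simp; norm_num

/-- Quadratic decay at the right end of the bump, the end at which the bumps of the children
accumulate. -/
theorem bump_le_sq (hw : 0 < w) (x : ℝ) : bump L w x ≤ 8 / w * (x - (L + w)) ^ 2 := by
  by_cases hx : x ≤ L ∨ L + w ≤ x
  · rw [bump_eq_zero hw hx]; positivity
  · push Not at hx
    have h0 : 0 ≤ (x - L) * (L + w - x) := mul_nonneg (by linarith) (by linarith)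
    rw [bump, max_eq_left h0]
    have h1 : (x - L) ^ 2 ≤ w ^ 2 := pow_le_pow_left₀ (by linarith) (by linarith) 2
    calc 8 / w ^ 3 * ((x - L) * (L + w - x)) ^ 2
        = 8 / w ^ 3 * ((L + w - x) ^ 2 * (x - L) ^ 2) := by ring
      _ ≤ 8 / w ^ 3 * ((L + w - x) ^ 2 * w ^ 2) := by gcongr
      _ = 8 / w * (x - (L + w)) ^ 2 := by field_simp; ring

/-- Height `w / 2` at distance `w / 2` from the ends: the slopes from the midpoint to the ends are
`±1` whatever `w` is. Small bumps therefore oscillate as much as large ones. -/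
theorem bump_mid (hw : 0 < w) : bump L w (L + w / 2) = w / 2 := by
  have : (L + w / 2 - L) * (L + w - (L + w / 2)) = w ^ 2 / 4 := by ring
  rw [bump, this, max_eq_left (by positivity)]
  field_simp; norm_num

/-- The derivative is at most `8 / w ^ 3 * 2 * (w ^ 2 / 4) * w = 4`. A constant independent of `w`
passes to the upper envelope of all bumps. -/
theorem abs_bump_sub_le (hw : 0 < w) (x y : ℝ) : |bump L w x - bump L w y| ≤ 4 * |x - y| := by
  have hb : ∀ z, ‖8 / w ^ 3 * (2 * max ((z - L) * (L + w - z)) 0 * (L + w - z - (z - L)))‖ ≤ 4 := by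
    intro z
    by_cases hz : z ≤ L ∨ L + w ≤ z
    · have : (z - L) * (L + w - z) ≤ 0 := by
        rcases hz with h | h
        · exact mul_nonpos_of_nonpos_of_nonneg (by linarith) (by linarith)
        · exact mul_nonpos_of_nonneg_of_nonpos (by linarith) (by linarith)
      rw [max_eq_right this]; norm_num
    · push Not at hz
      have h0 : 0 ≤ max ((z - L) * (L + w - z)) 0 := le_max_right _ _
      have h1 := max_mul_le (L := L) (w := w) z
      have h2 : |L + w - z - (z - L)| ≤ w := by rw [abs_le]; constructor <;> linarith
      rw [Real.norm_eq_abs, abs_mul, abs_mul, abs_of_pos (show 0 < 8 / w ^ 3 by positivity),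
        abs_of_nonneg (show 0 ≤ 2 * max ((z - L) * (L + w - z)) 0 by positivity)]
      calc 8 / w ^ 3 * (2 * max ((z - L) * (L + w - z)) 0 * |L + w - z - (z - L)|)
          ≤ 8 / w ^ 3 * (2 * (w ^ 2 / 4) * w) := by gcongr
        _ = 4 := by field_simp; norm_num
  have := Convex.norm_image_sub_le_of_norm_hasDerivWithin_le (f := bump L w) (C := 4) (s := univ)
    (fun z _ => (hasDerivAt_bump L w z).hasDerivWithinAt) (fun z _ => hb z) convex_univ
    (mem_univ y) (mem_univ x)
  simpa [Real.norm_eq_abs] using this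

end

/-! ### The layout of the nodes of a tree in the unit interval -/

/-- The left end and the length of the interval of a node. The children of `σ` are the nodes
`n :: σ`. -/
def layout (σ : List ℕ) : ℚ × ℚ :=
  List.rec (motive := fun _ => ℚ × ℚ) (0, 1)
    (fun n σ r => (r.1 + r.2 / 4 + r.2 / ((2 ^ (n + 2) : ℕ) : ℚ),
      r.2 / ((4 ^ (enc (n :: σ) + 2) : ℕ) : ℚ))) σ

@[fun_prop] theorem primrec_layout {α : Type*} [Primcodable α] {s : α → List ℕ}
    (hs : Primrec s) : Primrec (fun x => layout (s x)) := by
  unfold layout; fun_prop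

/-- Left end of the interval of a node. -/
noncomputable def lft (σ : List ℕ) : ℝ := (layout σ).1

/-- Length of the interval of a node. -/
noncomputable def len (σ : List ℕ) : ℝ := (layout σ).2

/-- The point that a node contributes to the hierarchy: the right end of its bump. -/
noncomputable def pt (σ : List ℕ) : ℝ := lft σ + len σ / 4

/-- Distance of the interval of the `n`-th child from the point of its parent. -/
noncomputable def gap (σ : List ℕ) (n : ℕ) : ℝ := len σ / 2 ^ (n + 2)

theorem lft_nil : lft [] = 0 := by simp [lft, layout]

theorem len_nil : len [] = 1 := by simp [len, layout]

theorem lft_cons (n : ℕ) (σ : List ℕ) : lft (n :: σ) = pt σ + gap σ n := by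
  simp only [lft, layout, pt, gap, len]
  push_cast
  rfl

theorem len_cons (n : ℕ) (σ : List ℕ) :
    len (n :: σ) = len σ / 4 ^ (enc (n :: σ) + 2) := by
  simp only [len, layout]
  push_cast
  rfl

theorem len_pos (σ : List ℕ) : 0 < len σ := by
  induction σ with
  | nil => simp [len_nil]
  | cons n σ ih => rw [len_cons]; positivity

theorem len_le_one (σ : List ℕ) : len σ ≤ 1 := by
  induction σ with
  | nil => simp [len_nil]
  | cons n σ ih =>
    rw [len_cons]
    exact (div_le_self (len_pos σ).le (one_le_pow₀ (by norm_num))).trans ih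

/-- Used for computability: omitting the nodes with code at least `n` changes the envelope by at
most `1 / 4 ^ n`. -/
theorem len_le (σ : List ℕ) : len σ ≤ 1 / 4 ^ enc σ := by
  cases σ with
  | nil =>
    rw [len_nil, show enc ([] : List ℕ) = 0 from rfl]; norm_num
  | cons n σ =>
    rw [len_cons]
    have := len_le_one σ
    gcongr
    · norm_num
    · omega

theorem le_enc_cons (n : ℕ) (σ : List ℕ) : n ≤ enc (n :: σ) := by
  have : enc (n :: σ) = Nat.succ (Nat.pair n (enc σ)) := rfl
  have := Nat.left_le_pair n (enc σ)
  omega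

theorem gap_pos (σ : List ℕ) (n : ℕ) : 0 < gap σ n := by
  have := len_pos σ
  unfold gap; positivity

theorem gap_le (σ : List ℕ) (n : ℕ) : gap σ n ≤ len σ / 4 := by
  have := len_pos σ
  unfold gap
  have h : (4 : ℝ) ≤ 2 ^ (n + 2) := by
    rw [pow_add]; have : (1 : ℝ) ≤ 2 ^ n := one_le_pow₀ (by norm_num)
    linarith
  gcongr

theorem gap_succ_le {σ : List ℕ} {m n : ℕ} (h : m < n) : 2 * gap σ n ≤ gap σ m := by
  have := len_pos σ
  have h1 : gap σ (m + 1) * 2 = gap σ m := by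
    unfold gap; rw [show m + 1 + 2 = (m + 2) + 1 by ring, pow_succ]; field_simp
  have h2 : gap σ n ≤ gap σ (m + 1) := by
    unfold gap
    gcongr
    · norm_num
    · exact h
  linarith

/-- Used for differentiability: a child, and with it every bump below it, is quadratically small in
its distance to the point of the parent. The exponent in `layout` is large enough because the code
of `n :: σ` is at least `n`. -/
theorem len_cons_mul_le (n : ℕ) (σ : List ℕ) : len (n :: σ) * len σ ≤ gap σ n ^ 2 := by
  have h := len_pos σ
  rw [len_cons, gap, div_pow, div_mul_eq_mul_div, ← sq, ← pow_mul]
  have : ((2 : ℝ) ^ ((n + 2) * 2)) = 4 ^ (n + 2) := by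
    rw [mul_comm, pow_mul]; norm_num
  rw [this]
  have := le_enc_cons n σ
  gcongr
  norm_num

theorem len_cons_le (n : ℕ) (σ : List ℕ) : len (n :: σ) ≤ gap σ n / 4 := by
  have h := len_pos σ
  have h1 := len_cons_mul_le n σ
  have h2 := gap_le σ n
  have h3 := gap_pos σ n
  have h4 : gap σ n ^ 2 ≤ gap σ n * (len σ / 4) := by rw [sq]; gcongr
  have h5 : len (n :: σ) * len σ ≤ (gap σ n / 4) * len σ := by linarith
  exact le_of_mul_le_mul_right h5 h

theorem tendsto_gap (σ : List ℕ) : Tendsto (gap σ) atTop (𝓝 0) := by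
  have h := tendsto_pow_atTop_nhds_zero_of_lt_one (r := (1 / 2 : ℝ)) (by norm_num) (by norm_num)
  have h2 := ((tendsto_add_atTop_iff_nat 2).2 h).const_mul (len σ)
  rw [mul_zero] at h2
  refine h2.congr fun n => ?_
  simp [gap, div_eq_mul_inv]

/-- The closed interval of a node. -/
def box (σ : List ℕ) : Set ℝ := Icc (lft σ) (lft σ + len σ)

/-- A neighbourhood of the interval of a node that only meets the intervals of related nodes. -/
def nbd : List ℕ → Set ℝ
  | [] => univ
  | n :: σ => Ioo (pt σ + 3 / 4 * gap σ n) (pt σ + 3 / 2 * gap σ n)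

theorem isOpen_nbd (σ : List ℕ) : IsOpen (nbd σ) := by
  cases σ with
  | nil => exact isOpen_univ
  | cons n σ => exact isOpen_Ioo

theorem box_subset_nbd (σ : List ℕ) : box σ ⊆ nbd σ := by
  cases σ with
  | nil => exact subset_univ _
  | cons n σ =>
    rintro x ⟨h1, h2⟩
    rw [lft_cons] at h1 h2
    have := len_cons_le n σ
    have := gap_pos σ n
    exact ⟨by linarith, by linarith⟩

theorem nbd_cons_subset_box (n : ℕ) (σ : List ℕ) : nbd (n :: σ) ⊆ box σ := by
  rintro x ⟨h1, h2⟩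
  have := len_pos σ
  have := gap_pos σ n
  have := gap_le σ n
  unfold pt at h1 h2
  exact ⟨by linarith, by linarith⟩

theorem pt_lt_of_mem_nbd_cons {n : ℕ} {σ : List ℕ} {x : ℝ} (hx : x ∈ nbd (n :: σ)) :
    pt σ < x := by
  have := gap_pos σ n
  have := hx.1
  linarith

theorem nbd_subset_of_suffix {σ τ : List ℕ} (h : σ <:+ τ) : nbd τ ⊆ nbd σ := by
  induction τ with
  | nil => rw [List.suffix_nil.1 h]
  | cons n τ ih =>
    rcases List.suffix_cons_iff.1 h with rfl | h
    · exact Subset.rfl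
    · exact (nbd_cons_subset_box n τ).trans ((box_subset_nbd τ).trans (ih h))

theorem box_subset_of_suffix {σ τ : List ℕ} (h : σ <:+ τ) : box τ ⊆ box σ := by
  induction τ with
  | nil => rw [List.suffix_nil.1 h]
  | cons n τ ih =>
    rcases List.suffix_cons_iff.1 h with rfl | h
    · exact Subset.rfl
    · exact (box_subset_nbd _).trans ((nbd_cons_subset_box n τ).trans (ih h))

theorem len_le_of_suffix {σ τ : List ℕ} (h : σ <:+ τ) : len τ ≤ len σ := by
  induction τ with
  | nil => rw [List.suffix_nil.1 h]
  | cons n τ ih =>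
    rcases List.suffix_cons_iff.1 h with rfl | h
    · exact le_rfl
    · rw [len_cons]
      exact (div_le_self (len_pos τ).le (one_le_pow₀ (by norm_num))).trans (ih h)

/-- For `m < n` one has `gap σ n ≤ gap σ m / 2`, so `3/2 · gap σ n ≤ 3/4 · gap σ m`: the factors in
`nbd` just separate siblings. -/
theorem eq_of_mem_nbd_cons {m n : ℕ} {σ : List ℕ} {x : ℝ} (hm : x ∈ nbd (m :: σ))
    (hn : x ∈ nbd (n :: σ)) : m = n := by
  rcases lt_trichotomy m n with h | h | h
  · have := gap_succ_le (σ := σ) h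
    have := hm.1
    have := hn.2
    linarith
  · exact h
  · have := gap_succ_le (σ := σ) h
    have := hm.2
    have := hn.1
    linarith

theorem eq_or_cons_suffix {σ τ : List ℕ} (h : σ <:+ τ) : τ = σ ∨ ∃ m, (m :: σ) <:+ τ := by
  obtain ⟨l, rfl⟩ := h
  rcases List.eq_nil_or_concat l with rfl | ⟨l', m, rfl⟩
  · exact Or.inl rfl
  · exact Or.inr ⟨m, l', by simp⟩

theorem suffix_or_suffix_of_mem_nbd {σ τ : List ℕ} {x : ℝ} (hσ : x ∈ nbd σ) (hτ : x ∈ nbd τ) :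
    σ <:+ τ ∨ τ <:+ σ := by
  induction σ with
  | nil => exact Or.inl (List.nil_suffix)
  | cons n σ ih =>
    rcases ih (nbd_subset_of_suffix (List.suffix_cons n σ) hσ) with h | h
    · rcases eq_or_cons_suffix h with rfl | ⟨m, h⟩
      · exact Or.inr (List.suffix_cons _ _)
      · obtain rfl := eq_of_mem_nbd_cons hσ (nbd_subset_of_suffix h hτ)
        exact Or.inl h
    · exact Or.inr (h.trans (List.suffix_cons _ _))

/-- The bump of a node. -/
noncomputable def nodeBump (σ : List ℕ) (x : ℝ) : ℝ := bump (lft σ) (len σ / 4) x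

theorem nodeBump_nonneg (σ : List ℕ) (x : ℝ) : 0 ≤ nodeBump σ x :=
  bump_nonneg (by have := len_pos σ; positivity) x

theorem nodeBump_le (σ : List ℕ) (x : ℝ) : nodeBump σ x ≤ len σ := by
  have h := len_pos σ
  have := bump_le (L := lft σ) (w := len σ / 4) (by positivity) x
  unfold nodeBump; linarith

theorem mem_of_nodeBump_ne_zero {σ : List ℕ} {x : ℝ} (h : nodeBump σ x ≠ 0) :
    lft σ < x ∧ x < pt σ := by
  have hp := len_pos σ
  by_contra hn
  refine h (bump_eq_zero (by positivity) ?_)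
  by_cases h1 : x ≤ lft σ
  · exact Or.inl h1
  · exact Or.inr (not_lt.1 fun h2 => hn ⟨not_le.1 h1, h2⟩)

theorem mem_box_of_nodeBump_ne_zero {σ : List ℕ} {x : ℝ} (h : nodeBump σ x ≠ 0) : x ∈ box σ := by
  have hp := len_pos σ
  obtain ⟨h1, h2⟩ := mem_of_nodeBump_ne_zero h
  unfold pt at h2
  exact ⟨h1.le, by linarith⟩

/-- In the neighbourhood of the interval of `σ` only the bumps of `σ` and of its descendants are
seen; those of the descendants lie in the intervals of the children, to the right of `pt σ`. -/
theorem nodeBump_cases {σ τ : List ℕ} {x : ℝ} (hx : x ∈ nbd σ) (h : nodeBump τ x ≠ 0) :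
    σ <:+ τ ∧ (τ = σ ∧ x < pt σ ∨ ∃ m, (m :: σ) <:+ τ ∧ x ∈ box (m :: σ) ∧ pt σ < x) := by
  have hxτ := mem_box_of_nodeBump_ne_zero h
  have hs : σ <:+ τ := by
    rcases suffix_or_suffix_of_mem_nbd hx (box_subset_nbd τ hxτ) with h' | h'
    · exact h'
    · rcases eq_or_cons_suffix h' with rfl | ⟨m, h''⟩
      · exact List.suffix_rfl
      · have h1 := pt_lt_of_mem_nbd_cons (nbd_subset_of_suffix h'' hx)
        have h2 := (mem_of_nodeBump_ne_zero h).2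
        exact absurd h1 (not_lt.2 h2.le)
  refine ⟨hs, ?_⟩
  rcases eq_or_cons_suffix hs with rfl | ⟨m, hm⟩
  · exact Or.inl ⟨rfl, (mem_of_nodeBump_ne_zero h).2⟩
  · have hb := box_subset_of_suffix hm hxτ
    exact Or.inr ⟨m, hm, hb, pt_lt_of_mem_nbd_cons (box_subset_nbd _ hb)⟩

end KW

namespace KW

open Set Filter Topology

/-! ### The function of a set of nodes -/

/-- The contribution of a node to the function of a set of nodes. -/
noncomputable def nodeTerm (T : List ℕ → Bool) (σ : List ℕ) (x : ℝ) : ℝ :=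
  bif T σ then nodeBump σ x else 0

/-- The function of a set of nodes: the upper envelope of the bumps of its nodes. -/
noncomputable def treeFun (T : List ℕ → Bool) (x : ℝ) : ℝ := ⨆ σ, nodeTerm T σ x

section

variable {T : List ℕ → Bool} {σ τ : List ℕ} {x y : ℝ}

theorem nodeTerm_nonneg : 0 ≤ nodeTerm T σ x := by
  unfold nodeTerm; cases T σ
  · exact le_rfl
  · exact nodeBump_nonneg σ x

theorem nodeTerm_le_nodeBump : nodeTerm T σ x ≤ nodeBump σ x := by
  unfold nodeTerm; cases T σ
  · exact nodeBump_nonneg σ x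
  · exact le_rfl

theorem nodeTerm_le : nodeTerm T σ x ≤ len σ := nodeTerm_le_nodeBump.trans (nodeBump_le σ x)

theorem nodeTerm_ne_zero (h : nodeTerm T σ x ≠ 0) : T σ = true ∧ nodeBump σ x ≠ 0 := by
  unfold nodeTerm at h; cases hT : T σ
  · simp [hT] at h
  · simpa [hT] using h

theorem abs_nodeTerm_sub_le : |nodeTerm T σ x - nodeTerm T σ y| ≤ 4 * |x - y| := by
  unfold nodeTerm; cases T σ
  · simp
  · exact abs_bump_sub_le (by have := len_pos σ; positivity) x y

theorem bddAbove_nodeTerm (T : List ℕ → Bool) (x : ℝ) :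
    BddAbove (range fun σ => nodeTerm T σ x) :=
  ⟨1, by rintro _ ⟨σ, rfl⟩; exact nodeTerm_le.trans (len_le_one σ)⟩

theorem nodeTerm_le_treeFun : nodeTerm T σ x ≤ treeFun T x := le_ciSup (bddAbove_nodeTerm T x) σ

theorem treeFun_le {c : ℝ} (h : ∀ σ, nodeTerm T σ x ≤ c) : treeFun T x ≤ c := ciSup_le h

theorem treeFun_nonneg : 0 ≤ treeFun T x := (nodeTerm_nonneg (σ := [])).trans nodeTerm_le_treeFun

theorem abs_treeFun_sub_le : |treeFun T x - treeFun T y| ≤ 4 * |x - y| := by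
  have key : ∀ x y, treeFun T x ≤ treeFun T y + 4 * |x - y| := fun x y => treeFun_le fun σ => by
    have h1 := (abs_le.1 (abs_nodeTerm_sub_le (T := T) (σ := σ) (x := x) (y := y))).2
    have h2 := nodeTerm_le_treeFun (T := T) (σ := σ) (x := y)
    linarith
  have h1 := key x y
  have h2 := key y x
  rw [abs_sub_comm y x] at h2
  rw [abs_le]; constructor <;> linarith

/-- To the left of `pt σ` the descendants of `σ` are invisible, and inside `nbd σ` so are all other
nodes. -/
theorem treeFun_eq_nodeTerm (hx : x ∈ nbd σ) (h : x ≤ pt σ) : treeFun T x = nodeTerm T σ x := by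
  refine le_antisymm (treeFun_le fun τ => ?_) nodeTerm_le_treeFun
  by_cases h0 : nodeTerm T τ x = 0
  · rw [h0]; exact nodeTerm_nonneg
  · obtain ⟨-, ⟨rfl, -⟩ | ⟨m, -, -, h'⟩⟩ := nodeBump_cases hx (nodeTerm_ne_zero h0).2
    · exact le_rfl
    · exact absurd h' (not_lt.2 h)

theorem treeFun_eq_zero (h : ∀ σ, T σ = true → nodeBump σ x = 0) : treeFun T x = 0 :=
  le_antisymm (treeFun_le fun σ => by
    by_contra hn
    obtain ⟨h1, h2⟩ := nodeTerm_ne_zero (T := T) (σ := σ) (x := x) fun h => hn h.le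
    exact h2 (h σ h1)) treeFun_nonneg

theorem hasStrictDerivAt_of_eventually_zero {f : ℝ → ℝ} (h : ∀ᶠ z in 𝓝 x, f z = 0) :
    HasStrictDerivAt f 0 x :=
  (hasStrictDerivAt_const x (0 : ℝ)).congr_of_eventuallyEq (h.mono fun _ h => h.symm)

theorem exists_hasStrictDerivAt_left (hx : x ∈ nbd σ) (h : x < pt σ) :
    ∃ d, HasStrictDerivAt (treeFun T) d x := by
  have he : ∀ᶠ z in 𝓝 x, nodeTerm T σ z = treeFun T z := by
    filter_upwards [(isOpen_nbd σ).mem_nhds hx, Iio_mem_nhds h] with z h1 h2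
    exact (treeFun_eq_nodeTerm h1 (le_of_lt h2)).symm
  cases hT : T σ
  · refine ⟨0, hasStrictDerivAt_of_eventually_zero (he.mono fun z hz => ?_)⟩
    rw [← hz, nodeTerm, hT]; rfl
  · obtain ⟨d, hd⟩ := hasStrictDerivAt_bump (lft σ) (len σ / 4) x
    refine ⟨d, hd.congr_of_eventuallyEq (he.mono fun z hz => ?_)⟩
    rw [← hz, nodeTerm, hT]; rfl

/-- Strictly to the right of `pt σ` only finitely many intervals of children come close: those of
the others lie left of the midpoint between `pt σ` and `x`. A point outside all of them has a
neighbourhood on which the function vanishes. -/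
theorem hasStrictDerivAt_gap (hx : x ∈ nbd σ) (h : pt σ < x) (hb : ∀ n, x ∉ box (n :: σ)) :
    HasStrictDerivAt (treeFun T) 0 x := by
  apply hasStrictDerivAt_of_eventually_zero
  obtain ⟨N, hN⟩ := ((tendsto_gap σ).eventually
    (Iio_mem_nhds (show 0 < (x - pt σ) / 4 by linarith))).exists_forall_of_atTop
  have hc : IsClosed (⋃ n ∈ Iio N, box (n :: σ)) :=
    (finite_Iio N).isClosed_biUnion fun n _ => isClosed_Icc
  have hxc : x ∉ ⋃ n ∈ Iio N, box (n :: σ) := by simpa using fun n _ => hb n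
  filter_upwards [(isOpen_nbd σ).mem_nhds hx, hc.isOpen_compl.mem_nhds hxc,
    Ioi_mem_nhds (show pt σ + (x - pt σ) / 2 < x by linarith)] with z h1 h2 h3
  rw [mem_Ioi] at h3
  refine treeFun_eq_zero fun τ _ => ?_
  by_contra hn
  obtain ⟨-, ⟨-, h'⟩ | ⟨m, -, h', -⟩⟩ := nodeBump_cases h1 hn
  · linarith
  · by_cases hm : m < N
    · exact h2 (mem_iUnion₂.2 ⟨m, hm, h'⟩)
    · have h4 := hN m (not_lt.1 hm)
      have h5 := (box_subset_nbd _ h').2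
      linarith

/-- For the bump of `σ`, of width `len σ / 4`, this is `bump_le_sq`, which gives the constant `32 /
len σ`. For descendants it follows from `len_cons_mul_le` even with `1 / len σ`. -/
theorem treeFun_le_sq (hx : x ∈ nbd σ) : treeFun T x ≤ 32 / len σ * (x - pt σ) ^ 2 := by
  have hl := len_pos σ
  refine treeFun_le fun τ => ?_
  by_cases h0 : nodeTerm T τ x = 0
  · rw [h0]; positivity
  · obtain ⟨-, ⟨rfl, -⟩ | ⟨m, h1, h2, h3⟩⟩ := nodeBump_cases hx (nodeTerm_ne_zero h0).2
    · refine nodeTerm_le_nodeBump.trans ((bump_le_sq (by positivity) x).trans_eq ?_)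
      rw [pt]; congr 1; field_simp; norm_num
    · have h4 := (nodeTerm_le (T := T) (σ := τ) (x := x)).trans (len_le_of_suffix h1)
      have h5 := len_cons_mul_le m σ
      have h6 : gap σ m ≤ x - pt σ := by have := h2.1; rw [lft_cons] at this; linarith
      have h7 : gap σ m ^ 2 ≤ (x - pt σ) ^ 2 := pow_le_pow_left₀ (gap_pos σ m).le h6 2
      have h8 : nodeTerm T τ x ≤ 1 / len σ * (x - pt σ) ^ 2 := by
        rw [one_div, inv_mul_eq_div, le_div_iff₀ hl]
        nlinarith
      have h9 : 1 / len σ * (x - pt σ) ^ 2 ≤ 32 / len σ * (x - pt σ) ^ 2 := by gcongr; norm_num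
      exact h8.trans h9

theorem pt_mem_box (σ : List ℕ) : pt σ ∈ box σ := by
  have := len_pos σ
  exact ⟨by unfold pt; linarith, by unfold pt; linarith⟩

theorem hasDerivAt_pt (T : List ℕ → Bool) (σ : List ℕ) : HasDerivAt (treeFun T) 0 (pt σ) := by
  have hl := len_pos σ
  have h0 : treeFun T (pt σ) = 0 := by
    have := treeFun_le_sq (T := T) (box_subset_nbd σ (pt_mem_box σ))
    rw [sub_self] at this
    exact le_antisymm (this.trans_eq (by ring)) treeFun_nonneg
  rw [hasDerivAt_iff_isLittleO, Asymptotics.isLittleO_iff]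
  intro c hc
  filter_upwards [(isOpen_nbd σ).mem_nhds (box_subset_nbd σ (pt_mem_box σ)),
    Metric.ball_mem_nhds (pt σ) (show 0 < c * len σ / 32 by positivity)] with z h1 h2
  rw [Metric.mem_ball, Real.dist_eq] at h2
  have h3 := treeFun_le_sq (T := T) h1
  rw [h0, sub_zero, smul_zero, sub_zero, Real.norm_eq_abs, Real.norm_eq_abs,
    abs_of_nonneg treeFun_nonneg]
  refine h3.trans ?_
  rw [← sq_abs, sq, ← mul_assoc]
  gcongr
  calc 32 / len σ * |z - pt σ| ≤ 32 / len σ * (c * len σ / 32) := by gcongr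
    _ = c := by field_simp

/-! ### Upper bounds for the rank -/

/-- The interval of the node `σ` does not meet the level `β + 1` of any hierarchy of the
function of `T`. -/
def Thin (T : List ℕ → Bool) (σ : List ℕ) (β : Ordinal.{0}) : Prop :=
  ∀ ε : ℝ, 0 < ε → ∀ y ∈ box σ, y ∉ hierarchy (treeFun T) ε (β + 1)

theorem Thin.mono {β γ : Ordinal.{0}} (h : Thin T σ β) (hβγ : β ≤ γ) : Thin T σ γ :=
  fun ε hε y hy hm => h ε hε y hy
    (hierarchy_antitone _ _ (add_le_add_left hβγ 1) hm)

theorem thin_zero_of_forall (h : ∀ τ, σ <:+ τ → T τ = false) : Thin T σ 0 := by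
  intro ε hε y hy
  rw [hierarchy_succ]
  refine notMem_kwDeriv_of_hasStrictDerivAt (f' := 0) (hasStrictDerivAt_of_eventually_zero ?_) hε _
  filter_upwards [(isOpen_nbd σ).mem_nhds (box_subset_nbd σ hy)] with z hz
  refine treeFun_eq_zero fun τ hτ => ?_
  by_contra hn
  simp [h τ (nodeBump_cases hz hn).1] at hτ

/-- Outside the intervals of the children and apart from `pt σ`, the function is strictly
differentiable, so such points leave at the first stage. Almost all children are exhausted by stage
`β`, which leaves `pt σ` isolated in `P^β`; being a point of differentiability, it leaves at stage
`β + 1`. -/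
theorem thin_of_children {β : Ordinal.{0}} (hβ : 0 < β) (h : ∀ n, Thin T (n :: σ) β)
    (h' : ∀ᶠ n in atTop, ∃ γ < β, Thin T (n :: σ) γ) : Thin T σ β := by
  intro ε hε y hy
  have hy' := box_subset_nbd σ hy
  have key : ∀ y ∈ nbd σ, y ≠ pt σ → (∀ n, y ∉ box (n :: σ)) → ∀ γ,
      y ∉ hierarchy (treeFun T) ε (γ + 1) := by
    intro y hy hne hb γ
    rw [hierarchy_succ]
    rcases lt_or_gt_of_ne hne with h1 | h1
    · obtain ⟨d, hd⟩ := exists_hasStrictDerivAt_left (T := T) hy h1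
      exact notMem_kwDeriv_of_hasStrictDerivAt hd hε _
    · exact notMem_kwDeriv_of_hasStrictDerivAt (hasStrictDerivAt_gap hy h1 hb) hε _
  by_cases hb : ∃ n, y ∈ box (n :: σ)
  · obtain ⟨n, hn⟩ := hb
    exact h n ε hε y hn
  push Not at hb
  by_cases hp : y = pt σ
  swap
  · exact key y hy' hp hb β
  subst hp
  rw [hierarchy_succ]
  refine notMem_kwDeriv_of_isolated (hasDerivAt_pt T σ) hε ?_
  obtain ⟨N, hN⟩ := h'.exists_forall_of_atTop
  filter_upwards [(isOpen_nbd σ).mem_nhds hy',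
    Iio_mem_nhds (show pt σ < pt σ + gap σ N by have := gap_pos σ N; linarith)] with z h1 h2 hz
  by_contra hne
  by_cases hb : ∃ n, z ∈ box (n :: σ)
  · obtain ⟨n, hn⟩ := hb
    have hnN : N ≤ n := by
      by_contra hlt
      have h3 := gap_succ_le (σ := σ) (not_le.1 hlt)
      have h4 := hn.1
      have h5 := gap_pos σ N
      rw [lft_cons] at h4
      rw [mem_Iio] at h2
      linarith
    obtain ⟨γ, hγ, ht⟩ := hN n hnN
    exact ht ε hε z hn (hierarchy_antitone _ _ (Order.add_one_le_of_lt hγ) hz)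
  · push Not at hb
    exact key z h1 hne hb 0 (hierarchy_antitone _ _ (Order.add_one_le_of_lt hβ) hz)

/-! ### Lower bounds for the rank -/

theorem box_nil : box [] = Icc 0 1 := by simp [box, lft_nil, len_nil]

theorem box_subset_Icc (σ : List ℕ) : box σ ⊆ Icc 0 1 :=
  box_nil ▸ box_subset_of_suffix (List.nil_suffix)

/-- The points of the children of `σ` in `S` belong to `P^γ` by induction and accumulate at `pt σ`.
At each of them a bump exhibits slopes that differ by `1`, at arbitrarily small scale. -/
theorem pt_mem_hierarchy {S : Set (List ℕ)} (hT : ∀ σ ∈ S, T σ = true)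
    (hS : ∀ σ ∈ S, ∀ N, ∃ n ≥ N, n :: σ ∈ S) (γ : Ordinal.{0}) :
    ∀ σ ∈ S, pt σ ∈ hierarchy (treeFun T) 1 γ := by
  induction γ using Ordinal.limitRecOn with
  | zero => intro σ _; rw [hierarchy_zero]; exact box_subset_Icc σ (pt_mem_box σ)
  | limit l hl ih =>
    intro σ hσ
    rw [hierarchy_limit _ _ hl]
    exact mem_iInter₂.2 fun β hβ => ih β hβ σ hσ
  | add_one γ ih =>
    intro σ hσ
    rw [hierarchy_succ]
    refine ⟨ih σ hσ, fun δ hδ => ?_⟩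
    obtain ⟨N, hN⟩ := ((tendsto_gap σ).eventually
      (Iio_mem_nhds (show (0 : ℝ) < δ / 2 by positivity))).exists_forall_of_atTop
    obtain ⟨n, hn, hnS⟩ := hS σ hσ N
    have hg : gap σ n < δ / 2 := hN n hn
    set c := n :: σ with hc
    have hl := len_pos c
    have hball : ∀ z ∈ box c, z ∈ Metric.ball (pt σ) δ ∩ Icc 0 1 := by
      intro z hz
      refine ⟨?_, box_subset_Icc c hz⟩
      obtain ⟨h1, h2⟩ := box_subset_nbd c hz
      have := gap_pos σ n
      rw [Metric.mem_ball, Real.dist_eq, abs_lt]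
      constructor <;> linarith
    have e1 : (((layout c).1 + (layout c).2 / 8 : ℚ) : ℝ) = lft c + len c / 8 := by
      push_cast; rfl
    have e2 : (((layout c).1 + (layout c).2 / 4 : ℚ) : ℝ) = pt c := by push_cast; rfl
    have e3 : (((layout c).1 : ℚ) : ℝ) = lft c := rfl
    have hl' : 0 < (layout c).2 := by have : (0 : ℝ) < (layout c).2 := hl; exact_mod_cast this
    -- The right half of the bump of the child has slope `-1` and its whole support has slope `0`.
    -- Both intervals end at `pt c`, which lies in `P^γ`.
    refine ⟨(layout c).1 + (layout c).2 / 8, (layout c).1 + (layout c).2 / 4, (layout c).1,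
      (layout c).1 + (layout c).2 / 4, by linarith, by linarith, ?_, ?_, ?_⟩
    · have hp : pt c = lft c + len c / 4 := rfl
      rintro t (rfl | rfl | rfl | rfl)
      · rw [e1]; exact hball _ ⟨by linarith, by linarith⟩
      · rw [e2]; exact hball _ (pt_mem_box c)
      · rw [e3]; exact hball _ ⟨by linarith, by linarith⟩
      · rw [e2]; exact hball _ (pt_mem_box c)
    · rw [e1, e2, e3]
      have hp : pt c = lft c + len c / 4 := rfl
      exact ⟨pt c, ⟨⟨by linarith, le_rfl⟩, ⟨by linarith, le_rfl⟩⟩, ih c hnS⟩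
    · rw [e1, e2, e3]
      have hp : pt c = lft c + len c / 4 := rfl
      have hv : ∀ z ∈ box c, z ≤ pt c → treeFun T z = bump (lft c) (len c / 4) z := by
        intro z hz hzp
        rw [treeFun_eq_nodeTerm (box_subset_nbd c hz) hzp, nodeTerm, hT c hnS]; rfl
      have v1 : treeFun T (lft c + len c / 8) = len c / 8 := by
        rw [hv _ ⟨by linarith, by linarith⟩ (by linarith),
          show lft c + len c / 8 = lft c + len c / 4 / 2 by ring, bump_mid (by positivity)]
        ring
      have v2 : treeFun T (pt c) = 0 := by
        rw [hv _ (pt_mem_box c) le_rfl, bump_eq_zero (by positivity) (Or.inr hp.ge)]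
      have v3 : treeFun T (lft c) = 0 := by
        rw [hv _ ⟨le_rfl, by linarith⟩ (by linarith), bump_eq_zero (by positivity) (Or.inl le_rfl)]
      rw [secant, secant, v1, v2, v3, hp]
      have : (len c / 8 - 0) / (lft c + len c / 8 - (lft c + len c / 4)) = -1 := by
        have h8 : lft c + len c / 8 - (lft c + len c / 4) = -(len c / 8) := by ring
        rw [h8, sub_zero, div_neg, div_self (by positivity)]
      rw [this]; norm_num

end

end KW

namespace KW

open Set Filter Topology

/-! ### Codes for the functions of sets of nodes -/

/-- The bump as a function of rational numbers. -/
def ratBump (L w x : ℚ) : ℚ :=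
  8 / (w * w * w) * (max ((x - L) * (L + w - x)) 0 * max ((x - L) * (L + w - x)) 0)

theorem cast_ratBump (L w x : ℚ) : (ratBump L w x : ℝ) = bump L w x := by
  simp only [ratBump, bump]; push_cast; ring

@[fun_prop] theorem primrec_ratBump {α : Type*} [Primcodable α] {f g h : α → ℚ} (hf : Primrec f)
    (hg : Primrec g) (hh : Primrec h) : Primrec (fun x => ratBump (f x) (g x) (h x)) := by
  unfold ratBump; fun_prop

/-- The contribution of a node, as a function of rational numbers. -/
def ratTerm (t : Bool) (σ : List ℕ) (a : ℚ) : ℚ :=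
  bif t then ratBump (layout σ).1 ((layout σ).2 / 4) a else 0

theorem cast_ratTerm (T : List ℕ → Bool) (σ : List ℕ) (a : ℚ) :
    (ratTerm (T σ) σ a : ℝ) = nodeTerm T σ a := by
  unfold ratTerm nodeTerm
  cases T σ
  · simp
  · simp only [cond_true, cast_ratBump, nodeBump]; push_cast; rfl

@[fun_prop] theorem primrec_ratTerm {α : Type*} [Primcodable α] {t : α → Bool} {s : α → List ℕ}
    {a : α → ℚ} (ht : Primrec t) (hs : Primrec s) (ha : Primrec a) :
    Primrec (fun x => ratTerm (t x) (s x) (a x)) := by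
  unfold ratTerm; fun_prop

/-- The maximum of the contributions of the nodes with code less than `n`. -/
def approx (T : List ℕ → Bool) (n : ℕ) (a : ℚ) : ℚ :=
  (List.range n).foldr
    (fun j m => max m ((dec (List ℕ) j).elim 0 fun σ => ratTerm (T σ) σ a)) 0

section

variable {T : List ℕ → Bool}

theorem foldr_max_le {g : ℕ → ℚ} {c : ℝ} (hc : 0 ≤ c) (hg : ∀ j, (g j : ℝ) ≤ c) (l : List ℕ) :
    ((l.foldr (fun j m => max m (g j)) 0 : ℚ) : ℝ) ≤ c := by
  induction l with
  | nil => simpa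
  | cons j l ih => rw [List.foldr_cons, Rat.cast_max]; exact max_le ih (hg j)

theorem le_foldr_max {g : ℕ → ℚ} {l : List ℕ} {j : ℕ} (hj : j ∈ l) :
    g j ≤ l.foldr (fun j m => max m (g j)) 0 := by
  induction l with
  | nil => simp at hj
  | cons i l ih =>
    rw [List.foldr_cons]
    rcases List.mem_cons.1 hj with rfl | h
    · exact le_max_right _ _
    · exact (ih h).trans (le_max_left _ _)

theorem approx_le (T : List ℕ → Bool) (n : ℕ) (a : ℚ) : (approx T n a : ℝ) ≤ treeFun T a := by
  refine foldr_max_le treeFun_nonneg (fun j => ?_) _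
  cases dec (List ℕ) j with
  | none => simpa using treeFun_nonneg
  | some σ => simpa [cast_ratTerm] using nodeTerm_le_treeFun

/-- Nodes with code less than `n` are included in the maximum, and every other contribution is at
most `1 / 4 ^ n` by `len_le`. -/
theorem treeFun_le_approx (T : List ℕ → Bool) (n : ℕ) (a : ℚ) :
    treeFun T a ≤ approx T n a + 1 / 4 ^ n := by
  refine treeFun_le fun σ => ?_
  by_cases h : enc σ < n
  · have := le_foldr_max (g := fun j => (dec (List ℕ) j).elim 0 fun σ => ratTerm (T σ) σ a)
      (List.mem_range.2 h)
    simp only [dec_enc, Option.elim_some] at this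
    have h2 : ((ratTerm (T σ) σ a : ℚ) : ℝ) ≤ approx T n a := by exact_mod_cast this
    rw [cast_ratTerm] at h2
    have : (0 : ℝ) < 1 / 4 ^ n := by positivity
    linarith
  · have h1 : (0 : ℝ) ≤ approx T n a := by
      have : (0 : ℚ) ≤ approx T n a := by
        unfold approx
        induction List.range n with
        | nil => simp
        | cons j l ih => rw [List.foldr_cons]; exact ih.trans (le_max_left _ _)
      exact_mod_cast this
    have h2 : (1 : ℝ) / 4 ^ enc σ ≤ 1 / 4 ^ n := by
      gcongr
      · norm_num
      · exact not_lt.1 h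
    have := (nodeTerm_le (T := T) (σ := σ) (x := a)).trans (len_le σ)
    linarith

/-- The test for membership in the code of the function of `T`, with the approximate value `v` of
the function. -/
def inCodeAt (v : ℚ) (t : ℕ × ℚ × ℚ × ℚ × ℚ) : Bool :=
  ratLe 0 t.2.1 && ratLe t.2.1 1 && ratLt 0 t.2.2.1 && ratLt 0 t.2.2.2.2 &&
    ratLt (|v - t.2.2.2.1| + 4 * t.2.2.1 + 1 / ((4 ^ t.1 : ℕ) : ℚ)) t.2.2.2.2

@[fun_prop] theorem primrec_inCodeAt {α : Type*} [Primcodable α] {v : α → ℚ}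
    {t : α → ℕ × ℚ × ℚ × ℚ × ℚ} (hv : Primrec v) (ht : Primrec t) :
    Primrec (fun x => inCodeAt (v x) (t x)) := by
  have : Primrec fun p : ℚ × (ℕ × ℚ × ℚ × ℚ × ℚ) => inCodeAt p.1 p.2 := by
    unfold inCodeAt; fun_prop
  have := this.comp (hv.pair ht)
  exact this

/-- The test for membership in the code of the function of `T`. -/
def inCode (T : List ℕ → Bool) (t : ℕ × ℚ × ℚ × ℚ × ℚ) : Bool :=
  inCodeAt (approx T t.1 t.2.1) t

/-- The first component `n` serves as a precision: each single test is decidable, and its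
existential closure is the exact strict inequality. The summand `4 * r` is the Lipschitz variation
of the function over the ball. -/
theorem rel_inCode_iff {a r b s : ℚ} : Rel {t | inCode T t = true} a r b s ↔
    (0 ≤ a ∧ a ≤ 1) ∧ 0 < r ∧ 0 < s ∧ |treeFun T a - b| + 4 * r < s := by
  simp only [Rel, mem_ofPred_eq, inCode, inCodeAt, Bool.and_eq_true, ratLe_eq_true, ratLt_eq_true]
  have hc : ∀ n, (((1 / ((4 ^ n : ℕ) : ℚ) : ℚ)) : ℝ) = 1 / 4 ^ n := fun n => by push_cast; rfl
  constructor
  · rintro ⟨n, ⟨⟨⟨h0, h1⟩, h2⟩, h3⟩, h4⟩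
    refine ⟨⟨h0, h1⟩, h2, h3, ?_⟩
    have h5 : (|(approx T n a : ℝ) - b| + 4 * r + 1 / 4 ^ n : ℝ) < s := by
      rw [← hc]; exact_mod_cast h4
    have h6 := approx_le T n a
    have h7 := treeFun_le_approx T n a
    have h8 : |treeFun T a - b| ≤ |(approx T n a : ℝ) - b| + 1 / 4 ^ n := by
      have := abs_le.1 (le_refl |(approx T n a : ℝ) - b|)
      rw [abs_le]; constructor <;> linarith [this.1, this.2]
    linarith
  · rintro ⟨⟨h0, h1⟩, h2, h3, h4⟩
    -- Half of the slack, since `1 / 4 ^ n` enters twice: in the test, and as the error of the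
    -- approximate value.
    obtain ⟨n, hn⟩ := exists_pow_lt_of_lt_one
      (show 0 < ((s : ℝ) - (|treeFun T a - b| + 4 * r)) / 2 by linarith)
      (show (1 / 4 : ℝ) < 1 by norm_num)
    refine ⟨n, ⟨⟨⟨h0, h1⟩, h2⟩, h3⟩, ?_⟩
    rw [one_div, inv_pow, ← one_div] at hn
    have h6 := approx_le T n a
    have h7 := treeFun_le_approx T n a
    have h8 : |(approx T n a : ℝ) - b| ≤ |treeFun T a - b| + 1 / 4 ^ n := by
      have := abs_le.1 (le_refl |treeFun T a - b|)
      rw [abs_le]; constructor <;> linarith [this.1, this.2]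
    have h5 : (|(approx T n a : ℝ) - b| + 4 * r + 1 / 4 ^ n : ℝ) < s := by linarith
    rw [← hc] at h5
    exact_mod_cast h5

theorem isFunctionCode_inCode (T : List ℕ → Bool) : IsFunctionCode {t | inCode T t = true} where
  range n a r b s h := by
    have := rel_inCode_iff.1 ⟨n, h⟩
    exact ⟨this.1, this.2.1, this.2.2.1⟩
  compat a r b s b' s' h h' := by
    rw [rel_inCode_iff] at h h'
    obtain ⟨-, hr, -, h1⟩ := h
    obtain ⟨-, -, -, h2⟩ := h'
    have hr' : (0 : ℝ) < r := by exact_mod_cast hr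
    have : |(b : ℝ) - b'| ≤ s + s' := by
      have e1 := abs_le.1 (le_refl |treeFun T a - b|)
      have e2 := abs_le.1 (le_refl |treeFun T a - b'|)
      rw [abs_le]; constructor <;> linarith [e1.1, e1.2, e2.1, e2.2]
    exact_mod_cast this
  shrink a r b s a' r' h h0 h1 hr' hlt := by
    rw [rel_inCode_iff] at h ⊢
    obtain ⟨-, hr, hs, h2⟩ := h
    refine ⟨⟨h0, h1⟩, hr', hs, ?_⟩
    have h3 : |(a : ℝ) - a'| + r' < r := by exact_mod_cast hlt
    have h4 := abs_le.1 (abs_treeFun_sub_le (T := T) (x := a) (y := a'))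
    have e1 := abs_le.1 (le_refl |treeFun T a - b|)
    have : |treeFun T a' - b| ≤ |treeFun T a - b| + 4 * |(a : ℝ) - a'| := by
      rw [abs_le]; constructor <;> linarith [e1.1, e1.2, h4.1, h4.2]
    linarith
  enlarge a r b s b' s' h hlt := by
    rw [rel_inCode_iff] at h ⊢
    obtain ⟨h01, hr, hs, h2⟩ := h
    have h3 : |(b : ℝ) - b'| + s < s' := by exact_mod_cast hlt
    refine ⟨h01, hr, by linarith [abs_nonneg (b - b')], ?_⟩
    have := abs_sub_le (treeFun T a) b b'
    linarith

theorem exists_rat_near {x : ℝ} (hx : x ∈ Icc (0 : ℝ) 1) {r : ℝ} (hr : 0 < r) :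
    ∃ a : ℚ, 0 ≤ a ∧ a ≤ 1 ∧ |x - a| < r := by
  have : max (x - r) 0 < min (x + r) 1 := by
    rw [max_lt_iff, lt_min_iff, lt_min_iff]
    exact ⟨⟨by linarith, by linarith [hx.2]⟩, by linarith [hx.1], by norm_num⟩
  obtain ⟨a, h1, h2⟩ := exists_rat_btwn this
  rw [max_lt_iff] at h1
  rw [lt_min_iff] at h2
  refine ⟨a, by exact_mod_cast h1.2.le, by exact_mod_cast h2.2.le, ?_⟩
  rw [abs_lt]; constructor <;> linarith

theorem represents_inCode (T : List ℕ → Bool) : Represents {t | inCode T t = true} (treeFun T) := by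
  intro x hx
  constructor
  · intro ε hε
    obtain ⟨s, hs0, hs⟩ := exists_rat_btwn hε
    have hs0' : 0 < s := by exact_mod_cast hs0
    obtain ⟨a, ha0, ha1, hxa⟩ := exists_rat_near hx (show 0 < (s : ℝ) / 16 by linarith)
    obtain ⟨b, hb1, hb2⟩ := exists_rat_btwn
      (show treeFun T a - (s : ℝ) / 4 < treeFun T a by linarith)
    refine ⟨a, s / 16, b, s, rel_inCode_iff.2 ⟨⟨ha0, ha1⟩, by linarith, hs0', ?_⟩, ?_, hs⟩
    · have : |treeFun T a - b| ≤ s / 4 := by rw [abs_le]; constructor <;> linarith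
      push_cast
      linarith
    · push_cast; exact hxa
  · intro a r b s h hxa
    obtain ⟨-, -, -, h2⟩ := rel_inCode_iff.1 h
    have := abs_sub_le (treeFun T x) (treeFun T a) b
    have := abs_treeFun_sub_le (T := T) (x := x) (y := a)
    linarith

theorem enc_eq_codeQuint (t : ℕ × ℚ × ℚ × ℚ × ℚ) : enc t = codeQuint t := rfl

/-- The characteristic function of the code of the function of `T`. -/
def codeChar (T : List ℕ → Bool) (k : ℕ) : ℕ :=
  (dec (ℕ × ℚ × ℚ × ℚ × ℚ) k).elim 0
    fun t => bif decide (enc t = k) && inCode T t then 1 else 0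

theorem codeChar_codeQuint (T : List ℕ → Bool) (t : ℕ × ℚ × ℚ × ℚ × ℚ) :
    codeChar T (codeQuint t) = bif inCode T t then 1 else 0 := by
  have : dec (ℕ × ℚ × ℚ × ℚ × ℚ) (codeQuint t) = some t := dec_enc t
  simp [codeChar, this, enc_eq_codeQuint]

theorem codeChar_of_notMem {k : ℕ} (h : k ∉ codeQuint '' {t | inCode T t = true}) :
    codeChar T k = 0 := by
  unfold codeChar
  cases hd : dec (ℕ × ℚ × ℚ × ℚ × ℚ) k with
  | none => rfl
  | some t =>
    simp only [Option.elim_some, enc_eq_codeQuint]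
    by_cases h1 : codeQuint t = k
    · have : inCode T t = false := by
        by_contra hn
        exact h ⟨t, by simpa using hn, h1⟩
      simp [this]
    · simp [h1]

end

theorem primrec_codeChar {T : ℕ → List ℕ → Bool}
    (hT : Primrec fun p : ℕ × List ℕ => T p.1 p.2) :
    Primrec fun p : ℕ × ℕ => codeChar (T p.1) p.2 := by
  have h1 : Primrec fun p : ℕ × ℕ × ℚ => approx (T p.1) p.2.1 p.2.2 := by
    unfold approx; fun_prop
  have h2 : Primrec fun p : ℕ × (ℕ × ℚ × ℚ × ℚ × ℚ) => inCode (T p.1) p.2 := by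
    have := h1.comp
      (by fun_prop : Primrec fun p : ℕ × (ℕ × ℚ × ℚ × ℚ × ℚ) => (p.1, p.2.1, p.2.2.1))
    have := primrec_inCodeAt this Primrec.snd
    exact this
  have h3 : Primrec fun p : (ℕ × ℕ) × (ℕ × ℚ × ℚ × ℚ × ℚ) =>
      bif decide (enc p.2 = p.1.2) && inCode (T p.1.1) p.2 then 1 else 0 := by
    have := h2.comp
      (by fun_prop : Primrec fun p : (ℕ × ℕ) × (ℕ × ℚ × ℚ × ℚ × ℚ) => (p.1.1, p.2))
    have hc : Primrec fun p : (ℕ × ℕ) × (ℕ × ℚ × ℚ × ℚ × ℚ) =>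
      decide (enc p.2 = p.1.2) := 
        primrec_decide_eq (primrec_enc Primrec.snd) (Primrec.snd.comp Primrec.fst)
    exact Primrec.cond (Primrec.and.comp hc this) (Primrec.const 1) (Primrec.const 0)
  have h4 : Primrec fun p : ℕ × ℕ => dec (ℕ × ℚ × ℚ × ℚ × ℚ) p.2 := by clear h1 h2 h3 hT; fun_prop
  exact primrec_option_elim h4 (Primrec.const 0) h3

/-- The parameter theorem: one program decides the codes uniformly in `x`, and currying in `x` is
computable and injective, as a one-one reduction requires. -/
theorem exists_encodes_treeFun {T : ℕ → List ℕ → Bool}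
    (hT : Primrec fun p : ℕ × List ℕ => T p.1 p.2) : ∃ g : ℕ → ℕ, Computable g ∧
      Function.Injective g ∧ ∀ x, Encodes (g x) (treeFun (T x)) := by
  have hp : Nat.Partrec (fun m : ℕ => Part.some (codeChar (T m.unpair.1) m.unpair.2)) := by
    have := ((primrec_codeChar hT).comp Primrec.unpair).to_comp
    exact Partrec.nat_iff.1 this
  obtain ⟨c, hc⟩ := Nat.Partrec.Code.exists_code.1 hp
  refine ⟨fun x => Encodable.encode (Nat.Partrec.Code.curry c x), ?_, ?_, fun x => ?_⟩
  · have := (Nat.Partrec.Code.primrec₂_curry.comp (Primrec.const c) Primrec.id).to_comp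
    exact Computable.encode.comp this
  · intro x y h
    exact (Nat.Partrec.Code.curry_inj (Encodable.encode_injective h)).2
  · refine ⟨_, isFunctionCode_inCode (T x), ?_, represents_inCode (T x)⟩
    have he : ∀ k, phi (Encodable.encode (Nat.Partrec.Code.curry c x)) k =
        Part.some (codeChar (T x) k) := by
      intro k
      rw [phi, Denumerable.ofNat_encode, Nat.Partrec.Code.eval_curry, hc]
      simp
    intro k
    rw [he]
    constructor
    · rintro ⟨t, ht, rfl⟩
      rw [codeChar_codeQuint, show inCode (T x) t = true from ht]
      simp
    · intro h
      rw [codeChar_of_notMem h]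
      simp

end KW

/-! ### Hardness: from false claims to small rank, from true claims to no rank. -/

namespace KW

open Set Filter Topology

/-! ### The tree of positions of a game -/

section Game

variable {C : Type} (bot : C) (exp : C → ℕ → ℕ → List C)

/-- The claims that are added to the list `l` when all challenges below `k` are answered by the
responses in the list `R`. -/
def answers (l : List C) (k : ℕ) (R : List ℕ) : List C :=
  (List.range l.length).flatMap fun j => (List.range k).flatMap fun i =>
    (l[j]?).elim [] fun c => exp c i (R[Nat.pair j i]?.getD 0)

/-- The claims of the child with label `n` of a node, and the number of challenges that its children
answer for each of them. -/
def claimStep (n : ℕ) (s : List C × ℕ) : List C × ℕ :=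
  bif decide (n.unpair.2 < n.unpair.1) && decide (s.2 < n.unpair.1) then
    (s.1 ++ answers exp s.1 s.2 ((dec (List ℕ) n.unpair.2).getD []), n.unpair.1)
  else (s.1 ++ [bot], s.2)

/-- The list of claims at a node, and the number of challenges answered for each of them by the
children of the node. -/
def claims (c₀ : C) (σ : List ℕ) : List C × ℕ :=
  List.rec (motive := fun _ => List C × ℕ) ([c₀], 0) (fun n _ s => claimStep bot exp n s) σ

open Classical in
/-- The positions of the game at which the claim `bot` has not been made. -/
noncomputable def alive (c₀ : C) (σ : List ℕ) : Bool := !decide (bot ∈ (claims bot exp c₀ σ).1)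

variable {bot exp} {c₀ : C}

theorem primrec_alive [Primcodable C] (hexp : Primrec fun p : C × ℕ × ℕ => exp p.1 p.2.1 p.2.2) {g : ℕ → C}
    (hg : Primrec g) : Primrec fun p : ℕ × List ℕ => alive bot exp (g p.1) p.2 := by
  have h1 : Primrec fun p : List C × ℕ × List ℕ => answers exp p.1 p.2.1 p.2.2 := by
    unfold answers; fun_prop
  have h2 : Primrec fun p : ℕ × List ℕ => claims bot exp (g p.1) p.2 := by
    unfold claims claimStep; fun_prop
  unfold alive; fun_prop

theorem mem_answers {l : List C} {k : ℕ} {R : List ℕ} {c' : C} : c' ∈ answers exp l k R ↔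
    ∃ j c, l[j]? = some c ∧ ∃ i < k, c' ∈ exp c i (R[Nat.pair j i]?.getD 0) := by
  simp only [answers, List.mem_flatMap, List.mem_range]
  constructor
  · rintro ⟨j, hj, i, hi, h⟩
    rw [List.getElem?_eq_getElem hj] at h
    exact ⟨j, l[j], List.getElem?_eq_getElem hj, i, hi, h⟩
  · rintro ⟨j, c, hc, i, hi, h⟩
    refine ⟨j, (List.getElem?_eq_some_iff.1 hc).1, i, hi, ?_⟩
    rw [hc]; exact h

theorem claims_cons (n : ℕ) (σ : List ℕ) :
    claims bot exp c₀ (n :: σ) = claimStep bot exp n (claims bot exp c₀ σ) := rfl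

theorem claims_cons_of_valid {n : ℕ} {σ : List ℕ} (h1 : n.unpair.2 < n.unpair.1)
    (h2 : (claims bot exp c₀ σ).2 < n.unpair.1) : claims bot exp c₀ (n :: σ) =
      ((claims bot exp c₀ σ).1 ++ answers exp (claims bot exp c₀ σ).1 (claims bot exp c₀ σ).2
        ((dec (List ℕ) n.unpair.2).getD []), n.unpair.1) := by
  rw [claims_cons, claimStep, decide_eq_true h1, decide_eq_true h2]
  rfl

theorem claims_cons_of_not_valid {n : ℕ} {σ : List ℕ}
    (h : ¬ (n.unpair.2 < n.unpair.1 ∧ (claims bot exp c₀ σ).2 < n.unpair.1)) :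
    bot ∈ (claims bot exp c₀ (n :: σ)).1 := by
  have : (decide (n.unpair.2 < n.unpair.1) &&
    decide ((claims bot exp c₀ σ).2 < n.unpair.1)) = false := by
    rw [Bool.eq_false_iff]; simpa using h
  rw [claims_cons, claimStep, this]
  simp

theorem mem_claims_cons {n : ℕ} {σ : List ℕ} {c : C} (h : c ∈ (claims bot exp c₀ σ).1) :
    c ∈ (claims bot exp c₀ (n :: σ)).1 := by
  rw [claims_cons, claimStep]
  cases (decide (n.unpair.2 < n.unpair.1) && decide ((claims bot exp c₀ σ).2 < n.unpair.1))
  · exact List.mem_append_left _ h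
  · exact List.mem_append_left _ h

theorem mem_claims_of_suffix {σ τ : List ℕ} (hs : σ <:+ τ) {c : C}
    (h : c ∈ (claims bot exp c₀ σ).1) : c ∈ (claims bot exp c₀ τ).1 := by
  induction τ with
  | nil => rwa [List.suffix_nil.1 hs] at h
  | cons n τ ih =>
    rcases List.suffix_cons_iff.1 hs with rfl | h'
    · exact h
    · exact mem_claims_cons (ih h')

variable (bot exp c₀) in
/-- All nodes with the claim `c` are thin of rank `β`. -/
def Bounds (c : C) (β : Ordinal.{0}) : Prop :=
  ∀ σ, c ∈ (claims bot exp c₀ σ).1 → Thin (alive bot exp c₀) σ β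

theorem Bounds.mono {c : C} {β γ : Ordinal.{0}} (h : Bounds bot exp c₀ c β) (hβγ : β ≤ γ) :
    Bounds bot exp c₀ c γ := fun σ hσ => (h σ hσ).mono hβγ

theorem bounds_bot : Bounds bot exp c₀ bot 0 := by
  intro σ hσ
  refine thin_zero_of_forall fun τ hτ => ?_
  simp [alive, mem_claims_of_suffix hτ hσ]

/-- The challenge `i` defeats `c`. At a node that has its children answer `i`, each child carries a
claim of bound `β` or the absurd claim, so the node is thin of rank `β + 1`. At a node with a
smaller counter, almost all children are of that kind, and the others have a larger counter than the
node, so that induction on `i + 1` minus the counter gives `β + 2`. -/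
theorem bounds_of_exp {c : C} {β : Ordinal.{0}} (i : ℕ)
    (h : ∀ r, ∃ c' ∈ exp c i r, Bounds bot exp c₀ c' β) : Bounds bot exp c₀ c (β + 2) := by
  have h2 : β + 2 = β + 1 + 1 := by rw [add_assoc, one_add_one_eq_two]
  have hlt : β + 1 < β + 2 := by rw [h2]; exact lt_add_one _
  have hbad : ∀ {n σ}, ¬ (n.unpair.2 < n.unpair.1 ∧ (claims bot exp c₀ σ).2 < n.unpair.1) →
      Thin (alive bot exp c₀) (n :: σ) 0
    := fun {n σ} hn => bounds_bot _ (claims_cons_of_not_valid hn)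
  have key : ∀ σ, c ∈ (claims bot exp c₀ σ).1 → i < (claims bot exp c₀ σ).2 →
      Thin (alive bot exp c₀) σ (β + 1) := by
    intro σ hc hi
    have hch : ∀ n, Thin (alive bot exp c₀) (n :: σ) β := by
      intro n
      by_cases hv : n.unpair.2 < n.unpair.1 ∧ (claims bot exp c₀ σ).2 < n.unpair.1
      · obtain ⟨j, hj⟩ := List.mem_iff_getElem?.1 hc
        obtain ⟨c', hc', hb⟩ := h (((dec (List ℕ) n.unpair.2).getD [])[Nat.pair j i]?.getD 0)
        refine hb _ ?_
        rw [claims_cons_of_valid hv.1 hv.2]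
        exact List.mem_append_right _ (mem_answers.2 ⟨j, c, hj, i, hi, hc'⟩)
      · exact (hbad hv).mono bot_le
    exact thin_of_children (lt_of_le_of_lt bot_le (lt_add_one β))
      (fun n => (hch n).mono (lt_add_one β).le)
      (Eventually.of_forall fun n => ⟨β, lt_add_one β, hch n⟩)
  intro σ hσ
  induction hm : i + 1 - (claims bot exp c₀ σ).2 using Nat.strong_induction_on generalizing σ with
  | _ m ih =>
    by_cases hi : i < (claims bot exp c₀ σ).2
    · exact (key σ hσ hi).mono hlt.le
    refine thin_of_children (lt_of_le_of_lt bot_le hlt) (fun n => ?_) ?_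
    · by_cases hv : n.unpair.2 < n.unpair.1 ∧ (claims bot exp c₀ σ).2 < n.unpair.1
      · have e := claims_cons_of_valid hv.1 hv.2
        have e2 : (claims bot exp c₀ (n :: σ)).2 = n.unpair.1 := by rw [e]
        exact ih _ (by rw [e2]; omega) _ (mem_claims_cons hσ) rfl
      · exact (hbad hv).mono bot_le
    -- A valid label is a pair whose second component is less than the first, the new counter. A
    -- counter of at most `i` thus forces `n ≤ pair i i`, which leaves finitely many exceptions.
    · filter_upwards [eventually_gt_atTop (Nat.pair i i)] with n hn
      refine ⟨β + 1, hlt, ?_⟩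
      by_cases hv : n.unpair.2 < n.unpair.1 ∧ (claims bot exp c₀ σ).2 < n.unpair.1
      · have e := claims_cons_of_valid hv.1 hv.2
        have e2 : (claims bot exp c₀ (n :: σ)).2 = n.unpair.1 := by rw [e]
        refine key _ (mem_claims_cons hσ) ?_
        rw [e2]
        by_contra hle
        have h3 : n ≤ Nat.pair i i := by
          rw [← Nat.pair_unpair n]
          calc Nat.pair n.unpair.1 n.unpair.2 ≤ Nat.pair i n.unpair.2 := by
                rcases (not_lt.1 hle).lt_or_eq with h | h
                · exact (Nat.pair_lt_pair_left _ h).le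
                · rw [h]
            _ ≤ Nat.pair i i := by
                have : n.unpair.2 < i := by omega
                exact (Nat.pair_lt_pair_right _ this).le
        omega
      · exact (hbad hv).mono bot_le

theorem hierarchy_eq_empty_of_bounds {β : Ordinal.{0}} (h : Bounds bot exp c₀ c₀ β) {ε : ℝ}
    (hε : 0 < ε) : hierarchy (treeFun (alive bot exp c₀)) ε (β + 1) = ∅ := by
  refine eq_empty_of_forall_notMem fun y hy => ?_
  refine h [] (by simp [claims]) ε hε y ?_ hy
  rw [box_nil]; exact hierarchy_subset_Icc _ _ _ hy

/-- The nodes all of whose claims are true form a set to which `pt_mem_hierarchy` applies: true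
claims never include `bot`, and good responses to all pending challenges can be packed into
arbitrarily large labels. -/
theorem hierarchy_nonempty_of_true {Tr : C → Prop} (hbot : ¬ Tr bot)
    (hexp : ∀ c, Tr c → ∀ i, ∃ r, ∀ c' ∈ exp c i r, Tr c') (h₀ : Tr c₀) (γ : Ordinal.{0}) :
    (hierarchy (treeFun (alive bot exp c₀)) 1 γ).Nonempty := by
  let S : Set (List ℕ) := {σ | ∀ c ∈ (claims bot exp c₀ σ).1, Tr c}
  refine ⟨pt [], pt_mem_hierarchy (S := S) (fun σ hσ => ?_) (fun σ hσ N => ?_) γ [] ?_⟩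
  · simpa [alive] using fun h => hbot (hσ _ h)
  · choose! ρ hρ using hexp
    set l := (claims bot exp c₀ σ).1 with hl
    set k := (claims bot exp c₀ σ).2 with hk
    let R : List ℕ := (List.range (Nat.pair l.length k)).map fun m =>
      (l[m.unpair.1]?).elim 0 fun c => ρ c m.unpair.2
    -- The counter exceeds the code of the responses and the old counter, which makes the label
    -- valid, and it exceeds `N`, which makes the label large.
    refine ⟨Nat.pair (max (enc R) (max k N) + 1) (enc R), ?_, ?_⟩
    · have := Nat.left_le_pair (max (enc R) (max k N) + 1) (enc R)
      have := le_max_right (enc R) (max k N)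
      have := le_max_right k N
      omega
    · have h1 := le_max_left (enc R) (max k N)
      have h2 := le_max_right (enc R) (max k N)
      have h3 := le_max_left k N
      intro c' hc'
      rw [claims_cons_of_valid (by rw [Nat.unpair_pair]; simp only; omega)
        (by rw [Nat.unpair_pair]; simp only; omega), Nat.unpair_pair] at hc'
      simp only [dec_enc, Option.getD_some] at hc'
      rcases List.mem_append.1 hc' with h | h
      · exact hσ c' h
      · obtain ⟨j, c, hj, i, hi, h⟩ := mem_answers.1 h
        have hjl : j < l.length := (List.getElem?_eq_some_iff.1 hj).1
        have hlt : Nat.pair j i < Nat.pair l.length k :=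
          (Nat.pair_lt_pair_left i hjl).trans (Nat.pair_lt_pair_right _ hi)
        have hR : R[Nat.pair j i]? = some (ρ c i) := by
          simp only [R, List.getElem?_map, List.getElem?_range hlt, Option.map_some,
            Nat.unpair_pair]
          rw [hl, hj]; rfl
        rw [hR] at h
        exact hρ c (hσ c (List.mem_of_getElem? hj)) i c' h
  · intro c hc
    obtain rfl : c = c₀ := by simpa [claims] using hc
    exact h₀

end Game

end KW

namespace KW

open Set Filter Topology

/-! ### The game for membership in `H_b` -/

/-- The claim `(b, y, t)` says that `y ∈ H_b` if `t` is true, and that `y ∉ H_b` otherwise. The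
claim `absurdClaim` is never true, since `0` is not a notation. -/
def absurdClaim : ℕ × ℕ × Bool := (0, 0, true)

/-- The challenges and responses for claims about a jump. -/
def succExp (c y : ℕ) (t : Bool) (i r : ℕ) : List (ℕ × ℕ × Bool) :=
  bif t then
    bif OCode.haltsBy ((dec (List (ℕ × ℕ × ℕ)) r).getD []) y then
      (OCode.queries ((dec (List (ℕ × ℕ × ℕ)) r).getD [])).map fun q => (c, q.1, q.2)
    else [absurdClaim]
  else
    bif OCode.haltsBy ((dec (List (ℕ × ℕ × ℕ)) i).getD []) y then
      ((OCode.queries ((dec (List (ℕ × ℕ × ℕ)) i).getD []))[r]?).elim [absurdClaim]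
        fun q => [(c, q.1, !q.2)]
    else []

/-- The challenges and responses for claims about an effective union. -/
def limExp (e y : ℕ) (t : Bool) (r : ℕ) : List (ℕ × ℕ × Bool) :=
  (Nat.Partrec.Code.evaln r (Denumerable.ofNat Nat.Partrec.Code e) y.unpair.2).elim [absurdClaim]
    fun d => [(d, y.unpair.1, t)]

/-- The claims to which the claim `c` is reduced by the response `r` to the challenge `i`. -/
def claimExp (c : ℕ × ℕ × Bool) (i r : ℕ) : List (ℕ × ℕ × Bool) :=
  (bif c.1 == 1 && c.2.2 then [absurdClaim] else []) ++
    (List.range c.1).flatMap fun d =>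
      (bif 2 ^ d == c.1 && !(d == 0) then succExp d c.2.1 c.2.2 i r else []) ++
      (bif 3 * 5 ^ d == c.1 then limExp d c.2.1 c.2.2 r else [])

section

variable {α : Type*} [Primcodable α] {c y i r : α → ℕ} {t : α → Bool}

theorem primrec_succExp (hc : Primrec c) (hy : Primrec y) (ht : Primrec t) (hi : Primrec i)
    (hr : Primrec r) : Primrec fun x => succExp (c x) (y x) (t x) (i x) (r x) := by
  have h : Primrec fun p : ℕ × ℕ × Bool × ℕ × ℕ =>
      succExp p.1 p.2.1 p.2.2.1 p.2.2.2.1 p.2.2.2.2 := by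
    unfold succExp; fun_prop
  have := h.comp (hc.pair (hy.pair (ht.pair (hi.pair hr))))
  exact this

theorem primrec_limExp (hc : Primrec c) (hy : Primrec y) (ht : Primrec t) (hr : Primrec r) :
    Primrec fun x => limExp (c x) (y x) (t x) (r x) := by
  have h : Primrec fun p : ℕ × ℕ × Bool × ℕ => limExp p.1 p.2.1 p.2.2.1 p.2.2.2 := by
    unfold limExp; fun_prop
  have := h.comp (hc.pair (hy.pair (ht.pair hr)))
  exact this

end

theorem primrec_claimExp :
    Primrec fun p : (ℕ × ℕ × Bool) × ℕ × ℕ => claimExp p.1 p.2.1 p.2.2 := by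
  have h1 : Primrec fun p : ((ℕ × ℕ × Bool) × ℕ × ℕ) × ℕ =>
      bif 2 ^ p.2 == p.1.1.1 && !(p.2 == 0) then
        succExp p.2 p.1.1.2.1 p.1.1.2.2 p.1.2.1 p.1.2.2 else [] :=
    primrec_cond (by fun_prop) (primrec_succExp (by fun_prop) (by fun_prop) (by fun_prop)
      (by fun_prop) (by fun_prop)) (primrec_const _)
  have h2 : Primrec fun p : ((ℕ × ℕ × Bool) × ℕ × ℕ) × ℕ =>
      bif 3 * 5 ^ p.2 == p.1.1.1 then limExp p.2 p.1.1.2.1 p.1.1.2.2 p.1.2.2 else [] :=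
    primrec_cond (by fun_prop) (primrec_limExp (by fun_prop) (by fun_prop) (by fun_prop)
      (by fun_prop)) (primrec_const _)
  have h3 : Primrec fun p : (ℕ × ℕ × Bool) × ℕ × ℕ =>
      bif p.1.1 == 1 && p.1.2.2 then [absurdClaim] else [] := by clear h1 h2; fun_prop
  have h4 : Primrec fun p : (ℕ × ℕ × Bool) × ℕ × ℕ => List.range p.1.1 := by
    clear h1 h2 h3; fun_prop
  exact primrec_append h3 (primrec_flatMap h4 (primrec_append h1 h2))

theorem lt_three_mul_five_pow (e : ℕ) : e < 3 * 5 ^ e := by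
  have := Nat.lt_pow_self (n := e) (show 1 < 5 by norm_num)
  omega

theorem claimExp_one (y : ℕ) (t : Bool) (i r : ℕ) :
    claimExp (1, y, t) i r = bif t then [absurdClaim] else [] := by
  simp [claimExp]

theorem mem_claimExp_two_pow {c y : ℕ} (hc : c ≠ 0) {t : Bool} {i r : ℕ} {c' : ℕ × ℕ × Bool} :
    c' ∈ claimExp (2 ^ c, y, t) i r ↔ c' ∈ succExp c y t i r := by
  have h0 : (2 ^ c == 1) = false := beq_false_of_ne (by simpa using hc)
  simp only [claimExp, List.mem_append, List.mem_flatMap, List.mem_range, h0, Bool.false_and,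
    cond_false, List.not_mem_nil, false_or, beq_false_of_ne (two_pow_ne _ _).symm, or_false]
  constructor
  · rintro ⟨d, -, h⟩
    by_cases hd : 2 ^ d = 2 ^ c
    · obtain rfl := two_pow_inj hd
      simpa [beq_false_of_ne hc] using h
    · simp [beq_false_of_ne hd] at h
  · exact fun h => ⟨c, Nat.lt_pow_self (by norm_num), by simpa [beq_false_of_ne hc] using h⟩

theorem mem_claimExp_lim {e y : ℕ} {t : Bool} {i r : ℕ} {c' : ℕ × ℕ × Bool} :
    c' ∈ claimExp (3 * 5 ^ e, y, t) i r ↔ c' ∈ limExp e y t r := by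
  have h0 : (3 * 5 ^ e == 1) = false := beq_false_of_ne (by omega)
  simp only [claimExp, List.mem_append, List.mem_flatMap, List.mem_range, h0, Bool.false_and,
    cond_false, List.not_mem_nil, false_or, beq_false_of_ne (two_pow_ne _ _)]
  constructor
  · rintro ⟨d, -, h⟩
    by_cases hd : 3 * 5 ^ d = 3 * 5 ^ e
    · obtain rfl := three_mul_five_pow_inj hd
      simpa using h
    · simp [beq_false_of_ne hd] at h
  · exact fun h => ⟨e, lt_three_mul_five_pow e, by simpa using h⟩

/-- Truth of a claim. -/
def TrueClaim (c : ℕ × ℕ × Bool) : Prop := c.1 ∈ kleeneO ∧ (c.2.2 = true ↔ c.2.1 ∈ H c.1)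

theorem not_trueClaim_absurdClaim : ¬ TrueClaim absurdClaim := fun h => zero_notMem_kleeneO h.1

/-- The strategy of a truthful player: a correct halting derivation for membership in a jump, a
wrongly answered question in the proposed derivation for non-membership, and a sufficient running
time of `φ_e` at a limit. -/
theorem exists_response {c : ℕ × ℕ × Bool} (hc : TrueClaim c) (i : ℕ) :
    ∃ r, ∀ c' ∈ claimExp c i r, TrueClaim c' := by
  obtain ⟨b, y, t⟩ := c
  obtain ⟨hb, ht⟩ := hc
  simp only at hb ht
  rcases kleeneO_cases hb with rfl | ⟨c, rfl, hc⟩ | ⟨e, f, rfl, hf⟩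
  · rw [H_one] at ht
    obtain rfl : t = false := by simpa using ht
    exact ⟨0, by simp [claimExp_one]⟩
  · have hc0 : c ≠ 0 := fun h => zero_notMem_kleeneO (h ▸ hc)
    simp only [mem_claimExp_two_pow hc0]
    rw [H_two_pow hc] at ht
    cases t
    · by_cases hl : OCode.haltsBy ((dec (List (ℕ × ℕ × ℕ)) i).getD []) y = true
      · have hn : ¬ OCode.Correct (H c) ((dec (List (ℕ × ℕ × ℕ)) i).getD []) := fun h => by
          simpa using ht.2 (OCode.mem_jump_iff.2 ⟨_, hl, h⟩)
        rw [OCode.correct_iff_queries] at hn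
        push Not at hn
        obtain ⟨q, hq, hn⟩ := hn
        obtain ⟨r, hr⟩ := List.mem_iff_getElem?.1 hq
        refine ⟨r, fun c' hc' => ?_⟩
        simp only [succExp, hl, hr, cond_true, cond_false, Option.elim_some,
          List.mem_singleton] at hc'
        subst hc'
        refine ⟨hc, ?_⟩
        simp only
        cases h2 : q.2 <;> simp_all
      · exact ⟨0, by simp [succExp, hl]⟩
    · obtain ⟨l, hl, hcor⟩ := OCode.mem_jump_iff.1 (ht.1 rfl)
      refine ⟨enc l, fun c' hc' => ?_⟩
      simp only [succExp, dec_enc, Option.getD_some, hl, cond_true, List.mem_map] at hc'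
      obtain ⟨q, hq, rfl⟩ := hc'
      exact ⟨hc, OCode.correct_iff_queries.1 hcor q hq⟩
  · simp only [mem_claimExp_lim]
    rw [hf.mem_H] at ht
    obtain ⟨r, hr⟩ := Nat.Partrec.Code.evaln_complete.1 (hf.1 y.unpair.2)
    refine ⟨r, fun c' hc' => ?_⟩
    rw [limExp, Option.mem_def.1 hr] at hc'
    obtain rfl : c' = _ := by simpa using hc'
    exact ⟨hf.apply_mem _, ht⟩

section

variable {c₀ : ℕ × ℕ × Bool}

local notation "Bd" => Bounds absurdClaim claimExp c₀

theorem bounds_lim {e : ℕ} {f : ℕ → ℕ} (hf : IsFund e f) {y : ℕ} {t : Bool} {β : Ordinal.{0}}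
    (h : Bd (f y.unpair.2, y.unpair.1, t) β) : Bd (3 * 5 ^ e, y, t) (β + 2) := by
  refine bounds_of_exp 0 fun r => ?_
  simp only [mem_claimExp_lim, limExp]
  cases hr : Nat.Partrec.Code.evaln r (Denumerable.ofNat Nat.Partrec.Code e) y.unpair.2 with
  | none => exact ⟨_, List.mem_singleton_self _, bounds_bot.mono bot_le⟩
  | some d =>
    obtain rfl : d = f y.unpair.2 :=
      Part.mem_unique (Nat.Partrec.Code.evaln_sound (Option.mem_def.2 hr)) (hf.1 _)
    exact ⟨_, List.mem_singleton_self _, h⟩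

theorem bounds_two_pow_false {c y : ℕ} (hc : c ∈ kleeneO) {l : List (ℕ × ℕ × ℕ)}
    (hl : OCode.haltsBy l y = true) {β : Ordinal.{0}}
    (h : ∀ q ∈ OCode.queries l, Bd (c, q.1, !q.2) β) : Bd (2 ^ c, y, false) (β + 2) := by
  have hc0 : c ≠ 0 := fun h => zero_notMem_kleeneO (h ▸ hc)
  refine bounds_of_exp (enc l) fun r => ?_
  simp only [mem_claimExp_two_pow hc0, succExp, dec_enc, Option.getD_some, hl, cond_true,
    cond_false]
  cases hr : (OCode.queries l)[r]? with
  | none => exact ⟨_, List.mem_singleton_self _, bounds_bot.mono bot_le⟩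
  | some q => exact ⟨_, List.mem_singleton_self _, h q (List.mem_of_getElem? hr)⟩

/-- A false claim loses to a fixed challenge: every response yields the absurd claim or a false
claim about a smaller notation. For a false claim of non-membership in a jump, the challenge is a
correct halting derivation; otherwise any challenge will do. Each reduction costs `2` by
`bounds_of_exp`, hence the factor. -/
theorem bounds_of_not_trueClaim {b : ℕ} (hb : b ∈ kleeneO) : ∀ y t,
    ¬ (t = true ↔ y ∈ H b) → Bd (b, y, t) (2 * (nrank b + 1)) := by
  refine kleeneO_induction (p := fun b => ∀ y t, ¬ (t = true ↔ y ∈ H b) →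
    Bd (b, y, t) (2 * (nrank b + 1))) ?_ ?_ ?_ hb
  · intro y t ht
    obtain rfl : t = true := by simpa [H_one] using ht
    rw [nrank_one, zero_add, mul_one, ← zero_add 2]
    refine bounds_of_exp 0 fun r => ⟨absurdClaim, by simp [claimExp_one], bounds_bot⟩
  · intro c hc ih y t ht
    have hc0 : c ≠ 0 := fun h => zero_notMem_kleeneO (h ▸ hc)
    rw [H_two_pow hc] at ht
    rw [nrank_two_pow hc, mul_add 2 (nrank c + 1), mul_one]
    cases t
    · obtain ⟨l, hl, hcor⟩ := OCode.mem_jump_iff.1 (by simpa using ht : y ∈ jump (H c))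
      refine bounds_two_pow_false hc hl fun q hq => ih _ _ ?_
      have := OCode.correct_iff_queries.1 hcor q hq
      rw [← this]
      cases q.2 <;> simp
    · refine bounds_of_exp 0 fun r => ?_
      simp only [mem_claimExp_two_pow hc0, succExp, cond_true]
      set l := (dec (List (ℕ × ℕ × ℕ)) r).getD []
      by_cases hl : OCode.haltsBy l y = true
      · have hn : ¬ OCode.Correct (H c) l := fun h => by
          simp [OCode.mem_jump_iff.2 ⟨_, hl, h⟩] at ht
        rw [OCode.correct_iff_queries] at hn
        push Not at hn
        obtain ⟨q, hq, hn⟩ := hn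
        refine ⟨(c, q.1, q.2), ?_, ih _ _ ?_⟩
        · rw [hl]; exact List.mem_map.2 ⟨q, hq, rfl⟩
        · tauto
      · refine ⟨absurdClaim, ?_, bounds_bot.mono bot_le⟩
        simp [hl]
  · intro e f hf ih y t ht
    rw [hf.mem_H] at ht
    refine (bounds_lim hf (ih _ _ _ ht)).mono ?_
    have h1 : nrank (f y.unpair.2) + 1 + 1 ≤ nrank (3 * 5 ^ e) + 1 := by
      have := Order.add_one_le_of_lt (hf.nrank_lt y.unpair.2)
      gcongr
    calc (2 : Ordinal) * (nrank (f y.unpair.2) + 1) + 2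
        = 2 * (nrank (f y.unpair.2) + 1 + 1) := by rw [mul_add 2 (_ + 1), mul_one]
      _ ≤ _ := by gcongr

end

/-- A limit is of the form `ω * μ`, and `2 * ω = ω`; so doubling a rank does not lead out of a
limit. -/
theorem two_mul_lt_of_isSuccLimit {l β : Ordinal.{0}} (hl : Order.IsSuccLimit l) (h : β < l) :
    2 * β < l := by
  have : 2 * l = l := by
    obtain ⟨μ, rfl⟩ := Ordinal.isSuccPrelimit_iff_omega0_dvd.1 hl.isSuccPrelimit
    rw [← mul_assoc]
    congr 1
    exact_mod_cast Ordinal.natCast_mul_omega0 (n := 2) (by norm_num)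
  rw [← this]
  exact mul_lt_mul_of_pos_left h (by norm_num)

theorem IsFund.ltO_or_eq {e : ℕ} {f : ℕ → ℕ} (hf : IsFund e f) {m n : ℕ} (h : m ≤ n) :
    f m = f n ∨ LtO (f m) (f n) := by
  induction h with
  | refl => exact Or.inl rfl
  | step _ ih => exact Or.inr (ih.elim (fun h => h ▸ hf.2 _) fun h => h.trans (hf.2 _))

/-- `H_{2^a}` is one-one reducible to `D_λ`. -/
theorem H_two_pow_reducible {e : ℕ} {f : ℕ → ℕ} (hf : IsFund e f) :
    (fun n => n ∈ H (2 ^ (3 * 5 ^ e))) ≤₁ fun n => n ∈ D (nrank (3 * 5 ^ e)) := by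
  obtain ⟨g, hg, hinj, henc⟩ := exists_encodes_treeFun
    (T := fun x => alive absurdClaim claimExp (2 ^ (3 * 5 ^ e), x, false))
    (primrec_alive primrec_claimExp (g := fun x => (2 ^ (3 * 5 ^ e), x, false)) (by fun_prop))
  refine ⟨g, hg, hinj, fun x => ?_⟩
  have hl := hf.isSuccLimit
  constructor
  · intro hx
    rw [H_two_pow hf.mem] at hx
    obtain ⟨l, hl1, hcor⟩ := OCode.mem_jump_iff.1 hx
    rw [OCode.correct_iff_queries] at hcor
    -- A halting computation looks at finitely many columns of `H_{3·5^e}`. The rank is thus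
    -- controlled by a single `f N`, of rank strictly below the limit.
    obtain ⟨N, hN⟩ : ∃ N, ∀ q ∈ OCode.queries l, q.1.unpair.2 ≤ N := by
      induction OCode.queries l with
      | nil => exact ⟨0, by simp⟩
      | cons q l ih =>
        obtain ⟨N, hN⟩ := ih
        refine ⟨max q.1.unpair.2 N, fun p hp => ?_⟩
        rcases List.mem_cons.1 hp with rfl | hp
        · exact le_max_left _ _
        · exact (hN p hp).trans (le_max_right _ _)
    -- The summands `2` account for the passage from the union to a column and from the jump to the
    -- union. The final `1` is the shift in the definition of `Thin`.
    refine mem_D_iff.2 ⟨_, henc x, 2 * (nrank (f N) + 1) + 2 + 2 + 1, ?_, fun ε hε =>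
      hierarchy_eq_empty_of_bounds (bounds_two_pow_false hf.mem hl1 fun q hq => ?_) hε⟩
    · have h1 : ∀ β < nrank (3 * 5 ^ e), β + 1 < nrank (3 * 5 ^ e) := fun β hβ => by
        simpa using hl.succ_lt hβ
      have h2 : ∀ β < nrank (3 * 5 ^ e), β + 2 < nrank (3 * 5 ^ e) := fun β hβ => by
        rw [← one_add_one_eq_two, ← add_assoc]; exact h1 _ (h1 _ hβ)
      exact h1 _ (h2 _ (h2 _ (two_mul_lt_of_isSuccLimit hl (h1 _ (hf.nrank_lt N)))))
    · have hw : ¬ ((!q.2) = true ↔ q.1.unpair.1 ∈ H (f q.1.unpair.2)) := by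
        rw [← hf.mem_H, ← hcor q hq]
        cases q.2 <;> simp
      refine bounds_lim hf ((bounds_of_not_trueClaim (hf.apply_mem _) _ _ hw).mono ?_)
      have : nrank (f q.1.unpair.2) ≤ nrank (f N) := by
        rcases hf.ltO_or_eq (hN q hq) with h | h
        · rw [h]
        · exact (nrank_lt h).le
      gcongr
  · intro hx
    by_contra hn
    obtain ⟨h, hh, β, -, hβ⟩ := mem_D_iff.1 hx
    -- If `x` is not in the jump, the opening claim is true and the level `1`-hierarchy never
    -- becomes empty.
    have ht : TrueClaim (2 ^ (3 * 5 ^ e), x, false) := ⟨two_pow_mem hf.mem, by simpa using hn⟩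
    have h1 := hierarchy_nonempty_of_true not_trueClaim_absurdClaim
      (fun c hc i => exists_response hc i) ht β
    rw [hierarchy_congr ((henc x).eqOn hh), hβ 1 one_pos] at h1
    exact not_nonempty_empty h1

end KW

/-! ### Upper bound: iterated quantifiers as membership in the sets `H_{2^c}`. -/

namespace KW

/-! ### Indices of halting problems -/

namespace OCode

/-- A program without oracle, as a program with oracle. -/
def ofCode : Nat.Partrec.Code → OCode
  | .zero => zero
  | .succ => succ
  | .left => left
  | .right => right
  | .pair a b => pair (ofCode a) (ofCode b)
  | .comp a b => comp (ofCode a) (ofCode b)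
  | .prec a b => prec (ofCode a) (ofCode b)
  | .rfind' a => rfind' (ofCode a)

theorem eval_ofCode (X : Set ℕ) (c : Nat.Partrec.Code) : (ofCode c).eval X = c.eval := by
  induction c with
  | zero => rfl
  | succ => rfl
  | left => rfl
  | right => rfl
  | pair a b iha ihb => simp only [ofCode, eval, Nat.Partrec.Code.eval, iha, ihb]; rfl
  | comp a b iha ihb => simp only [ofCode, eval, Nat.Partrec.Code.eval, iha, ihb]; rfl
  | prec a b iha ihb => simp only [ofCode, eval, Nat.Partrec.Code.eval, iha, ihb]; rfl
  | rfind' a iha => simp only [ofCode, eval, Nat.Partrec.Code.eval, iha]; rfl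

theorem exists_eval_eq {g : ℕ → ℕ} (hg : Primrec g) :
    ∃ c : OCode, ∀ X n, c.eval X n = Part.some (g n) := by
  obtain ⟨c, hc⟩ := Nat.Partrec.Code.exists_code.1 (Nat.Partrec.of_primrec (Primrec.nat_iff.1 hg))
  exact ⟨ofCode c, fun X n => by rw [eval_ofCode, hc]; rfl⟩

/-- Index of a program with the constant value `p`. -/
def idxConst (p : ℕ) : ℕ := Nat.rec (motive := fun _ => ℕ) 0 (fun _ c => idxComp 1 c) p

/-- Index of a program that runs the program with index `n` on the input `p`. -/
def idxRun (n p : ℕ) : ℕ := idxComp n (idxConst p)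

theorem mem_eval_idxConst {X : Set ℕ} {p x v : ℕ} :
    v ∈ (ofNat (idxConst p)).eval X x ↔ v = p := by
  induction p generalizing v with
  | zero => rw [show idxConst 0 = 0 from rfl, ofNat]; exact Part.mem_some_iff
  | succ p ih =>
    rw [show idxConst (p + 1) = idxComp 1 (idxConst p) from rfl, ofNat_idxComp, mem_eval_comp]
    simp only [ih, exists_eq_left]
    rw [show ofNat 1 = succ by rw [ofNat]]
    exact Part.mem_some_iff

/-- Membership in the jump runs a program on its own index. Composing with a constant program
discards that input in favour of `p`. -/
theorem idxRun_mem_jump {X : Set ℕ} {n p : ℕ} :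
    idxRun n p ∈ jump X ↔ ∃ v, v ∈ (ofNat n).eval X p := by
  rw [jump, Set.mem_ofPred_eq, idxRun, ofNat_idxComp, Part.dom_iff_mem]
  simp only [mem_eval_comp, mem_eval_idxConst, exists_eq_left]

theorem idxComp_inj {i j i' j' : ℕ} (h : idxComp i j = idxComp i' j') : i = i' ∧ j = j' := by
  unfold idxComp at h
  exact Nat.pair_eq_pair.1 (by omega)

theorem idxConst_injective : Function.Injective idxConst := by
  intro p q h
  induction p generalizing q with
  | zero =>
    cases q with
    | zero => rfl
    | succ q => exact absurd h (by simp [idxConst, idxComp])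
  | succ p ih =>
    cases q with
    | zero => exact absurd h (by simp [idxConst, idxComp])
    | succ q => rw [ih (idxComp_inj h).2]

theorem idxRun_injective (n : ℕ) : Function.Injective (idxRun n) :=
  fun _ _ h => idxConst_injective (idxComp_inj h).2

@[fun_prop] theorem primrec_idxRun {α : Type*} [Primcodable α] {n p : α → ℕ} (hn : Primrec n)
    (hp : Primrec p) : Primrec (fun x => idxRun (n x) (p x)) := by
  unfold idxRun idxConst idxComp; fun_prop

open Classical in
/-- An existential statement with one oracle question for each instance is a halting problem. -/
theorem exists_idxRun {q : ℕ → ℕ → ℕ} {t : ℕ → ℕ → Bool → Bool}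
    (hq : Primrec fun p : ℕ × ℕ => q p.1 p.2)
    (ht : Primrec fun p : (ℕ × ℕ) × Bool => t p.1.1 p.1.2 p.2) :
    ∃ n, ∀ X p, idxRun n p ∈ jump X ↔ ∃ i, t p i (decide (q p i ∈ X)) = true := by
  obtain ⟨pre, hpre⟩ := exists_eval_eq
    (g := fun m : ℕ => q m.unpair.1 m.unpair.2)
    (by have := hq.comp Primrec.unpair; exact this)
  obtain ⟨post, hpost⟩ := exists_eval_eq
    (g := fun m : ℕ =>
      bif t m.unpair.2.unpair.1 m.unpair.2.unpair.2 (m.unpair.1 == 1) then 0 else 1)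
    (by
      have := ht.comp (by fun_prop : Primrec fun m : ℕ =>
        ((m.unpair.2.unpair.1, m.unpair.2.unpair.2), m.unpair.1 == 1))
      exact Primrec.cond this (Primrec.const 0) (Primrec.const 1))
  obtain ⟨ident, hident⟩ := exists_eval_eq (g := fun m : ℕ => m) (by fun_prop)
  obtain ⟨start, hstart⟩ := exists_eval_eq (g := fun m : ℕ => Nat.pair m 0) (by fun_prop)
  -- An unbounded search for `i` from `0`: `pre` computes the question, `post` returns `0` exactly
  -- when the answer makes the test succeed, and `ident` passes the pair of `p` and `i` on to
  -- `post`.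
  obtain ⟨n, hn⟩ := exists_index
    (comp (rfind' (comp post (pair (comp oracle pre) ident))) start)
  refine ⟨n, fun X p => ?_⟩
  have hval : ∀ i v, v ∈ eval X (comp post (pair (comp oracle pre) ident)) (Nat.pair p i) ↔
      v = bif t p i (decide (q p i ∈ X)) then 0 else 1 := by
    intro i v
    simp only [mem_eval_comp, mem_eval_pair, mem_eval_oracle, hpre, hpost, hident,
      Part.mem_some_iff, exists_eq_left, Nat.unpair_pair]
    constructor
    · rintro ⟨w, ⟨h1, h2⟩, rfl⟩
      rw [h2, Nat.unpair_pair]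
      rcases h1 with ⟨hm, h1⟩ | ⟨hm, h1⟩ <;> simp [hm, h1]
    · rintro rfl
      by_cases hm : q p i ∈ X
      · exact ⟨Nat.pair 1 (Nat.pair p i), by simp [hm], by simp [hm]⟩
      · exact ⟨Nat.pair 0 (Nat.pair p i), by simp [hm], by simp [hm]⟩
  rw [idxRun_mem_jump, hn]
  simp only [mem_eval_comp, hstart, Part.mem_some_iff, exists_eq_left, mem_eval_rfind]
  constructor
  · rintro ⟨i, -, h, -⟩
    refine ⟨i, ?_⟩
    by_contra hne
    have := (hval i 0).1 (mem_eval_comp.2 h)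
    simp [Bool.eq_false_iff.2 hne] at this
  · intro h
    refine ⟨Nat.find h, Nat.zero_le _, ?_, fun j _ hj => ⟨0, ?_⟩⟩
    · refine mem_eval_comp.1 ((hval _ 0).2 ?_)
      rw [Nat.find_spec h]; rfl
    · refine mem_eval_comp.1 ((hval _ 1).2 ?_)
      rw [Bool.eq_false_iff.2 (Nat.find_min h hj)]; rfl

end OCode

end KW

namespace KW

open OCode

/-! ### Descending along notations -/

/-- The exponent of a power of two. -/
def lg (b : ℕ) : ℕ := (List.range b).foldr (fun d r => bif 2 ^ d == b then d else r) 0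

/-- The exponent in a number of the form `3 * 5 ^ e`. -/
def limIdx (b : ℕ) : Option ℕ :=
  (List.range b).foldr (fun e r => bif 3 * 5 ^ e == b then some e else r) none

section

variable {α : Type*} [Primcodable α]

@[fun_prop] theorem primrec_lg {f : α → ℕ} (hf : Primrec f) : Primrec (fun x => lg (f x)) := by
  unfold lg; fun_prop

@[fun_prop] theorem primrec_limIdx {f : α → ℕ} (hf : Primrec f) :
    Primrec (fun x => limIdx (f x)) := by
  unfold limIdx; fun_prop

end

theorem foldr_bif_eq {β : Type*} {p : ℕ → Bool} {g : ℕ → β} {z : β} {l : List ℕ} {d : ℕ}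
    (hd : d ∈ l) (hp : p d = true) (h : ∀ i, p i = true → i = d) :
    l.foldr (fun d r => bif p d then g d else r) z = g d := by
  induction l with
  | nil => simp at hd
  | cons i l ih =>
    rw [List.foldr_cons]
    cases hi : p i
    · refine ih ((List.mem_cons.1 hd).resolve_left fun h => ?_)
      rw [h, hi] at hp; exact Bool.noConfusion hp
    · rw [h i hi]; rfl

theorem lg_two_pow (c : ℕ) : lg (2 ^ c) = c :=
  foldr_bif_eq (List.mem_range.2 (Nat.lt_pow_self (by norm_num))) (by simp)
    fun i hi => two_pow_inj (by simpa using hi)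

theorem limIdx_lim (e : ℕ) : limIdx (3 * 5 ^ e) = some e :=
  foldr_bif_eq (List.mem_range.2 (lt_three_mul_five_pow e)) (by simp)
    fun i hi => three_mul_five_pow_inj (by simpa using hi)

theorem eq_of_limIdx {b e : ℕ} (h : limIdx b = some e) : b = 3 * 5 ^ e := by
  unfold limIdx at h
  generalize List.range b = l at h
  induction l with
  | nil => simp at h
  | cons i l ih =>
    rw [List.foldr_cons] at h
    cases hi : 3 * 5 ^ i == b
    · rw [hi] at h; exact ih h
    · rw [hi] at h
      obtain rfl : i = e := by simpa using h
      exact (beq_iff_eq.1 hi).symm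

theorem limIdx_two_pow (c : ℕ) : limIdx (2 ^ c) = none := by
  rw [Option.eq_none_iff_forall_ne_some]
  exact fun e h => two_pow_ne _ _ (eq_of_limIdx h)

/-- One step down from a limit notation, along a member of its fundamental sequence. -/
def stepDown (o : Option ℕ) (p : ℕ × ℕ) : Option ℕ :=
  o.bind fun b => (limIdx b).bind fun e =>
    Nat.Partrec.Code.evaln p.2 (Denumerable.ofNat Nat.Partrec.Code e) p.1

/-- Repeated steps down from a limit notation. -/
def descend (b : ℕ) (s : List (ℕ × ℕ)) : Option ℕ := s.foldl stepDown (some b)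

/-- The element of `H_b` that corresponds to an element of `H_d`, for `d` reached from `b`. -/
def wrap (s : List (ℕ × ℕ)) (x : ℕ) : ℕ := s.foldr (fun p y => Nat.pair y p.1) x

theorem foldl_stepDown_none (s : List (ℕ × ℕ)) : s.foldl stepDown none = none := by
  induction s with
  | nil => rfl
  | cons p s ih => exact ih

theorem descend_cons {e : ℕ} {f : ℕ → ℕ} (hf : IsFund e f) {n T : ℕ} {s : List (ℕ × ℕ)} {d : ℕ} :
    descend (3 * 5 ^ e) ((n, T) :: s) = some d ↔
      f n ∈ Nat.Partrec.Code.evaln T (Denumerable.ofNat Nat.Partrec.Code e) n ∧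
        descend (f n) s = some d := by
  have h : descend (3 * 5 ^ e) ((n, T) :: s) =
      s.foldl stepDown (Nat.Partrec.Code.evaln T (Denumerable.ofNat Nat.Partrec.Code e) n) := by
    rw [descend, List.foldl_cons]
    congr 1
    simp [stepDown, limIdx_lim]
  rw [h]
  cases hr : Nat.Partrec.Code.evaln T (Denumerable.ofNat Nat.Partrec.Code e) n with
  | none => simp [foldl_stepDown_none]
  | some d' =>
    obtain rfl : d' = f n :=
      Part.mem_unique (Nat.Partrec.Code.evaln_sound (Option.mem_def.2 hr)) (hf.1 _)
    simp [descend]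

theorem descend_spec {s : List (ℕ × ℕ)} {b d : ℕ} (hb : b ∈ kleeneO)
    (h : descend b s = some d) :
    (d = b ∨ LtO d b) ∧ ∀ x, wrap s x ∈ H b ↔ x ∈ H d := by
  induction s generalizing b with
  | nil =>
    obtain rfl : b = d := by simpa [descend] using h
    exact ⟨Or.inl rfl, fun x => Iff.rfl⟩
  | cons p s ih =>
    obtain ⟨n, T⟩ := p
    cases hl : limIdx b with
    | none =>
      rw [descend, List.foldl_cons, stepDown, Option.bind_some, hl, Option.bind_none,
        foldl_stepDown_none] at h
      simp at h
    | some e =>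
      obtain rfl := eq_of_limIdx hl
      obtain ⟨f, hf⟩ := exists_isFund_of_lim_mem hb
      obtain ⟨-, h⟩ := (descend_cons hf).1 h
      obtain ⟨h1, h2⟩ := ih (hf.apply_mem n) h
      refine ⟨Or.inr (h1.elim (fun h => h ▸ hf.lt n) fun h => h.trans (hf.lt n)), fun x => ?_⟩
      rw [← h2 x]
      exact hf.pair_mem_H _ _

/-- Following the fundamental sequences downwards reaches a successor notation after finitely many
steps, without falling to `γ` or below. The running times recorded in `s` make each step decidable.
-/
theorem exists_descend {b : ℕ} (hb : b ∈ kleeneO) : ∀ {γ : Ordinal.{0}}, γ < nrank b →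
    ∃ s d, descend b s = some (2 ^ d) ∧ d ∈ kleeneO ∧ γ < nrank (2 ^ d) := by
  refine kleeneO_induction (p := fun b => ∀ {γ : Ordinal.{0}}, γ < nrank b →
    ∃ s d, descend b s = some (2 ^ d) ∧ d ∈ kleeneO ∧ γ < nrank (2 ^ d)) ?_ ?_ ?_ hb
  · intro γ h
    rw [nrank_one] at h
    exact absurd h (not_lt.2 bot_le)
  · intro c hc _ γ h
    exact ⟨[], c, rfl, hc, h⟩
  · intro e f hf ih γ h
    obtain ⟨n, hn⟩ := hf.lt_nrank h
    obtain ⟨s, d, h1, h2, h3⟩ := ih n hn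
    obtain ⟨T, hT⟩ := Nat.Partrec.Code.evaln_complete.1 (hf.1 n)
    exact ⟨(n, T) :: s, d, (descend_cons hf).2 ⟨hT, h1⟩, h2, h3⟩

section

variable {α : Type*} [Primcodable α]

@[fun_prop] theorem primrec_foldl {β γ : Type*} [Primcodable β] [Primcodable γ] {l : α → List β}
    {d : α → γ} {g : α → γ → β → γ} (hl : Primrec l) (hd : Primrec d)
    (hg : Primrec (fun p : α × γ × β => g p.1 p.2.1 p.2.2)) :
    Primrec (fun x => (l x).foldl (g x) (d x)) :=
  Primrec.list_foldl hl hd (h := fun a p => g a p.1 p.2) hg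

@[fun_prop] theorem primrec_descend {b : α → ℕ} {s : α → List (ℕ × ℕ)} (hb : Primrec b)
    (hs : Primrec s) : Primrec (fun x => descend (b x) (s x)) := by
  unfold descend stepDown; fun_prop

@[fun_prop] theorem primrec_wrap {x : α → ℕ} {s : α → List (ℕ × ℕ)} (hs : Primrec s)
    (hx : Primrec x) : Primrec (fun a => wrap (s a) (x a)) := by
  unfold wrap; fun_prop

end

/-! ### Statements with iterated quantifiers, as halting problems -/

section Sat

variable {Z : Type} [Primcodable Z]

/-- Index of the halting problem for the statement `z` at the level of the notation `c`; with
`t = true` it is the negation of its universal instance `i`. -/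
def satIdx (N c : ℕ) (t : Bool) (z : Z) (i : ℕ) : ℕ := idxRun N (enc (N, c, t, z, i))

theorem primrec_satIdx {α : Type*} [Primcodable α] {N c i : α → ℕ} {t : α → Bool} {z : α → Z}
    (hN : Primrec N) (hc : Primrec c) (ht : Primrec t) (hz : Primrec z) (hi : Primrec i) :
    Primrec (fun x => satIdx (N x) (c x) (t x) (z x) (i x)) :=
  primrec_idxRun hN (primrec_enc (primrec_mk hN (primrec_mk hc (primrec_mk ht
    (primrec_mk hz hi)))))

/-- The oracle question, and how to read the answer: `0` for failure, `1` for success, `2` for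
success if the answer is yes and `3` for success if it is no. -/
def limQuery (N c : ℕ) (z : Z) (w : ℕ) : ℕ × ℕ :=
  (dec (List (ℕ × ℕ)) w).elim (0, 0) fun s => (descend c s).elim (0, 0) fun b =>
    bif 2 ^ lg b == b && !(b == 1) then (wrap s (satIdx N (lg b) false z 0), 2) else (0, 0)

/-- The oracle question at the level of a successor. -/
def succQuery (N d : ℕ) (z : Z) (w : ℕ) : ℕ × ℕ :=
  bif d == 1 || (limIdx d).isSome then (satIdx N d false z 0, 2) else (satIdx N d true z w, 3)

variable (R : Z → ℕ → Bool) (k : Z → ℕ → ℕ → Z)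

/-- The oracle question of the halting problem for a statement. -/
def satQuery (p : ℕ × ℕ × Bool × Z × ℕ) (w : ℕ) : ℕ × ℕ :=
  bif p.2.2.1 then
    (satIdx p.1 (lg p.2.1) false (k p.2.2.2.1 p.2.2.2.2 w) 0, 3)
  else bif p.2.1 == 1 then (0, bif R p.2.2.2.1 w then 1 else 0)
  else bif (limIdx p.2.1).isSome then limQuery p.1 p.2.1 p.2.2.2.1 w
  else succQuery p.1 (lg p.2.1) p.2.2.2.1 w

/-- Reading of the answer to an oracle question. -/
def readAnswer (m : ℕ) (t : Bool) : Bool := m == 1 || (m == 2 && t) || (m == 3 && !t)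

/-- Success of an oracle question. -/
def Success (q : ℕ × ℕ) (X : Set ℕ) : Prop := q.2 = 1 ∨ q.2 = 2 ∧ q.1 ∈ X ∨ q.2 = 3 ∧ q.1 ∉ X

variable {R k}

theorem primrec_limQuery : Primrec fun p : ℕ × ℕ × Z × ℕ => limQuery p.1 p.2.1 p.2.2.1 p.2.2.2 := by
  have h1 : Primrec fun q : ((ℕ × ℕ × Z × ℕ) × List (ℕ × ℕ)) × ℕ =>
      satIdx q.1.1.1 (lg q.2) false q.1.1.2.2.1 0 :=
    primrec_satIdx (by fun_prop) (by fun_prop) (by fun_prop) (by fun_prop) (by fun_prop)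
  have h2 : Primrec fun q : ((ℕ × ℕ × Z × ℕ) × List (ℕ × ℕ)) × ℕ =>
      bif 2 ^ lg q.2 == q.2 && !(q.2 == 1) then
        (wrap q.1.2 (satIdx q.1.1.1 (lg q.2) false q.1.1.2.2.1 0), 2) else (0, 0) :=
    primrec_cond (by clear h1; fun_prop) (primrec_mk (primrec_wrap (by fun_prop) h1)
      (primrec_const 2)) (primrec_const _)
  have h3 : Primrec fun q : (ℕ × ℕ × Z × ℕ) × List (ℕ × ℕ) => descend q.1.2.1 q.2 := by
    clear h1 h2; fun_prop
  have h4 : Primrec fun q : ℕ × ℕ × Z × ℕ => dec (List (ℕ × ℕ)) q.2.2.2 := by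
    clear h1 h2 h3; fun_prop
  exact primrec_option_elim h4 (primrec_const _) (primrec_option_elim h3 (primrec_const _) h2)

theorem primrec_succQuery :
    Primrec fun p : ℕ × ℕ × Z × ℕ => succQuery p.1 p.2.1 p.2.2.1 p.2.2.2 := by
  have h1 : Primrec fun p : ℕ × ℕ × Z × ℕ => satIdx p.1 p.2.1 false p.2.2.1 0 :=
    primrec_satIdx (by fun_prop) (by fun_prop) (by fun_prop) (by fun_prop) (by fun_prop)
  have h2 : Primrec fun p : ℕ × ℕ × Z × ℕ => satIdx p.1 p.2.1 true p.2.2.1 p.2.2.2 :=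
    primrec_satIdx (by fun_prop) (by fun_prop) (by fun_prop) (by fun_prop) (by fun_prop)
  exact primrec_cond (by clear h1 h2; fun_prop) (primrec_mk h1 (primrec_const _))
    (primrec_mk h2 (primrec_const _))

theorem primrec_satQuery (hR : Primrec fun p : Z × ℕ => R p.1 p.2)
    (hk : Primrec fun p : Z × ℕ × ℕ => k p.1 p.2.1 p.2.2) :
    Primrec fun q : (ℕ × ℕ × Bool × Z × ℕ) × ℕ => satQuery R k q.1 q.2 := by
  have h1 := hk.comp (by fun_prop : Primrec fun q : (ℕ × ℕ × Bool × Z × ℕ) × ℕ =>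
    (q.1.2.2.2.1, q.1.2.2.2.2, q.2))
  have h2 := hR.comp (by fun_prop : Primrec fun q : (ℕ × ℕ × Bool × Z × ℕ) × ℕ =>
    (q.1.2.2.2.1, q.2))
  have h3 := primrec_limQuery.comp (by fun_prop : Primrec fun q : (ℕ × ℕ × Bool × Z × ℕ) × ℕ =>
    (q.1.1, q.1.2.1, q.1.2.2.2.1, q.2))
  have h4 := primrec_succQuery.comp (by fun_prop : Primrec fun q : (ℕ × ℕ × Bool × Z × ℕ) × ℕ =>
    (q.1.1, lg q.1.2.1, q.1.2.2.2.1, q.2))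
  have h5 : Primrec fun q : (ℕ × ℕ × Bool × Z × ℕ) × ℕ => q.1.2.2.1 := by
    clear hR hk h1 h2 h3 h4; fun_prop
  have h6 : Primrec fun q : (ℕ × ℕ × Bool × Z × ℕ) × ℕ => q.1.2.1 := by
    clear hR hk h1 h2 h3 h4; fun_prop
  have h7 : Primrec fun q : (ℕ × ℕ × Bool × Z × ℕ) × ℕ => q.1.1 := by
    clear hR hk h1 h2 h3 h4; fun_prop
  exact primrec_cond h5 (primrec_mk (primrec_satIdx h7 (primrec_lg h6) (primrec_const _) h1
      (primrec_const _)) (primrec_const _))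
    (primrec_cond (primrec_nat_beq h6 (primrec_const _))
      (primrec_mk (primrec_const _) (primrec_cond h2 (primrec_const _) (primrec_const _)))
      (primrec_cond (primrec_isSome (primrec_limIdx h6)) h3 h4))

theorem readAnswer_eq_true {m : ℕ} {P : Prop} [Decidable P] :
    readAnswer m (decide P) = true ↔ m = 1 ∨ m = 2 ∧ P ∨ m = 3 ∧ ¬ P := by
  simp [readAnswer, or_assoc]

/-- Self-reference without a fixed-point theorem: the index `N` of the program is part of its own
input, so the program can form the indices of the lower-level halting problems it asks about. -/
theorem exists_satIdx (hR : Primrec fun p : Z × ℕ => R p.1 p.2)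
    (hk : Primrec fun p : Z × ℕ × ℕ => k p.1 p.2.1 p.2.2) :
    ∃ N : ℕ, ∀ (X : Set ℕ) c t z i, satIdx N c t z i ∈ jump X ↔ ∃ w,
      Success (satQuery R k (N, c, t, z, i) w) X := by
  classical
  have h0 : Primrec fun q : ℕ × ℕ => (dec (ℕ × ℕ × Bool × Z × ℕ) q.1).elim (0, 0)
      fun p => satQuery R k p q.2 := by
    have h1 : Primrec fun q : (ℕ × ℕ) × (ℕ × ℕ × Bool × Z × ℕ) => satQuery R k q.2 q.1.2 := by
      have := (primrec_satQuery hR hk).comp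
        (by fun_prop : Primrec fun q : (ℕ × ℕ) × (ℕ × ℕ × Bool × Z × ℕ) => (q.2, q.1.2))
      exact this
    exact primrec_option_elim (primrec_dec Primrec.fst) (primrec_const _) h1
  obtain ⟨N, hN⟩ := exists_idxRun
    (q := fun p w => ((dec (ℕ × ℕ × Bool × Z × ℕ) p).elim (0, 0) fun p => satQuery R k p w).1)
    (t := fun p w => readAnswer
      ((dec (ℕ × ℕ × Bool × Z × ℕ) p).elim (0, 0) fun p => satQuery R k p w).2)
    (Primrec.fst.comp h0) (by
      have h1 : Primrec fun p : ℕ × Bool => readAnswer p.1 p.2 := by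
        unfold readAnswer; clear h0 hk hR; fun_prop
      have h2 := Primrec.snd.comp (h0.comp (Primrec.fst (α := ℕ × ℕ) (β := Bool)))
      have := h1.comp (h2.pair Primrec.snd)
      exact this)
  refine ⟨N, fun X c t z i => ?_⟩
  rw [satIdx, hN]
  simp only [dec_enc, Option.elim_some]
  exact exists_congr fun w => readAnswer_eq_true

variable (R k) in
/-- Membership of statements in the sets `H_{2 ^ c}`, described by recursion on the notation. -/
structure IsSat (S : ℕ → Z → Prop) : Prop where
  one : ∀ z, S 1 z ↔ ∃ i, R z i = true
  lim : ∀ {e f}, IsFund e f → ∀ z,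
    (S (3 * 5 ^ e) z ↔ ∃ s d, descend (3 * 5 ^ e) s = some (2 ^ d) ∧ d ∈ kleeneO ∧ S d z)
  two : ∀ z, S (2 ^ 1) z ↔ S 1 z
  lim_succ : ∀ {e f}, IsFund e f → ∀ z, (S (2 ^ (3 * 5 ^ e)) z ↔ S (3 * 5 ^ e) z)
  succ_succ : ∀ {d}, d ∈ kleeneO → ∀ z, (S (2 ^ 2 ^ d) z ↔ ∃ i, ∀ m, S d (k z i m))

/-- Each level adds one existential search with one oracle question per candidate. A block `∃∀` uses
two jumps; where only one level separates a notation from `1` or from a limit, that level is left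
unused. At a limit the search runs over descents, and `wrap` moves the question into the effective
union. -/
theorem exists_isSat (hR : Primrec fun p : Z × ℕ => R p.1 p.2)
    (hk : Primrec fun p : Z × ℕ × ℕ => k p.1 p.2.1 p.2.2) :
    ∃ g : ℕ → Z → ℕ, (∀ c, Primrec (g c)) ∧ (∀ c, Function.Injective (g c)) ∧
      IsSat R k fun c z => g c z ∈ H (2 ^ c) := by
  obtain ⟨N, hN⟩ := exists_satIdx hR hk
  have ne0 : ∀ {c}, c ∈ kleeneO → c ≠ 0 := fun hc h => zero_notMem_kleeneO (h ▸ hc)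
  have key : ∀ {c}, c ∈ kleeneO → ∀ t z i, satIdx N c t z i ∈ H (2 ^ c) ↔ ∃ w,
      Success (satQuery R k (N, c, t, z, i) w) (H c) :=
    fun hc t z i => by rw [H_two_pow hc]; exact hN _ _ _ _ _
  refine ⟨fun c z => satIdx N c false z 0, fun c => ?_, fun c z z' h => ?_, ?_⟩
  · exact primrec_satIdx (by fun_prop) (by fun_prop) (by fun_prop) (by fun_prop) (by fun_prop)
  · have := enc_injective (idxRun_injective N h)
    simpa using this
  constructor
  · intro z
    rw [key one_mem_kleeneO]
    refine exists_congr fun w => ?_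
    cases hw : R z w <;> simp [satQuery, Success, hw]
  · intro e f hf z
    rw [key hf.mem]
    have h1 : (3 * 5 ^ e == 1) = false := beq_false_of_ne (by omega)
    simp only [satQuery, cond_false, h1, limIdx_lim, Option.isSome_some, cond_true]
    constructor
    · rintro ⟨w, hw⟩
      unfold limQuery at hw
      cases hs : dec (List (ℕ × ℕ)) w with
      | none => simp [hs, Success] at hw
      | some s =>
        rw [hs] at hw
        simp only [Option.elim_some] at hw
        cases hb : descend (3 * 5 ^ e) s with
        | none => simp [hb, Success] at hw
        | some b =>
          rw [hb] at hw
          simp only [Option.elim_some] at hw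
          cases hc : (2 ^ lg b == b && !(b == 1)) with
          | false => simp [hc, Success] at hw
          | true =>
            rw [hc] at hw
            simp only [Bool.and_eq_true, beq_iff_eq, Bool.not_eq_true', beq_eq_false_iff_ne] at hc
            obtain ⟨h2, h3⟩ := descend_spec hf.mem hb
            have hbO : b ∈ kleeneO := h2.elim (fun h => h ▸ hf.mem) mem_kleeneO_left
            have hl0 : lg b ≠ 0 := fun h => hc.2 (by rw [← hc.1, h]; rfl)
            have hlO : lg b ∈ kleeneO := mem_of_two_pow_mem (by rwa [hc.1]) hl0
            refine ⟨s, lg b, by rw [hb, hc.1], hlO, ?_⟩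
            rw [hc.1, ← h3]
            simpa [Success] using hw
    · rintro ⟨s, d, hs, hd, h⟩
      refine ⟨enc s, ?_⟩
      have h2 : (2 ^ d == 1) = false := beq_false_of_ne (by simpa using ne0 hd)
      simp only [limQuery, dec_enc, Option.elim_some, hs, lg_two_pow, beq_self_eq_true, h2,
        Bool.not_false, Bool.and_self, cond_true]
      simpa [Success, (descend_spec hf.mem hs).2] using h
  · intro z
    rw [key (two_pow_mem one_mem_kleeneO)]
    have e1 : ((2 : ℕ) ^ 1 == 1) = false := rfl
    simp only [satQuery, cond_false, e1, limIdx_two_pow, Option.isSome_none, succQuery,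
      lg_two_pow, beq_self_eq_true, Bool.true_or, cond_true]
    simp [Success]
  · intro e f hf z
    rw [key (two_pow_mem hf.mem)]
    have e1 : (2 ^ (3 * 5 ^ e) == 1) = false := beq_false_of_ne (by simp)
    simp only [satQuery, cond_false, e1, limIdx_two_pow, Option.isSome_none, succQuery,
      lg_two_pow, limIdx_lim, Option.isSome_some, Bool.or_true, cond_true]
    simp [Success]
  -- The outer jump searches for `i` with a negative answer to the inner jump, which searches for an
  -- `m` at which the instance fails.
  · intro d hd z
    rw [key (two_pow_mem (two_pow_mem hd))]
    have e1 : (2 ^ 2 ^ d == 1) = false := beq_false_of_ne (by simp)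
    have e2 : (2 ^ d == 1) = false := beq_false_of_ne (by simpa using ne0 hd)
    simp only [satQuery, cond_false, e1, limIdx_two_pow, Option.isSome_none, succQuery,
      lg_two_pow, e2, Bool.or_self]
    have h3 : ∀ i, satIdx N (2 ^ d) true z i ∈ H (2 ^ 2 ^ d) ↔
        ∃ m, satIdx N d false (k z i m) 0 ∉ H (2 ^ d) := by
      intro i
      rw [key (two_pow_mem hd)]
      simp [satQuery, Success, lg_two_pow]
    simp only [Success]
    refine exists_congr fun i => ?_
    simp [h3]

end Sat

end KW

namespace KW

/-! ### Induction on the level of a statement -/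

theorem kleeneO_cases_two {d : ℕ} (hd : d ∈ kleeneO) :
    d = 1 ∨ d = 2 ^ 1 ∨ (∃ c ∈ kleeneO, d = 2 ^ 2 ^ c) ∨
      ∃ e f, IsFund e f ∧ (d = 3 * 5 ^ e ∨ d = 2 ^ (3 * 5 ^ e)) := by
  rcases kleeneO_cases hd with rfl | ⟨c, rfl, hc⟩ | ⟨e, f, rfl, hf⟩
  · exact Or.inl rfl
  · rcases kleeneO_cases hc with rfl | ⟨b, rfl, hb⟩ | ⟨e, f, rfl, hf⟩
    · exact Or.inr (Or.inl rfl)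
    · exact Or.inr (Or.inr (Or.inl ⟨b, hb, rfl⟩))
    · exact Or.inr (Or.inr (Or.inr ⟨e, f, hf, Or.inr rfl⟩))
  · exact Or.inr (Or.inr (Or.inr ⟨e, f, hf, Or.inl rfl⟩))

theorem ltO_of_descend {e : ℕ} {f : ℕ → ℕ} (hf : IsFund e f) {s : List (ℕ × ℕ)} {d : ℕ}
    (h : descend (3 * 5 ^ e) s = some (2 ^ d)) : LtO (2 ^ d) (3 * 5 ^ e) :=
  (descend_spec hf.mem h).1.resolve_left (two_pow_ne _ _)

theorem add_one_lt_of_isFund {e : ℕ} {f : ℕ → ℕ} (hf : IsFund e f) {α : Ordinal.{0}}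
    (h : α < nrank (3 * 5 ^ e)) : α + 1 < nrank (3 * 5 ^ e) := by
  simpa using hf.isSuccLimit.succ_lt h

section

variable {Z : Type} {R : Z → ℕ → Bool} {k : Z → ℕ → ℕ → Z} {S : ℕ → Z → Prop}

/-- The choice `i = 0` repeats the statement, so a statement true at the bottom remains true at
every level. -/
theorem IsSat.of_persistent (hS : IsSat R k S) {z : Z} (h : ∃ w, R z w = true) (hk : ∀ m, k z 0 m = z) {d : ℕ}
    (hd : d ∈ kleeneO) : S d z := by
  induction d using wellFounded_ltO.induction with
  | _ d ih =>
    have lim : ∀ {e f}, IsFund e f → (∀ d', LtO d' (3 * 5 ^ e) → d' ∈ kleeneO → S d' z) →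
        S (3 * 5 ^ e) z := by
      intro e f hf ih
      obtain ⟨s, d, h1, h2, -⟩ := exists_descend hf.mem (hf.isSuccLimit.bot_lt)
      exact (hS.lim hf z).2 ⟨s, d, h1, h2,
        ih d ((lt_two_pow_of_mem h2).trans (ltO_of_descend hf h1)) h2⟩
    rcases kleeneO_cases_two hd with rfl | rfl | ⟨c, hc, rfl⟩ | ⟨e, f, hf, rfl | rfl⟩
    · exact (hS.one z).2 h
    · exact (hS.two z).2 ((hS.one z).2 h)
    · refine (hS.succ_succ hc z).2 ⟨0, fun m => ?_⟩
      rw [hk]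
      exact ih c ((lt_two_pow_of_mem hc).trans (lt_two_pow_of_mem (two_pow_mem hc))) hc
    · exact lim hf fun d' h => ih d' h
    · exact (hS.lim_succ hf z).2 (lim hf fun d' h => ih d' (h.trans (lt_two_pow_of_mem hf.mem)))

/-- Induction principle for deriving consequences. The ordinal is the rank of `2 ^ d`, although half
of it would do at successors; the loss is harmless below a limit. -/
theorem IsSat.sound (hS : IsSat R k S) {Q : Z → Ordinal.{0} → Prop}
    (h0 : ∀ z w, R z w = true → Q z 0)
    (hmono : ∀ z α β, α ≤ β → Q z α → Q z β)
    (hstep : ∀ d ∈ kleeneO, (∀ z, S d z → Q z (nrank (2 ^ d))) →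
      ∀ z, (∃ i, ∀ m, S d (k z i m)) → Q z (nrank (2 ^ d) + 1)) {d : ℕ} (hd : d ∈ kleeneO) :
    ∀ z, S d z → Q z (nrank (2 ^ d)) := by
  induction d using wellFounded_ltO.induction with
  | _ d ih =>
    have one : ∀ z, S 1 z → ∀ α, Q z α := by
      intro z hz α
      obtain ⟨w, hw⟩ := (hS.one z).1 hz
      exact hmono z 0 α bot_le (h0 z w hw)
    have lim : ∀ {e f}, IsFund e f → (∀ d', LtO d' (3 * 5 ^ e) → d' ∈ kleeneO → ∀ z, S d' z →
        Q z (nrank (2 ^ d'))) → ∀ z, S (3 * 5 ^ e) z → Q z (nrank (3 * 5 ^ e)) := by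
      intro e f hf ih z hz
      obtain ⟨s, d, h1, h2, h3⟩ := (hS.lim hf z).1 hz
      have h4 := ltO_of_descend hf h1
      exact hmono z _ _ (nrank_lt h4).le (ih d ((lt_two_pow_of_mem h2).trans h4) h2 z h3)
    intro z hz
    rcases kleeneO_cases_two hd with rfl | rfl | ⟨c, hc, rfl⟩ | ⟨e, f, hf, rfl | rfl⟩
    · exact one z hz _
    · exact one z ((hS.two z).1 hz) _
    · have h1 := lt_two_pow_of_mem hc
      have h2 := lt_two_pow_of_mem (two_pow_mem hc)
      refine hmono z _ _ ?_ (hstep c hc (ih c (h1.trans h2) hc) z ((hS.succ_succ hc z).1 hz))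
      rw [nrank_two_pow (two_pow_mem (two_pow_mem hc)), nrank_two_pow (two_pow_mem hc)]
      exact le_self_add
    · refine hmono z _ _ (nrank_lt (lt_two_pow_of_mem hd)).le (lim hf (fun d' h => ih d' h) z hz)
    · have h1 := lt_two_pow_of_mem hf.mem
      refine hmono z _ _ (nrank_lt (h1.trans (lt_two_pow_of_mem hd))).le
        (lim hf (fun d' h => ih d' (h.trans h1)) z ((hS.lim_succ hf z).1 hz))

/-- At `d = 2 ^ 2 ^ c` the rank of `2 ^ d` exceeds that of `2 ^ c` by two, which pays for one block
of quantifiers. At a limit, or one above it, one first descends to a notation whose rank is still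
large enough. -/
theorem IsSat.of_step (hS : IsSat R k S) {z : Z} {γ : Ordinal.{0}}
    (h : ∀ d ∈ kleeneO, 2 * γ + 1 ≤ nrank (2 ^ d) → ∃ i, ∀ m, S d (k z i m)) {d : ℕ}
    (hd : d ∈ kleeneO) (hγ : 2 * (γ + 1) + 1 ≤ nrank (2 ^ d)) : S d z := by
  have e3 : 2 * (γ + 1) + 1 = 2 * γ + 1 + 1 + 1 := by
    rw [mul_add, mul_one, ← one_add_one_eq_two, ← add_assoc]
  rw [e3] at hγ
  induction d using wellFounded_ltO.induction with
  | _ d ih =>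
    have lim : ∀ {e f}, IsFund e f → 2 * γ < nrank (3 * 5 ^ e) →
        (∀ d', LtO d' (3 * 5 ^ e) → d' ∈ kleeneO → 2 * γ + 1 + 1 + 1 ≤ nrank (2 ^ d') → S d' z) →
        S (3 * 5 ^ e) z := by
      intro e f hf hlt ih
      have h1 := add_one_lt_of_isFund hf (add_one_lt_of_isFund hf (add_one_lt_of_isFund hf hlt))
      obtain ⟨s, d, h2, h3, h4⟩ := exists_descend hf.mem h1
      exact (hS.lim hf z).2 ⟨s, d, h2, h3,
        ih d ((lt_two_pow_of_mem h3).trans (ltO_of_descend hf h2)) h3 h4.le⟩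
    have cancel : ∀ {α β : Ordinal.{0}}, α + 1 ≤ β + 1 → α ≤ β := fun {α β} h => by
      simpa using h
    rcases kleeneO_cases_two hd with rfl | rfl | ⟨c, hc, rfl⟩ | ⟨e, f, hf, rfl | rfl⟩
    · rw [nrank_two_pow hd, nrank_one] at hγ
      have := cancel hγ
      simp at this
    · rw [nrank_two_pow hd, nrank_two_pow one_mem_kleeneO, nrank_one] at hγ
      have := cancel (cancel hγ)
      simp at this
    · refine (hS.succ_succ hc z).2 (h c hc ?_)
      rw [nrank_two_pow hd, nrank_two_pow (two_pow_mem hc)] at hγ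
      exact cancel (cancel hγ)
    · refine lim hf ?_ fun d' h => ih d' h
      rw [nrank_two_pow hd] at hγ
      exact lt_of_lt_of_le ((lt_add_one _).trans (lt_add_one _)) (cancel hγ)
    · have h1 := lt_two_pow_of_mem hf.mem
      refine (hS.lim_succ hf z).2 (lim hf ?_ fun d' h => ih d' (h.trans h1))
      rw [nrank_two_pow hd, nrank_two_pow hf.mem] at hγ
      exact lt_of_lt_of_le (lt_add_one _) (cancel (cancel hγ))

end

end KW

/-! ### Arithmetization of the coding of continuous functions. -/

namespace KW

open Set Filter Topology

/-! ### Encoding a function, as a conjunction of existential statements -/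

/-- The type of the elements of codes. -/
abbrev Quint := ℕ × ℚ × ℚ × ℚ × ℚ

/-- The program `e` on input `k` gives the value `v` within `T` steps. -/
def hasVal (e v T k : ℕ) : Bool :=
  (Nat.Partrec.Code.evaln T (Denumerable.ofNat Nat.Partrec.Code e) k).elim false fun u => u == v

theorem mem_of_hasVal {e v T k : ℕ} (h : hasVal e v T k = true) : v ∈ phi e k := by
  unfold hasVal at h
  cases hu : Nat.Partrec.Code.evaln T (Denumerable.ofNat Nat.Partrec.Code e) k with
  | none => simp [hu] at h
  | some u =>
    obtain rfl : u = v := by simpa [hu] using h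
    exact Nat.Partrec.Code.evaln_sound (Option.mem_def.2 hu)

theorem eventually_hasVal {e v k : ℕ} (h : v ∈ phi e k) :
    ∀ᶠ T in atTop, hasVal e v T k = true := by
  obtain ⟨T, hT⟩ := Nat.Partrec.Code.evaln_complete.1 h
  filter_upwards [eventually_ge_atTop T] with T' hT'
  have := Nat.Partrec.Code.evaln_mono hT' hT
  simp [hasVal, Option.mem_def.1 this]

theorem exists_hasVal_iff {e v k : ℕ} : (∃ T, hasVal e v T k = true) ↔ v ∈ phi e k :=
  ⟨fun ⟨_, h⟩ => mem_of_hasVal h, fun h => (eventually_hasVal h).exists⟩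

section

variable {α : Type*} [Primcodable α]

@[fun_prop] theorem primrec_hasVal {e v T k : α → ℕ} (he : Primrec e) (hv : Primrec v)
    (hT : Primrec T) (hk : Primrec k) :
    Primrec (fun x => hasVal (e x) (v x) (T x) (k x)) := by
  have : Primrec fun p : ℕ × ℕ × ℕ × ℕ => hasVal p.1 p.2.1 p.2.2.1 p.2.2.2 := by
    unfold hasVal; fun_prop
  have := this.comp (he.pair (hv.pair (hT.pair hk)))
  exact this

/-- The range condition on the elements of codes. -/
def inRange (t : Quint) : Bool :=
  ratLe 0 t.2.1 && ratLe t.2.1 1 && ratLt 0 t.2.2.1 && ratLt 0 t.2.2.2.2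

theorem primrec_inRange : Primrec inRange := by unfold inRange; fun_prop

theorem inRange_iff {t : Quint} :
    inRange t = true ↔ (0 ≤ t.2.1 ∧ t.2.1 ≤ 1) ∧ 0 < t.2.2.1 ∧ 0 < t.2.2.2.2 := by
  simp [inRange, and_assoc]

/-- The value at `k` is that of the characteristic function of a set of codes of quintuples. -/
def testRange (e k T : ℕ) : Bool :=
  hasVal e 0 T k || (hasVal e 1 T k && (dec Quint k).elim false fun t => enc t == k && inRange t)

theorem primrec_testRange : Primrec fun p : ℕ × ℕ × ℕ => testRange p.1 p.2.1 p.2.2 := by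
  have h1 : Primrec fun q : (ℕ × ℕ × ℕ) × Quint => enc q.2 == q.1.2.1 && inRange q.2 :=
    primrec_and (primrec_nat_beq (primrec_enc Primrec.snd) (by fun_prop))
      (primrec_inRange.comp Primrec.snd)
  have h2 : Primrec fun p : ℕ × ℕ × ℕ => dec Quint p.2.1 := primrec_dec (by fun_prop)
  exact primrec_or (by clear h1 h2; fun_prop) (primrec_and (by clear h1 h2; fun_prop)
    (primrec_option_elim h2 (primrec_const _) h1))

theorem exists_testRange_iff {e k : ℕ} : (∃ T, testRange e k T = true) ↔
    0 ∈ phi e k ∨ 1 ∈ phi e k ∧ ∃ t, codeQuint t = k ∧ inRange t = true := by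
  have hd : ((dec Quint k).elim false fun t => enc t == k && inRange t) = true ↔
      ∃ t, codeQuint t = k ∧ inRange t = true := by
    constructor
    · intro h
      cases ht : dec Quint k with
      | none => simp [ht] at h
      | some t =>
        rw [ht, Option.elim_some, Bool.and_eq_true, beq_iff_eq] at h
        exact ⟨t, h.1, h.2⟩
    · rintro ⟨t, rfl, h⟩
      have : dec Quint (codeQuint t) = some t := dec_enc t
      rw [this, Option.elim_some, Bool.and_eq_true, beq_iff_eq]
      exact ⟨rfl, h⟩
  rw [← hd, ← exists_hasVal_iff, ← exists_hasVal_iff, ← exists_and_right, ← exists_or]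
  simp only [testRange, Bool.or_eq_true, Bool.and_eq_true]

/-- Compatibility of two elements with the same ball. -/
def testCompat (e : ℕ) (x : Quint × ℕ × ℚ × ℚ) (T : ℕ) : Bool :=
  hasVal e 0 T (enc x.1) || hasVal e 0 T (enc (x.2.1, x.1.2.1, x.1.2.2.1, x.2.2.1, x.2.2.2)) ||
    ratLe |x.1.2.2.2.1 - x.2.2.1| (x.1.2.2.2.2 + x.2.2.2)

theorem primrec_testCompat :
    Primrec fun p : ℕ × (Quint × ℕ × ℚ × ℚ) × ℕ => testCompat p.1 p.2.1 p.2.2 := by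
  have h1 : Primrec fun p : ℕ × (Quint × ℕ × ℚ × ℚ) × ℕ => enc p.2.1.1 :=
    primrec_enc (by fun_prop)
  have h2 : Primrec fun p : ℕ × (Quint × ℕ × ℚ × ℚ) × ℕ =>
      enc (p.2.1.2.1, p.2.1.1.2.1, p.2.1.1.2.2.1, p.2.1.2.2.1, p.2.1.2.2.2) :=
    primrec_enc (by clear h1; fun_prop)
  exact primrec_or (primrec_or
    (primrec_hasVal Primrec.fst (primrec_const _) (by clear h1 h2; fun_prop) h1)
    (primrec_hasVal Primrec.fst (primrec_const _) (by clear h1 h2; fun_prop) h2))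
    (by clear h1 h2; fun_prop)

theorem exists_testCompat_iff {e n n' : ℕ} {a r b s b' s' : ℚ} :
    (∃ T, testCompat e ((n, a, r, b, s), n', b', s') T = true) ↔
      0 ∈ phi e (codeQuint (n, a, r, b, s)) ∨ 0 ∈ phi e (codeQuint (n', a, r, b', s')) ∨
        |b - b'| ≤ s + s' := by
  simp only [testCompat, Bool.or_eq_true, ratLe_eq_true, exists_or, exists_const, enc_eq_codeQuint,
    exists_hasVal_iff, or_assoc]

/-- An element gives rise to a given other element. -/
def testMove (e : ℕ) (c : Bool) (t : Quint) (x : ℚ × ℚ × ℚ × ℚ) (w : ℕ) : Bool :=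
  hasVal e 0 w.unpair.1 (enc t) || !c || hasVal e 1 w.unpair.1 (enc (w.unpair.2, x))

theorem primrec_testMove {e w : α → ℕ} {c : α → Bool} {t : α → Quint} {x : α → ℚ × ℚ × ℚ × ℚ}
    (he : Primrec e) (hc : Primrec c) (ht : Primrec t) (hx : Primrec x) (hw : Primrec w) :
    Primrec fun a => testMove (e a) (c a) (t a) (x a) (w a) := by
  have h0 : Primrec fun a => (w a).unpair := by fun_prop
  exact primrec_or (primrec_or
    (primrec_hasVal he (primrec_const _) (primrec_fst h0) (primrec_enc ht)) (primrec_not hc))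
    (primrec_hasVal he (primrec_const _) (primrec_fst h0)
      (primrec_enc (primrec_mk (primrec_snd h0) hx)))

theorem exists_testMove_iff {e : ℕ} {c : Bool} {t : Quint} {x : ℚ × ℚ × ℚ × ℚ} :
    (∃ w, testMove e c t x w = true) ↔ 0 ∈ phi e (codeQuint t) ∨
      (c = true → ∃ n, 1 ∈ phi e (codeQuint (n, x))) := by
  simp only [testMove, Bool.or_eq_true, enc_eq_codeQuint, Bool.not_eq_true']
  constructor
  · rintro ⟨w, (h | h) | h⟩
    · exact Or.inl (mem_of_hasVal h)
    · exact Or.inr fun h' => by simp [h] at h'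
    · exact Or.inr fun _ => ⟨_, mem_of_hasVal h⟩
  · rintro (h | h)
    · obtain ⟨T, hT⟩ := exists_hasVal_iff.2 h
      exact ⟨Nat.pair T 0, Or.inl (Or.inl (by simpa using hT))⟩
    · cases c with
      | false => exact ⟨0, Or.inl (Or.inr rfl)⟩
      | true =>
        obtain ⟨n, hn⟩ := h rfl
        obtain ⟨T, hT⟩ := exists_hasVal_iff.2 hn
        exact ⟨Nat.pair T n, Or.inr (by simpa using hT)⟩

/-- The condition for shrinking a ball. -/
def shrinkCond (x : Quint × ℚ × ℚ) : Bool :=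
  ratLe 0 x.2.1 && ratLe x.2.1 1 && ratLt 0 x.2.2 && ratLt (|x.1.2.1 - x.2.1| + x.2.2) x.1.2.2.1

/-- The condition for enlarging a ball. -/
def enlargeCond (x : Quint × ℚ × ℚ) : Bool :=
  ratLt (|x.1.2.2.2.1 - x.2.1| + x.1.2.2.2.2) x.2.2

/-- Closure under shrinking balls on the left. -/
def testShrink (e : ℕ) (x : Quint × ℚ × ℚ) (w : ℕ) : Bool :=
  testMove e (shrinkCond x) x.1 (x.2.1, x.2.2, x.1.2.2.2.1, x.1.2.2.2.2) w

/-- Closure under enlarging balls on the right. -/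
def testEnlarge (e : ℕ) (x : Quint × ℚ × ℚ) (w : ℕ) : Bool :=
  testMove e (enlargeCond x) x.1 (x.1.2.1, x.1.2.2.1, x.2.1, x.2.2) w

theorem primrec_testShrink :
    Primrec fun p : ℕ × (Quint × ℚ × ℚ) × ℕ => testShrink p.1 p.2.1 p.2.2 := by
  have h : Primrec shrinkCond := by unfold shrinkCond; fun_prop
  exact primrec_testMove (by fun_prop) (h.comp (by fun_prop)) (by fun_prop) (by fun_prop)
    (by fun_prop)

theorem primrec_testEnlarge :
    Primrec fun p : ℕ × (Quint × ℚ × ℚ) × ℕ => testEnlarge p.1 p.2.1 p.2.2 := by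
  have h : Primrec enlargeCond := by unfold enlargeCond; fun_prop
  exact primrec_testMove (by fun_prop) (h.comp (by fun_prop)) (by fun_prop) (by fun_prop)
    (by fun_prop)

/-- The function is known up to `1 / (j + 1)` on a ball that contains the ball of radius
`1 / (N + 1)` around `i / (N + 1)`. -/
def coverCond (j N i : ℕ) (a r s : ℚ) : Bool :=
  ratLt s (1 / ((j + 1 : ℕ) : ℚ)) &&
    ratLt (|(i : ℚ) / ((N + 1 : ℕ) : ℚ) - a| + 1 / ((N + 1 : ℕ) : ℚ)) r

theorem primrec_coverCond {j N i : α → ℕ} {a r s : α → ℚ} (hj : Primrec j) (hN : Primrec N)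
    (hi : Primrec i) (ha : Primrec a) (hr : Primrec r) (hs : Primrec s) :
    Primrec fun x => coverCond (j x) (N x) (i x) (a x) (r x) (s x) := by
  unfold coverCond; fun_prop

/-- The balls of radius `1 / (N + 1)` around the multiples of `1 / (N + 1)` are contained in balls
on which the function is known up to `1 / (j + 1)`. -/
def testCover (e j : ℕ) (x : ℕ × ℕ × List Quint) : Bool :=
  (List.range (x.2.1 + 2)).all fun i => x.2.2.any fun t =>
    hasVal e 1 x.1 (enc t) && coverCond j x.2.1 i t.2.1 t.2.2.1 t.2.2.2.2

theorem primrec_testCover :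
    Primrec fun p : ℕ × ℕ × (ℕ × ℕ × List Quint) => testCover p.1 p.2.1 p.2.2 := by
  have h1 : Primrec fun q : ((ℕ × ℕ × (ℕ × ℕ × List Quint)) × ℕ) × Quint =>
      coverCond q.1.1.2.1 q.1.1.2.2.2.1 q.1.2 q.2.2.1 q.2.2.2.1 q.2.2.2.2.2 :=
    primrec_coverCond (by fun_prop) (by fun_prop) (by fun_prop) (by fun_prop) (by fun_prop)
      (by fun_prop)
  have h2 : Primrec fun q : ((ℕ × ℕ × (ℕ × ℕ × List Quint)) × ℕ) × Quint =>
      hasVal q.1.1.1 1 q.1.1.2.2.1 (enc q.2) :=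
    primrec_hasVal (by clear h1; fun_prop) (primrec_const _) (by clear h1; fun_prop)
      (primrec_enc Primrec.snd)
  exact primrec_all (by clear h1 h2; fun_prop)
    (primrec_any (by clear h1 h2; fun_prop) (primrec_and h2 h1))

/-- The instance `m` of the statement that `e` encodes a function, with the witness `w`. -/
def encTest (e m w : ℕ) : Bool :=
  bif m.unpair.1 == 0 then testRange e m.unpair.2 w
  else bif m.unpair.1 == 1 then
    (dec (Quint × ℕ × ℚ × ℚ) m.unpair.2).elim true fun x => testCompat e x w
  else bif m.unpair.1 == 2 then
    (dec (Quint × ℚ × ℚ) m.unpair.2).elim true fun x => testShrink e x w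
  else bif m.unpair.1 == 3 then
    (dec (Quint × ℚ × ℚ) m.unpair.2).elim true fun x => testEnlarge e x w
  else (dec (ℕ × ℕ × List Quint) w).elim false fun x => testCover e m.unpair.2 x

theorem primrec_encTest : Primrec fun p : ℕ × ℕ × ℕ => encTest p.1 p.2.1 p.2.2 := by
  have hm : Primrec fun p : ℕ × ℕ × ℕ => p.2.1.unpair.1 := by fun_prop
  have hx : Primrec fun p : ℕ × ℕ × ℕ => p.2.1.unpair.2 := by clear hm; fun_prop
  have h0 := primrec_testRange.comp
    (by clear hm hx; fun_prop : Primrec fun p : ℕ × ℕ × ℕ => (p.1, p.2.1.unpair.2, p.2.2))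
  have h1 := primrec_testCompat.comp (by clear hm hx h0; fun_prop :
    Primrec fun p : (ℕ × ℕ × ℕ) × (Quint × ℕ × ℚ × ℚ) => (p.1.1, p.2, p.1.2.2))
  have h2 := primrec_testShrink.comp (by clear hm hx h0 h1; fun_prop :
    Primrec fun p : (ℕ × ℕ × ℕ) × (Quint × ℚ × ℚ) => (p.1.1, p.2, p.1.2.2))
  have h3 := primrec_testEnlarge.comp (by clear hm hx h0 h1 h2; fun_prop :
    Primrec fun p : (ℕ × ℕ × ℕ) × (Quint × ℚ × ℚ) => (p.1.1, p.2, p.1.2.2))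
  have h4 := primrec_testCover.comp (by clear hm hx h0 h1 h2 h3; fun_prop :
    Primrec fun p : (ℕ × ℕ × ℕ) × (ℕ × ℕ × List Quint) => (p.1.1, p.1.2.1.unpair.2, p.2))
  exact primrec_cond (primrec_nat_beq hm (primrec_const _)) h0 <|
    primrec_cond (primrec_nat_beq hm (primrec_const _))
      (primrec_option_elim (primrec_dec hx) (primrec_const _) h1) <|
    primrec_cond (primrec_nat_beq hm (primrec_const _))
      (primrec_option_elim (primrec_dec hx) (primrec_const _) h2) <|
    primrec_cond (primrec_nat_beq hm (primrec_const _))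
      (primrec_option_elim (primrec_dec hx) (primrec_const _) h3) <|
    primrec_option_elim (primrec_dec (Primrec.snd.comp Primrec.snd)) (primrec_const _) h4

end

end KW

namespace KW

open Set Filter Topology

/-- Compatibility is postulated for equal balls only. Both balls are shrunk to a common rational
ball near `x`, whose radius `ρ` is less than half of the room left in each. -/
theorem IsFunctionCode.abs_sub_le {Φ : Set Quint} (hΦ : IsFunctionCode Φ) {x : ℝ}
    (hx : x ∈ Icc (0 : ℝ) 1) {a r b s a' r' b' s' : ℚ} (h : Rel Φ a r b s)
    (h' : Rel Φ a' r' b' s') (hxa : |x - a| < r) (hxa' : |x - a'| < r') : |b - b'| ≤ s + s' := by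
  obtain ⟨ρ, hρ0, hρ⟩ := exists_rat_btwn
    (show (0 : ℝ) < min ((r - |x - a|) / 2) ((r' - |x - a'|) / 2) from
      lt_min (by linarith) (by linarith))
  rw [lt_min_iff] at hρ
  obtain ⟨c, hc0, hc1, hxc⟩ := exists_rat_near hx hρ0
  have hρ0' : 0 < ρ := by exact_mod_cast hρ0
  have key : ∀ {a r : ℚ}, (ρ : ℝ) < (r - |x - a|) / 2 → |a - c| + ρ < r := by
    intro a r h
    have h1 : |(a : ℝ) - c| ≤ |x - a| + |x - c| := by
      rw [abs_sub_comm x a]; exact _root_.abs_sub_le _ _ _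
    have : |(a : ℝ) - c| + ρ < r := by linarith
    exact_mod_cast this
  exact hΦ.compat c ρ b s b' s' (hΦ.shrink _ _ _ _ _ _ h hc0 hc1 hρ0' (key hρ.1))
    (hΦ.shrink _ _ _ _ _ _ h' hc0 hc1 hρ0' (key hρ.2))

/-- At `x` the lower bounds `b - s` lie below all upper bounds `b + s`, so their supremum satisfies
every constraint. -/
theorem IsFunctionCode.exists_represents {Φ : Set Quint} (hΦ : IsFunctionCode Φ)
    (h : ∀ x ∈ Icc (0 : ℝ) 1, ∀ ε : ℝ, 0 < ε →
      ∃ a r b s : ℚ, Rel Φ a r b s ∧ |x - a| < r ∧ (s : ℝ) < ε) : ∃ f, Represents Φ f := by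
  let A : ℝ → Set ℝ := fun x =>
    {y | ∃ a r b s : ℚ, Rel Φ a r b s ∧ |x - a| < r ∧ y = b - s}
  refine ⟨fun x => sSup (A x), fun x hx => ⟨h x hx, fun a r b s hr hxa => ?_⟩⟩
  have hub : ∀ y ∈ A x, y ≤ b + s := by
    rintro y ⟨a', r', b', s', hr', hxa', rfl⟩
    have h1 := hΦ.abs_sub_le hx hr hr' hxa hxa'
    have h2 : |(b : ℝ) - b'| ≤ s + s' := by exact_mod_cast h1
    linarith [(abs_le.1 h2).1]
  have hm : (b : ℝ) - s ∈ A x := ⟨a, r, b, s, hr, hxa, rfl⟩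
  have h1 : sSup (A x) ≤ b + s := csSup_le ⟨_, hm⟩ hub
  have h2 : (b : ℝ) - s ≤ sSup (A x) := le_csSup ⟨_, hub⟩ hm
  rw [abs_le]; constructor <;> linarith

theorem forall_encTest_iff {e : ℕ} : (∀ m, ∃ w, encTest e m w = true) ↔
    (∀ k, ∃ w, testRange e k w = true) ∧ (∀ x, ∃ w, testCompat e x w = true) ∧
      (∀ x, ∃ w, testShrink e x w = true) ∧ (∀ x, ∃ w, testEnlarge e x w = true) ∧
        ∀ j, ∃ x, testCover e j x = true := by
  constructor
  · intro h
    refine ⟨fun k => ?_, fun x => ?_, fun x => ?_, fun x => ?_, fun j => ?_⟩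
    · simpa [encTest] using h (Nat.pair 0 k)
    · simpa [encTest] using h (Nat.pair 1 (enc x))
    · simpa [encTest] using h (Nat.pair 2 (enc x))
    · simpa [encTest] using h (Nat.pair 3 (enc x))
    · obtain ⟨w, hw⟩ := h (Nat.pair 4 j)
      simp only [encTest, Nat.unpair_pair] at hw
      cases hd : dec (ℕ × ℕ × List Quint) w with
      | none => simp [hd] at hw
      | some x => exact ⟨x, by simpa [hd] using hw⟩
  · rintro ⟨h0, h1, h2, h3, h4⟩ m
    unfold encTest
    by_cases c0 : m.unpair.1 = 0
    · simpa [c0] using h0 m.unpair.2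
    by_cases c1 : m.unpair.1 = 1
    · simp only [c1, beq_self_eq_true, cond_true, show ((1 : ℕ) == 0) = false from rfl, cond_false]
      cases dec (Quint × ℕ × ℚ × ℚ) m.unpair.2 with
      | none => exact ⟨0, rfl⟩
      | some x => exact h1 x
    by_cases c2 : m.unpair.1 = 2
    · simp only [c2, beq_self_eq_true, cond_true, show ((2 : ℕ) == 0) = false from rfl,
        show ((2 : ℕ) == 1) = false from rfl, cond_false]
      cases dec (Quint × ℚ × ℚ) m.unpair.2 with
      | none => exact ⟨0, rfl⟩
      | some x => exact h2 x
    by_cases c3 : m.unpair.1 = 3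
    · simp only [c3, beq_self_eq_true, cond_true, show ((3 : ℕ) == 0) = false from rfl,
        show ((3 : ℕ) == 1) = false from rfl, show ((3 : ℕ) == 2) = false from rfl, cond_false]
      cases dec (Quint × ℚ × ℚ) m.unpair.2 with
      | none => exact ⟨0, rfl⟩
      | some x => exact h3 x
    · simp only [beq_false_of_ne c0, beq_false_of_ne c1, beq_false_of_ne c2, beq_false_of_ne c3,
        cond_false]
      obtain ⟨x, hx⟩ := h4 m.unpair.2
      exact ⟨enc x, by simpa using hx⟩

theorem coverCond_iff {j N i : ℕ} {a r s : ℚ} : coverCond j N i a r s = true ↔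
    (s : ℝ) < 1 / (j + 1) ∧ |(i : ℝ) / (N + 1) - a| + 1 / (N + 1) < r := by
  simp only [coverCond, Bool.and_eq_true, ratLt_eq_true]
  rw [← Rat.cast_lt (K := ℝ), ← Rat.cast_lt (K := ℝ)]
  push_cast
  rfl

theorem testCover_iff {e j T N : ℕ} {l : List Quint} : testCover e j (T, N, l) = true ↔
    ∀ i < N + 2, ∃ t ∈ l, hasVal e 1 T (codeQuint t) = true ∧
      coverCond j N i t.2.1 t.2.2.1 t.2.2.2.2 = true := by
  simp only [testCover, List.all_eq_true, List.mem_range, List.any_eq_true, Bool.and_eq_true,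
    enc_eq_codeQuint]

/-- Totality on `[0,1]` quantifies over reals. A Lebesgue number of the cover by balls of accuracy
`ε` replaces it by the existence of a finite grid, and so by an arithmetical statement. -/
theorem exists_grid_cover {Φ : Set Quint} {ε : ℝ}
    (h : ∀ x ∈ Icc (0 : ℝ) 1, ∃ a r b s : ℚ, Rel Φ a r b s ∧ |x - a| < r ∧ (s : ℝ) < ε) :
    ∃ N : ℕ, ∀ i < N + 2, ∃ t ∈ Φ, ((t.2.2.2.2 : ℚ) : ℝ) < ε ∧
      |(i : ℝ) / (N + 1) - (t.2.1 : ℚ)| + 1 / (N + 1) < (t.2.2.1 : ℚ) := by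
  let ι := {t : Quint // t ∈ Φ ∧ (t.2.2.2.2 : ℝ) < ε}
  obtain ⟨δ, hδ, hb⟩ := lebesgue_number_lemma_of_metric (isCompact_Icc (a := (0 : ℝ)) (b := 1))
    (c := fun t : ι => Metric.ball (t.1.2.1 : ℝ) t.1.2.2.1) (fun t => Metric.isOpen_ball)
    (fun x hx => by
      obtain ⟨a, r, b, s, ⟨n, hn⟩, h1, h2⟩ := h x hx
      exact mem_iUnion.2 ⟨⟨(n, a, r, b, s), hn, h2⟩, by simpa [Metric.mem_ball, Real.dist_eq] using h1⟩)
  obtain ⟨N, hN⟩ := exists_nat_one_div_lt hδ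
  refine ⟨N, fun i hi => ?_⟩
  have hN0 : (0 : ℝ) < N + 1 := by positivity
  obtain ⟨⟨t, ht, hs⟩, hsub⟩ := hb ((i : ℝ) / (N + 1)) ⟨by positivity, by
    rw [div_le_one hN0]; exact_mod_cast Nat.lt_succ_iff.1 hi⟩
  refine ⟨t, ht, hs, ?_⟩
  have h0 : (0 : ℝ) < 1 / (N + 1) := by positivity
  have h1 := hsub (show (i : ℝ) / (N + 1) + 1 / (N + 1) ∈ Metric.ball _ δ by
    rw [Metric.mem_ball, Real.dist_eq, add_sub_cancel_left, abs_of_pos h0]; exact hN)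
  have h2 := hsub (show (i : ℝ) / (N + 1) - 1 / (N + 1) ∈ Metric.ball _ δ by
    rw [Metric.mem_ball, Real.dist_eq, sub_sub_cancel_left, abs_neg, abs_of_pos h0]; exact hN)
  simp only [Metric.mem_ball, Real.dist_eq, abs_lt] at h1 h2
  rcases abs_cases ((i : ℝ) / (N + 1) - (t.2.1 : ℚ)) with h | h <;> linarith [h.1]

theorem exists_grid_near {x : ℝ} (hx : x ∈ Icc (0 : ℝ) 1) (N : ℕ) :
    ∃ i < N + 2, |x - (i : ℝ) / (N + 1)| ≤ 1 / (N + 1) := by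
  have hN0 : (0 : ℝ) < N + 1 := by positivity
  refine ⟨⌊x * (N + 1)⌋₊, ?_, ?_⟩
  · have : ⌊x * (N + 1)⌋₊ ≤ N + 1 := Nat.floor_le_of_le (by
      push_cast
      nlinarith [hx.2])
    omega
  · have h1 := Nat.floor_le (mul_nonneg hx.1 hN0.le)
    have h2 := Nat.lt_floor_add_one (x * (N + 1))
    have h3 : x = x * (N + 1) / (N + 1) := by field_simp
    rw [h3, ← sub_div, abs_div, abs_of_pos hN0, ← h3]
    gcongr
    rw [abs_le]; constructor <;> linarith

theorem ComputesSet.mem_iff {e : ℕ} {S : Set ℕ} (h : ComputesSet e S) (k : ℕ) :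
    1 ∈ phi e k ↔ k ∈ S :=
  ⟨fun h1 => by
    by_contra hn
    exact one_ne_zero (Part.mem_unique h1 ((h k).2 hn)), fun h1 => (h k).1 h1⟩

theorem forall_encTest_of_encodes {e : ℕ} {f : ℝ → ℝ} (h : Encodes e f) (m : ℕ) :
    ∃ w, encTest e m w = true := by
  obtain ⟨Φ, hΦ, hc, hf⟩ := h
  have hin : ∀ t, t ∈ Φ → 1 ∈ phi e (codeQuint t) := fun t ht => (hc _).1 ⟨t, ht, rfl⟩
  have hout : ∀ t, t ∉ Φ → 0 ∈ phi e (codeQuint t) := fun t ht =>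
    (hc _).2 fun ⟨t', ht', h⟩ => ht (codeQuint_injective h ▸ ht')
  revert m
  refine forall_encTest_iff.2 ⟨fun k => ?_, ?_, ?_, ?_, fun j => ?_⟩
  · rw [exists_testRange_iff]
    by_cases hk : k ∈ codeQuint '' Φ
    · obtain ⟨⟨n, a, r, b, s⟩, ht, rfl⟩ := hk
      exact Or.inr ⟨hin _ ht, _, rfl, inRange_iff.2 (hΦ.range _ _ _ _ _ ht)⟩
    · exact Or.inl ((hc k).2 hk)
  · rintro ⟨⟨n, a, r, b, s⟩, n', b', s'⟩
    rw [exists_testCompat_iff]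
    by_cases h1 : (n, a, r, b, s) ∈ Φ
    · by_cases h2 : (n', a, r, b', s') ∈ Φ
      · exact Or.inr (Or.inr (hΦ.compat a r b s b' s' ⟨n, h1⟩ ⟨n', h2⟩))
      · exact Or.inr (Or.inl (hout _ h2))
    · exact Or.inl (hout _ h1)
  · rintro ⟨⟨n, a, r, b, s⟩, a', r'⟩
    refine exists_testMove_iff.2 ?_
    by_cases h1 : (n, a, r, b, s) ∈ Φ
    · refine Or.inr fun hcond => ?_
      simp only [shrinkCond, Bool.and_eq_true, ratLe_eq_true, ratLt_eq_true] at hcond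
      obtain ⟨⟨⟨c1, c2⟩, c3⟩, c4⟩ := hcond
      obtain ⟨n', hn'⟩ := hΦ.shrink a r b s a' r' ⟨n, h1⟩ c1 c2 c3 c4
      exact ⟨n', hin _ hn'⟩
    · exact Or.inl (hout _ h1)
  · rintro ⟨⟨n, a, r, b, s⟩, b', s'⟩
    refine exists_testMove_iff.2 ?_
    by_cases h1 : (n, a, r, b, s) ∈ Φ
    · refine Or.inr fun hcond => ?_
      simp only [enlargeCond, ratLt_eq_true] at hcond
      obtain ⟨n', hn'⟩ := hΦ.enlarge a r b s b' s' ⟨n, h1⟩ hcond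
      exact ⟨n', hin _ hn'⟩
    · exact Or.inl (hout _ h1)
  · obtain ⟨N, hN⟩ := exists_grid_cover (Φ := Φ) (ε := 1 / (j + 1))
      fun x hx => (hf x hx).1 _ (by positivity)
    choose! t ht h1 h2 using hN
    -- Finitely many computations halt within a common time.
    obtain ⟨T, hT⟩ := ((eventually_all_finite (finite_Iio (N + 2))).2 fun i hi =>
      eventually_hasVal (hin _ (ht i hi))).exists
    refine ⟨(T, N, (List.range (N + 2)).map t), testCover_iff.2 fun i hi => ?_⟩
    exact ⟨t i, List.mem_map.2 ⟨i, List.mem_range.2 hi, rfl⟩, hT i hi,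
      coverCond_iff.2 ⟨h1 i hi, h2 i hi⟩⟩

theorem exists_encodes_of_forall_encTest {e : ℕ} (h : ∀ m, ∃ w, encTest e m w = true) :
    ∃ f, Encodes e f := by
  obtain ⟨h0, h1, h2, h3, h4⟩ := forall_encTest_iff.1 h
  -- The range test forces `φ_e` to be total with values `0` and `1`, and to take the value `1` only
  -- at codes of quintuples. Hence `φ_e` is the characteristic function of the codes of this set.
  let Φ : Set Quint := {t | 1 ∈ phi e (codeQuint t)}
  have hne : ∀ {t}, t ∈ Φ → 0 ∉ phi e (codeQuint t) := fun {t} ht h =>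
    one_ne_zero (Part.mem_unique ht h)
  have hΦ : IsFunctionCode Φ := by
    constructor
    · intro n a r b s ht
      rcases exists_testRange_iff.1 (h0 (codeQuint (n, a, r, b, s))) with h | ⟨-, t, h, hr⟩
      · exact absurd h (hne ht)
      · rw [codeQuint_injective h] at hr
        exact inRange_iff.1 hr
    · rintro a r b s b' s' ⟨n, hn⟩ ⟨n', hn'⟩
      rcases exists_testCompat_iff.1 (h1 ((n, a, r, b, s), n', b', s')) with h | h | h
      · exact absurd h (hne hn)
      · exact absurd h (hne hn')
      · exact h
    · rintro a r b s a' r' ⟨n, hn⟩ c1 c2 c3 c4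
      rcases exists_testMove_iff.1 (h2 ((n, a, r, b, s), a', r')) with h | h
      · exact absurd h (hne hn)
      · exact h (by simp [shrinkCond, c1, c2, c3, c4])
    · rintro a r b s b' s' ⟨n, hn⟩ c
      rcases exists_testMove_iff.1 (h3 ((n, a, r, b, s), b', s')) with h | h
      · exact absurd h (hne hn)
      · exact h (by simp [enlargeCond, c])
  obtain ⟨f, hf⟩ := hΦ.exists_represents fun x hx ε hε => by
    obtain ⟨j, hj⟩ := exists_nat_one_div_lt hε
    obtain ⟨⟨T, N, l⟩, hw⟩ := h4 j
    obtain ⟨i, hi, hxi⟩ := exists_grid_near hx N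
    obtain ⟨⟨n, a, r, b, s⟩, -, ht, hcov⟩ := testCover_iff.1 hw i hi
    obtain ⟨c1, c2⟩ := coverCond_iff.1 hcov
    refine ⟨a, r, b, s, ⟨n, mem_of_hasVal ht⟩, ?_, c1.trans hj⟩
    have := abs_sub_le x ((i : ℝ) / (N + 1)) a
    simp only at c2
    linarith
  refine ⟨f, Φ, hΦ, fun k => ⟨?_, fun hk => ?_⟩, hf⟩
  · rintro ⟨t, ht, rfl⟩
    exact ht
  · rcases exists_testRange_iff.1 (h0 k) with h | ⟨h, t, rfl, -⟩
    · exact h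
    · exact absurd ⟨t, h, rfl⟩ hk

end KW

/-! ### Arithmetization of the hierarchy and the reduction of `D_λ`. -/

namespace KW

open Set Filter Topology

/-! ### The statement that two secant slopes are close -/

/-- The element `t` is found to be in the code with index `e` within `T` steps, and its ball
contains `p`. -/
def evalCond (e T : ℕ) (p : ℚ) (t : Quint) : Bool :=
  hasVal e 1 T (enc t) && ratLt |p - t.2.1| t.2.2.1

theorem primrec_evalCond {α : Type*} [Primcodable α] {e T : α → ℕ} {p : α → ℚ} {t : α → Quint}
    (he : Primrec e) (hT : Primrec T) (hp : Primrec p) (ht : Primrec t) :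
    Primrec fun x => evalCond (e x) (T x) (p x) (t x) :=
  primrec_and (primrec_hasVal he (primrec_const _) hT (primrec_enc ht))
    (primrec_ratLt (primrec_rat_abs (primrec_rat_sub hp (primrec_fst (primrec_snd ht))))
      (primrec_fst (primrec_snd (primrec_snd ht))))

/-- The interval `[p, q]` is a nondegenerate subinterval of the unit interval. -/
def unitCond (p q : ℚ) : Bool := ratLe 0 p && ratLt p q && ratLe q 1

theorem primrec_unitCond {α : Type*} [Primcodable α] {p q : α → ℚ} (hp : Primrec p)
    (hq : Primrec q) : Primrec fun x => unitCond (p x) (q x) := by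
  unfold unitCond; fun_prop

theorem unitCond_iff {p q : ℚ} : unitCond p q = true ↔ 0 ≤ p ∧ p < q ∧ q ≤ 1 := by
  simp [unitCond, and_assoc]

/-- The numerical condition on approximations to the values of a function at `p`, `q`, `r` and `s`
which shows that the secant slopes differ by less than `1 / (j + 1)`. -/
def gapCond (j : ℕ) (x : ℚ × ℚ × ℚ × ℚ) (t u v w : ℚ × ℚ) : Bool :=
  ratLt (|(t.1 - u.1) / (x.1 - x.2.1) - (v.1 - w.1) / (x.2.2.1 - x.2.2.2)| +
    (t.2 + u.2) / (x.2.1 - x.1) + (v.2 + w.2) / (x.2.2.2 - x.2.2.1)) (1 / ((j + 1 : ℕ) : ℚ))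

/-- The secant slopes on `[p, q]` and on `[r, s]` are found to differ by less than
`1 / (j + 1)`. -/
def slopeTest (e j : ℕ) (x : ℚ × ℚ × ℚ × ℚ) (y : ℕ × Quint × Quint × Quint × Quint) : Bool :=
  (unitCond x.1 x.2.1 && unitCond x.2.2.1 x.2.2.2) &&
  (evalCond e y.1 x.1 y.2.1 && evalCond e y.1 x.2.1 y.2.2.1 &&
    (evalCond e y.1 x.2.2.1 y.2.2.2.1 && evalCond e y.1 x.2.2.2 y.2.2.2.2)) &&
  gapCond j x y.2.1.2.2.2 y.2.2.1.2.2.2 y.2.2.2.1.2.2.2 y.2.2.2.2.2.2.2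

theorem primrec_gapCond {α : Type*} [Primcodable α] {j : α → ℕ} {x : α → ℚ × ℚ × ℚ × ℚ}
    {t u v w : α → ℚ × ℚ} (hj : Primrec j) (hx : Primrec x) (ht : Primrec t) (hu : Primrec u)
    (hv : Primrec v) (hw : Primrec w) :
    Primrec fun a => gapCond (j a) (x a) (t a) (u a) (v a) (w a) := by
  unfold gapCond; fun_prop

theorem primrec_slopeTest :
    Primrec fun p : (ℕ × ℕ × ℚ × ℚ × ℚ × ℚ) × (ℕ × Quint × Quint × Quint × Quint) =>
      slopeTest p.1.1 p.1.2.1 p.1.2.2 p.2 := by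
  have hz : Primrec fun p : (ℕ × ℕ × ℚ × ℚ × ℚ × ℚ) × (ℕ × Quint × Quint × Quint × Quint) => p.1 :=
    Primrec.fst
  have hy : Primrec fun p : (ℕ × ℕ × ℚ × ℚ × ℚ × ℚ) × (ℕ × Quint × Quint × Quint × Quint) => p.2 :=
    Primrec.snd
  have he := primrec_fst hz
  have hj := primrec_fst (primrec_snd hz)
  have hx := primrec_snd (primrec_snd hz)
  have hT := primrec_fst hy
  have h1 := primrec_fst (primrec_snd hy)
  have h2 := primrec_fst (primrec_snd (primrec_snd hy))
  have h3 := primrec_fst (primrec_snd (primrec_snd (primrec_snd hy)))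
  have h4 := primrec_snd (primrec_snd (primrec_snd (primrec_snd hy)))
  have x1 := primrec_fst hx
  have x2 := primrec_fst (primrec_snd hx)
  have x3 := primrec_fst (primrec_snd (primrec_snd hx))
  have x4 := primrec_snd (primrec_snd (primrec_snd hx))
  have v : ∀ {t : (ℕ × ℕ × ℚ × ℚ × ℚ × ℚ) × (ℕ × Quint × Quint × Quint × Quint) → Quint},
      Primrec t → Primrec fun p => (t p).2.2.2 := fun h => primrec_snd (primrec_snd (primrec_snd h))
  exact primrec_and (primrec_and (primrec_and (primrec_unitCond x1 x2) (primrec_unitCond x3 x4))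
    (primrec_and (primrec_and (primrec_evalCond he hT x1 h1) (primrec_evalCond he hT x2 h2))
      (primrec_and (primrec_evalCond he hT x3 h3) (primrec_evalCond he hT x4 h4))))
    (primrec_gapCond hj hx (v h1) (v h2) (v h3) (v h4))

theorem abs_sub_le_of_evalCond {e T : ℕ} {f : ℝ → ℝ} (hf : Encodes e f) {p : ℚ} {t : Quint}
    (hp0 : 0 ≤ p) (hp1 : p ≤ 1) (h : evalCond e T p t = true) :
    |f p - t.2.2.2.1| ≤ t.2.2.2.2 := by
  obtain ⟨Φ, -, hc, hr⟩ := hf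
  rw [evalCond, Bool.and_eq_true, ratLt_eq_true, enc_eq_codeQuint] at h
  have hm : t ∈ Φ := codeQuint_injective.mem_set_image.1 ((hc.mem_iff _).1 (mem_of_hasVal h.1))
  obtain ⟨n, a, r, b, s⟩ := t
  exact (hr p ⟨by exact_mod_cast hp0, by exact_mod_cast hp1⟩).2 a r b s ⟨n, hm⟩
    (by exact_mod_cast h.2)

theorem exists_evalCond {e : ℕ} {f : ℝ → ℝ} (hf : Encodes e f) {p : ℚ}
    (hp0 : 0 ≤ p) (hp1 : p ≤ 1) {τ : ℝ} (hτ : 0 < τ) :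
    ∃ t : Quint, (t.2.2.2.2 : ℝ) < τ ∧ ∀ᶠ T in atTop, evalCond e T p t = true := by
  obtain ⟨Φ, -, hc, hr⟩ := hf
  obtain ⟨a, r, b, s, ⟨n, hn⟩, h1, h2⟩ :=
    (hr p ⟨by exact_mod_cast hp0, by exact_mod_cast hp1⟩).1 τ hτ
  refine ⟨(n, a, r, b, s), h2, ?_⟩
  filter_upwards [eventually_hasVal ((hc.mem_iff _).2 (mem_image_of_mem _ hn))] with T hT
  rw [evalCond, Bool.and_eq_true, ratLt_eq_true, enc_eq_codeQuint]
  exact ⟨hT, by exact_mod_cast h1⟩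

theorem abs_secant_sub_le {f : ℝ → ℝ} {p q b c s u : ℝ} (hpq : p < q) (hp : |f p - b| ≤ s)
    (hq : |f q - c| ≤ u) : |secant f p q - (b - c) / (p - q)| ≤ (s + u) / (q - p) := by
  have h : secant f p q - (b - c) / (p - q) = ((f q - c) - (f p - b)) / (q - p) := by
    have h1 : p - q ≠ 0 := by linarith
    have h2 : q - p ≠ 0 := by linarith
    rw [secant]; field_simp; ring
  rw [h, abs_div, abs_of_pos (sub_pos.2 hpq)]
  refine div_le_div_of_nonneg_right ?_ (sub_pos.2 hpq).le
  rw [abs_le] at *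
  constructor <;> linarith [hp.1, hp.2, hq.1, hq.2]

theorem gapCond_iff {j : ℕ} {p q r s : ℚ} {t u v w : ℚ × ℚ} :
    gapCond j (p, q, r, s) t u v w = true ↔
      |((t.1 : ℝ) - u.1) / (p - q) - (v.1 - w.1) / (r - s)| + (t.2 + u.2) / (q - p) +
        (v.2 + w.2) / (s - r) < 1 / ((j : ℝ) + 1) := by
  rw [gapCond, ratLt_eq_true, ← Rat.cast_lt (K := ℝ)]
  push_cast
  rfl

/-- The strict inequality between slopes is an open condition, so it is confirmed by sufficiently
good approximations, while each confirmation bounds the true difference. -/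
theorem exists_slopeTest_iff {e j : ℕ} {f : ℝ → ℝ} (hf : Encodes e f) {p q r s : ℚ} :
    (∃ y, slopeTest e j (p, q, r, s) y = true) ↔ (0 ≤ p ∧ p < q ∧ q ≤ 1) ∧
      (0 ≤ r ∧ r < s ∧ s ≤ 1) ∧ |secant f p q - secant f r s| < 1 / ((j : ℝ) + 1) := by
  simp only [slopeTest, Bool.and_eq_true, unitCond_iff, gapCond_iff]
  constructor
  · rintro ⟨⟨T, t, u, v, w⟩, ⟨⟨⟨hp, hpq, hq⟩, hr, hrs, hs⟩, ⟨h1, h2⟩, h3, h4⟩, h⟩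
    refine ⟨⟨hp, hpq, hq⟩, ⟨hr, hrs, hs⟩, lt_of_le_of_lt ?_ h⟩
    have e1 := abs_secant_sub_le (by exact_mod_cast hpq)
      (abs_sub_le_of_evalCond hf hp (hpq.le.trans hq) h1)
      (abs_sub_le_of_evalCond hf (hp.trans hpq.le) hq h2)
    have e2 := abs_secant_sub_le (by exact_mod_cast hrs)
      (abs_sub_le_of_evalCond hf hr (hrs.le.trans hs) h3)
      (abs_sub_le_of_evalCond hf (hr.trans hrs.le) hs h4)
    dsimp only at e1 e2 ⊢
    have e3 := neg_abs_le (((t.2.2.2.1 : ℝ) - u.2.2.2.1) / (p - q) -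
      (v.2.2.2.1 - w.2.2.2.1) / (r - s))
    have e4 := le_abs_self (((t.2.2.2.1 : ℝ) - u.2.2.2.1) / (p - q) -
      (v.2.2.2.1 - w.2.2.2.1) / (r - s))
    rw [abs_le] at e1 e2 ⊢
    constructor <;> linarith [e1.1, e1.2, e2.1, e2.2]
  · rintro ⟨⟨hp, hpq, hq⟩, ⟨hr, hrs, hs⟩, h⟩
    set η := 1 / ((j : ℝ) + 1) - |secant f p q - secant f r s| with hη
    have hη0 : 0 < η := sub_pos.2 h
    have hpq' : (0 : ℝ) < q - p := sub_pos.2 (by exact_mod_cast hpq)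
    have hrs' : (0 : ℝ) < s - r := sub_pos.2 (by exact_mod_cast hrs)
    -- Two values with this accuracy give a slope up to `η / 4`. The two slope errors enter twice,
    -- in the approximate difference and in the test, for a total below `η`.
    obtain ⟨t, ht, h1⟩ := exists_evalCond hf hp (hpq.le.trans hq)
      (show 0 < η / 8 * (q - p) by positivity)
    obtain ⟨u, hu, h2⟩ := exists_evalCond hf (hp.trans hpq.le) hq
      (show 0 < η / 8 * (q - p) by positivity)
    obtain ⟨v, hv, h3⟩ := exists_evalCond hf hr (hrs.le.trans hs)
      (show 0 < η / 8 * (s - r) by positivity)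
    obtain ⟨w, hw, h4⟩ := exists_evalCond hf (hr.trans hrs.le) hs
      (show 0 < η / 8 * (s - r) by positivity)
    obtain ⟨T, h1, h2, h3, h4⟩ := (h1.and (h2.and (h3.and h4))).exists
    refine ⟨(T, t, u, v, w), ⟨⟨⟨hp, hpq, hq⟩, hr, hrs, hs⟩, ⟨h1, h2⟩, h3, h4⟩, ?_⟩
    have e1 := abs_secant_sub_le (by exact_mod_cast hpq)
      (abs_sub_le_of_evalCond hf hp (hpq.le.trans hq) h1)
      (abs_sub_le_of_evalCond hf (hp.trans hpq.le) hq h2)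
    have e2 := abs_secant_sub_le (by exact_mod_cast hrs)
      (abs_sub_le_of_evalCond hf hr (hrs.le.trans hs) h3)
      (abs_sub_le_of_evalCond hf (hr.trans hrs.le) hs h4)
    have d1 : ((t.2.2.2.2 : ℝ) + u.2.2.2.2) / (q - p) < η / 4 := by
      rw [div_lt_iff₀ hpq']; linarith
    have d2 : ((v.2.2.2.2 : ℝ) + w.2.2.2.2) / (s - r) < η / 4 := by
      rw [div_lt_iff₀ hrs']; linarith
    dsimp only
    have e3 := neg_abs_le (secant f p q - secant f r s)
    have e4 := le_abs_self (secant f p q - secant f r s)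
    have e5 : |((t.2.2.2.1 : ℝ) - u.2.2.2.1) / (p - q) - (v.2.2.2.1 - w.2.2.2.1) / (r - s)| <
        |secant f p q - secant f r s| + η / 2 := by
      rw [abs_le] at e1 e2
      rw [abs_lt]
      constructor <;> linarith [e1.1, e1.2, e2.1, e2.2]
    linarith

end KW

namespace KW

open Set Filter Topology

/-! ### The statement that the rank of the encoded function is small -/

/-- The statements that are used to describe the rank, as tuples `(κ, e, j, p, q, r, s)`. For
`κ = 0` this is the statement that `e` encodes a function of small rank, for `κ = 1` it is the
instance `j` of the statement that `e` encodes a function. For `κ = 2` it says that the part of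
`[p, q] ∩ [r, s]` in a set of the hierarchy is empty, and for `κ = 3` that this is so or the secant
slopes on `[p, q]` and on `[r, s]` are close. -/
abbrev Query := ℕ × ℕ × ℕ × ℚ × ℚ × ℚ × ℚ

/-- The part of `[p, q] ∩ [r, s]` in the unit interval. -/
def common (x : ℚ × ℚ × ℚ × ℚ) : Set ℝ :=
  Icc (x.1 : ℝ) x.2.1 ∩ Icc (x.2.2.1 : ℝ) x.2.2.2 ∩ Icc 0 1

/-- The left endpoint of `common x`. -/
def lo (x : ℚ × ℚ × ℚ × ℚ) : ℚ := max (max x.1 x.2.2.1) 0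

/-- Membership of a rational number in `common x`. -/
def memCommon (c : ℚ) (x : ℚ × ℚ × ℚ × ℚ) : Bool :=
  (ratLe x.1 c && ratLe c x.2.1) && (ratLe x.2.2.1 c && ratLe c x.2.2.2) &&
    (ratLe 0 c && ratLe c 1)

theorem memCommon_iff {c : ℚ} {x : ℚ × ℚ × ℚ × ℚ} :
    memCommon c x = true ↔ (c : ℝ) ∈ common x := by
  simp only [memCommon, common, Bool.and_eq_true, ratLe_eq_true, mem_inter_iff, mem_Icc,
    Rat.cast_le, Rat.cast_nonneg]
  norm_cast

theorem isCompact_common (x : ℚ × ℚ × ℚ × ℚ) : IsCompact (common x) :=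
  (isCompact_Icc.inter_right isClosed_Icc).inter_right isClosed_Icc

/-- The set is an interval with rational left end `lo x`, so everything between `lo x` and one of
its points belongs to it. This yields the decision of emptiness and the density of rational points,
also for a one-point interval. -/
theorem max_lo_mem_common {x : ℚ × ℚ × ℚ × ℚ} {y : ℝ} (hy : y ∈ common x) {a : ℚ} (ha : a ≤ y) :
    ((max a (lo x) : ℚ) : ℝ) ∈ common x ∧ ((max a (lo x) : ℚ) : ℝ) ≤ y := by
  obtain ⟨⟨⟨h1, h2⟩, h3, h4⟩, h5, h6⟩ := hy
  have h : ((max a (lo x) : ℚ) : ℝ) ≤ y := by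
    rw [Rat.cast_max]
    refine max_le ha ?_
    rw [lo, Rat.cast_max, Rat.cast_max, Rat.cast_zero]
    exact max_le (max_le h1 h3) h5
  have g : ((lo x : ℚ) : ℝ) ≤ ((max a (lo x) : ℚ) : ℝ) := by exact_mod_cast le_max_right _ _
  have g1 : (x.1 : ℝ) ≤ lo x := by exact_mod_cast (le_max_left _ _).trans (le_max_left _ _)
  have g2 : (x.2.2.1 : ℝ) ≤ lo x := by exact_mod_cast (le_max_right _ _).trans (le_max_left _ _)
  have g3 : (0 : ℝ) ≤ lo x := by exact_mod_cast le_max_right _ _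
  exact ⟨⟨⟨⟨by linarith, by linarith⟩, by linarith, by linarith⟩, by linarith, by linarith⟩, h⟩

theorem memCommon_lo_iff {x : ℚ × ℚ × ℚ × ℚ} :
    memCommon (lo x) x = true ↔ (common x).Nonempty := by
  rw [memCommon_iff]
  refine ⟨fun h => ⟨_, h⟩, fun ⟨y, hy⟩ => ?_⟩
  obtain ⟨a, ha⟩ := exists_rat_lt (min y (lo x))
  rw [lt_min_iff] at ha
  have h := (max_lo_mem_common hy ha.1.le).1
  rwa [max_eq_right (by exact_mod_cast ha.2.le)] at h

theorem exists_rat_mem_common {x : ℚ × ℚ × ℚ × ℚ} {y : ℝ} (hy : y ∈ common x) {δ : ℝ}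
    (hδ : 0 < δ) : ∃ c : ℚ, (c : ℝ) ∈ common x ∧ |y - c| < δ := by
  obtain ⟨a, ha, ha'⟩ := exists_rat_btwn (show y - δ < y by linarith)
  obtain ⟨h1, h2⟩ := max_lo_mem_common hy ha'.le
  refine ⟨_, h1, ?_⟩
  have : (a : ℝ) ≤ ((max a (lo x) : ℚ) : ℝ) := by exact_mod_cast le_max_left _ _
  rw [abs_of_nonneg (by linarith)]
  linarith

/-- The test for the truth of a statement at the bottom of the hierarchy. -/
def queryTest (z : Query) (w : ℕ) : Bool :=
  bif z.1 == 0 then false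
  else bif z.1 == 1 then encTest z.2.1 z.2.2.1 w
  else !memCommon (lo z.2.2.2) z.2.2.2 || (z.1 == 3 &&
    (dec (ℕ × Quint × Quint × Quint × Quint) w).elim false (slopeTest z.2.1 z.2.2.1 z.2.2.2))

/-- The rational number `t` is in the unit interval and at distance less than `1 / i` from `c`. -/
def nearCond (i : ℕ) (c t : ℚ) : Bool :=
  ratLt |c - t| (1 / (i : ℚ)) && (ratLe 0 t && ratLe t 1)

theorem nearCond_iff {i : ℕ} {c t : ℚ} :
    nearCond i c t = true ↔ |(c : ℝ) - t| < 1 / i ∧ (t : ℝ) ∈ Icc (0 : ℝ) 1 := by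
  simp only [nearCond, Bool.and_eq_true, ratLe_eq_true, ratLt_eq_true, mem_Icc]
  refine and_congr ?_ (by norm_cast)
  rw [← Rat.cast_lt (K := ℝ)]
  push_cast
  rfl

/-- The two intervals `y` are nondegenerate and close to the point `c` of `common x`. -/
def splitCond (i : ℕ) (x : ℚ × ℚ × ℚ × ℚ) (c : ℚ) (y : ℚ × ℚ × ℚ × ℚ) : Bool :=
  memCommon c x && (ratLt y.1 y.2.1 && ratLt y.2.2.1 y.2.2.2) &&
    (nearCond i c y.1 && nearCond i c y.2.1 && (nearCond i c y.2.2.1 && nearCond i c y.2.2.2))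

/-- The statements of lower level to which a statement is reduced. -/
def queryStep (z : Query) (i m : ℕ) : Query :=
  bif z.1 == 0 then
    bif m.unpair.1 == 0 then (1, z.2.1, m.unpair.2, 0, 0, 0, 0)
    else (2, z.2.1, m.unpair.2, 0, 1, 0, 1)
  else bif z.1 == 1 || i == 0 then z
  else (dec (ℚ × ℚ × ℚ × ℚ × ℚ) m).elim (2, z.2.1, z.2.2.1, 1, 0, 1, 0) fun u =>
    bif splitCond i z.2.2.2 u.1 u.2 then (3, z.2.1, z.2.2.1, u.2)
    else (2, z.2.1, z.2.2.1, 1, 0, 1, 0)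

section

variable {α : Type*} [Primcodable α]

theorem primrec_lo {x : α → ℚ × ℚ × ℚ × ℚ} (hx : Primrec x) : Primrec fun a => lo (x a) := by
  unfold lo; fun_prop

theorem primrec_memCommon {c : α → ℚ} {x : α → ℚ × ℚ × ℚ × ℚ} (hc : Primrec c) (hx : Primrec x) :
    Primrec fun a => memCommon (c a) (x a) := by
  unfold memCommon; fun_prop

theorem primrec_nearCond {i : α → ℕ} {c t : α → ℚ} (hi : Primrec i) (hc : Primrec c)
    (ht : Primrec t) : Primrec fun a => nearCond (i a) (c a) (t a) := by
  unfold nearCond; fun_prop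

theorem primrec_splitCond {i : α → ℕ} {c : α → ℚ} {x y : α → ℚ × ℚ × ℚ × ℚ} (hi : Primrec i)
    (hx : Primrec x) (hc : Primrec c) (hy : Primrec y) :
    Primrec fun a => splitCond (i a) (x a) (c a) (y a) := by
  have y1 := primrec_fst hy
  have y2 := primrec_fst (primrec_snd hy)
  have y3 := primrec_fst (primrec_snd (primrec_snd hy))
  have y4 := primrec_snd (primrec_snd (primrec_snd hy))
  exact primrec_and (primrec_and (primrec_memCommon hc hx)
    (primrec_and (primrec_ratLt y1 y2) (primrec_ratLt y3 y4)))
    (primrec_and (primrec_and (primrec_nearCond hi hc y1) (primrec_nearCond hi hc y2))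
      (primrec_and (primrec_nearCond hi hc y3) (primrec_nearCond hi hc y4)))

end

theorem primrec_queryTest : Primrec fun p : Query × ℕ => queryTest p.1 p.2 := by
  have hz : Primrec fun p : Query × ℕ => p.1 := Primrec.fst
  have hw : Primrec fun p : Query × ℕ => p.2 := Primrec.snd
  have hκ := primrec_fst hz
  have hq := primrec_snd hz
  have he := primrec_fst hq
  have hj := primrec_fst (primrec_snd hq)
  have hx := primrec_snd (primrec_snd hq)
  have h1 := primrec_encTest.comp (primrec_mk he (primrec_mk hj hw))
  have h2 := primrec_slopeTest.comp (primrec_mk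
    (primrec_snd (primrec_fst Primrec.fst) : Primrec fun p : (Query × ℕ) ×
      (ℕ × Quint × Quint × Quint × Quint) => p.1.1.2) Primrec.snd)
  exact primrec_cond (primrec_nat_beq hκ (primrec_const _)) (primrec_const _) <|
    primrec_cond (primrec_nat_beq hκ (primrec_const _)) h1 <|
    primrec_or (primrec_not (primrec_memCommon (primrec_lo hx) hx)) <|
    primrec_and (primrec_nat_beq hκ (primrec_const _)) <|
    primrec_option_elim (primrec_dec hw) (primrec_const _) h2

theorem primrec_queryStep : Primrec fun p : Query × ℕ × ℕ => queryStep p.1 p.2.1 p.2.2 := by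
  have hz : Primrec fun p : Query × ℕ × ℕ => p.1 := Primrec.fst
  have hi : Primrec fun p : Query × ℕ × ℕ => p.2.1 := primrec_fst Primrec.snd
  have hm : Primrec fun p : Query × ℕ × ℕ => p.2.2 := primrec_snd Primrec.snd
  have hu := primrec_nat_unpair hm
  have hκ := primrec_fst hz
  have he := primrec_fst (primrec_snd hz)
  have hj := primrec_fst (primrec_snd (primrec_snd hz))
  have hb : Primrec fun p : Query × ℕ × ℕ =>
      (((2 : ℕ), p.1.2.1, p.1.2.2.1, (1 : ℚ), (0 : ℚ), (1 : ℚ), (0 : ℚ)) : Query) :=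
    primrec_mk (primrec_const _) (primrec_mk he (primrec_mk hj (primrec_const _)))
  have hf : Primrec fun p : (Query × ℕ × ℕ) × (ℚ × ℚ × ℚ × ℚ × ℚ) => p.1 := Primrec.fst
  have hs : Primrec fun p : (Query × ℕ × ℕ) × (ℚ × ℚ × ℚ × ℚ × ℚ) => p.2 := Primrec.snd
  have hc := primrec_splitCond (hi.comp hf)
    (primrec_snd (primrec_snd (primrec_snd (hz.comp hf)))) (primrec_fst hs) (primrec_snd hs)
  have h3 := primrec_mk (primrec_const 3 : Primrec fun _ : (Query × ℕ × ℕ) ×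
    (ℚ × ℚ × ℚ × ℚ × ℚ) => 3) (primrec_mk (he.comp hf) (primrec_mk (hj.comp hf) (primrec_snd hs)))
  exact primrec_cond (primrec_nat_beq hκ (primrec_const _))
    (primrec_cond (primrec_nat_beq (primrec_fst hu) (primrec_const _))
      (primrec_mk (primrec_const _) (primrec_mk he (primrec_mk (primrec_snd hu) (primrec_const _))))
      (primrec_mk (primrec_const _)
        (primrec_mk he (primrec_mk (primrec_snd hu) (primrec_const _))))) <|
    primrec_cond (primrec_or (primrec_nat_beq hκ (primrec_const _))
      (primrec_nat_beq hi (primrec_const _))) hz <|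
    primrec_option_elim (primrec_dec hm) hb (primrec_cond hc h3 (hb.comp hf))

end KW

namespace KW

open Set Filter Topology

/-- The truth of a statement about the hierarchy at the level `α`. -/
def Holds (f : ℝ → ℝ) (z : Query) (α : Ordinal.{0}) : Prop :=
  hierarchy f (1 / ((z.2.2.1 : ℝ) + 1)) α ∩ common z.2.2.2 = ∅ ∨
    z.1 = 3 ∧ ∃ y, slopeTest z.2.1 z.2.2.1 z.2.2.2 y = true

theorem Holds.mono {f : ℝ → ℝ} {z : Query} {α β : Ordinal.{0}} (h : Holds f z α) (hαβ : α ≤ β) :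
    Holds f z β :=
  h.imp_left fun h => subset_eq_empty (inter_subset_inter_left _ (hierarchy_antitone _ _ hαβ)) h

theorem exists_queryTest_iff {f : ℝ → ℝ} {z : Query} (h0 : z.1 ≠ 0) (h1 : z.1 ≠ 1) :
    (∃ w, queryTest z w = true) ↔ Holds f z 0 := by
  have hc : common z.2.2.2 ⊆ Icc 0 1 := inter_subset_right
  have he : (!memCommon (lo z.2.2.2) z.2.2.2) = true ↔
      hierarchy f (1 / ((z.2.2.1 : ℝ) + 1)) 0 ∩ common z.2.2.2 = ∅ := by
    rw [hierarchy_zero, inter_eq_right.2 hc, Bool.not_eq_true', ← Bool.not_eq_true,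
      memCommon_lo_iff, not_nonempty_iff_eq_empty]
  simp only [queryTest, beq_false_of_ne h0, beq_false_of_ne h1, cond_false, Bool.or_eq_true,
    Bool.and_eq_true, exists_or, exists_const, beq_iff_eq, he, Holds]
  refine or_congr_right ?_
  constructor
  · rintro ⟨w, h3, h⟩
    refine ⟨h3, ?_⟩
    cases hd : dec (ℕ × Quint × Quint × Quint × Quint) w with
    | none => simp [hd] at h
    | some y => exact ⟨y, by simpa [hd] using h⟩
  · rintro ⟨h3, y, hy⟩
    exact ⟨enc y, h3, by simpa using hy⟩

/-- The reversed intervals have no points, which makes this the harmless default to which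
`queryStep` sends irrelevant instances. -/
theorem holds_empty (f : ℝ → ℝ) (κ e j : ℕ) (α : Ordinal.{0}) : Holds f (κ, e, j, 1, 0, 1, 0) α := by
  left
  have : common (1, 0, 1, 0) = ∅ := by simp [common]
  rw [this, inter_empty]

/-- This reservation of `i = 0` supplies the hypothesis of `IsSat.of_persistent`. -/
theorem queryStep_zero {z : Query} (h0 : z.1 ≠ 0) (m : ℕ) : queryStep z 0 m = z := by
  simp [queryStep, beq_false_of_ne h0]

theorem queryStep_of_ne {z : Query} (h0 : z.1 ≠ 0) (h1 : z.1 ≠ 1) {i : ℕ} (hi : i ≠ 0) (m : ℕ) :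
    (∃ c y, dec (ℚ × ℚ × ℚ × ℚ × ℚ) m = some (c, y) ∧ splitCond i z.2.2.2 c y = true ∧
      queryStep z i m = (3, z.2.1, z.2.2.1, y)) ∨
      queryStep z i m = (2, z.2.1, z.2.2.1, 1, 0, 1, 0) := by
  simp only [queryStep, beq_false_of_ne h0, beq_false_of_ne h1, beq_false_of_ne hi, cond_false,
    Bool.or_self]
  cases dec (ℚ × ℚ × ℚ × ℚ × ℚ) m with
  | none => exact Or.inr rfl
  | some u =>
    cases hs : splitCond i z.2.2.2 u.1 u.2 with
    | false => exact Or.inr (by simp [hs])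
    | true => exact Or.inl ⟨u.1, u.2, rfl, hs, by simp [hs]⟩

theorem queryStep_enc {z : Query} (h0 : z.1 ≠ 0) (h1 : z.1 ≠ 1) {i : ℕ} (hi : i ≠ 0) {c : ℚ}
    {y : ℚ × ℚ × ℚ × ℚ} (h : splitCond i z.2.2.2 c y = true) :
    queryStep z i (enc (c, y)) = (3, z.2.1, z.2.2.1, y) := by
  simp [queryStep, beq_false_of_ne h0, beq_false_of_ne h1, beq_false_of_ne hi, h]

theorem splitCond_iff {i : ℕ} {x : ℚ × ℚ × ℚ × ℚ} {c p q r s : ℚ} :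
    splitCond i x c (p, q, r, s) = true ↔ (c : ℝ) ∈ common x ∧ p < q ∧ r < s ∧
      ∀ t ∈ ({p, q, r, s} : Set ℚ), |(c : ℝ) - t| < 1 / i ∧ (t : ℝ) ∈ Icc (0 : ℝ) 1 := by
  simp only [splitCond, Bool.and_eq_true, memCommon_iff, ratLt_eq_true, nearCond_iff, and_assoc,
    mem_insert_iff, mem_singleton_iff, forall_eq_or_imp, forall_eq]

/-- A point of `P^{γ+1}` would provide two rational intervals near it that meet in `P^γ` and have
distant slopes, which contradicts the instance for these intervals. -/
theorem Holds.of_step {e : ℕ} {f : ℝ → ℝ} (hf : Encodes e f) {z : Query} (he : z.2.1 = e)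
    (h0 : z.1 ≠ 0) (h1 : z.1 ≠ 1) {i : ℕ} {γ : Ordinal.{0}}
    (h : ∀ m, Holds f (queryStep z i m) γ) : Holds f z (γ + 1) := by
  rcases Nat.eq_zero_or_pos i with rfl | hi
  · have := h 0
    rw [queryStep_zero h0] at this
    exact this.mono le_self_add
  left
  rw [eq_empty_iff_forall_notMem]
  rintro y ⟨hy, hyc⟩
  rw [hierarchy_succ] at hy
  have hi' : (0 : ℝ) < i := by exact_mod_cast hi
  have hi'' : (0 : ℚ) < i := by exact_mod_cast hi
  -- Half of `1 / i`; the other half is spent on replacing `y` by a rational point `c` of the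
  -- interval.
  obtain ⟨p, q, r, s, hpq, hrs, hb, hn, hε⟩ := hy.2 (1 / (2 * i)) (by positivity)
  obtain ⟨c, hc, hyc⟩ := exists_rat_mem_common hyc (show (0 : ℝ) < 1 / (2 * i) by positivity)
  have hs : splitCond i z.2.2.2 c (p, q, r, s) = true := by
    rw [splitCond_iff]
    refine ⟨hc, hpq, hrs, fun t ht => ⟨?_, (hb t ht).2⟩⟩
    have h2 := (hb t ht).1
    rw [Metric.mem_ball, Real.dist_eq] at h2
    push_cast at h2
    have h3 : (1 : ℝ) / i = 1 / (2 * i) + 1 / (2 * i) := by field_simp; norm_num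
    rw [h3]
    rw [abs_lt] at *
    constructor <;> linarith [h2.1, h2.2, hyc.1, hyc.2]
  have hm := h (enc (c, p, q, r, s))
  rw [queryStep_enc h0 h1 hi.ne' hs] at hm
  rcases hm with hm | ⟨-, hm⟩
  · obtain ⟨x, hx, hxP⟩ := hn
    refine eq_empty_iff_forall_notMem.1 hm x ⟨hxP, hx, hierarchy_subset_Icc _ _ _ hxP⟩
  · have hm := (exists_slopeTest_iff (he ▸ hf)).1 hm
    exact absurd hm.2.2 (not_lt.2 hε)

/-- If `x` is in `P` this is the negation of the definition. If not, a ball around `x` misses the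
closed set `P`, and no admissible pair of intervals exists. -/
theorem exists_ball_of_notMem_kwDeriv {f : ℝ → ℝ} {ε : ℝ} {P : Set ℝ} (hP : IsClosed P) {x : ℝ}
    (hx : x ∉ kwDeriv f ε P) : ∃ δ > 0, ∀ p q r s : ℚ, p < q → r < s →
      (∀ t ∈ ({p, q, r, s} : Set ℚ), (t : ℝ) ∈ Metric.ball x δ ∩ Icc 0 1) →
      (Icc (p : ℝ) q ∩ Icc (r : ℝ) s ∩ P).Nonempty → |secant f p q - secant f r s| < ε := by
  by_cases hxP : x ∈ P
  · have : ¬ ∀ δ : ℚ, 0 < δ → ∃ p q r s : ℚ, p < q ∧ r < s ∧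
        (∀ t ∈ ({p, q, r, s} : Set ℚ), (t : ℝ) ∈ Metric.ball x δ ∩ Icc 0 1) ∧
        (Icc (p : ℝ) q ∩ Icc (r : ℝ) s ∩ P).Nonempty ∧
        ε ≤ |secant f p q - secant f r s| := fun h => hx ⟨hxP, h⟩
    push Not at this
    obtain ⟨δ, hδ, h⟩ := this
    exact ⟨δ, by exact_mod_cast hδ, h⟩
  · obtain ⟨δ, hδ, h⟩ := Metric.isOpen_iff.1 hP.isOpen_compl x hxP
    refine ⟨δ, hδ, fun p q r s _ _ hb hn => ?_⟩
    obtain ⟨y, ⟨hy, -⟩, hyP⟩ := hn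
    have hp := (hb p (by simp)).1
    have hq := (hb q (by simp)).1
    exact absurd hyP (h ((convex_ball x δ).ordConnected.out hp hq hy))

/-- Every point of the compact interval has a ball on which the slope condition holds. A Lebesgue
number of this cover gives one `i` for all rational centres. -/
theorem Holds.exists_step {e : ℕ} {f : ℝ → ℝ} (hf : Encodes e f) {z : Query} (he : z.2.1 = e)
    (h0 : z.1 ≠ 0) (h1 : z.1 ≠ 1) {γ : Ordinal.{0}}
    (h : hierarchy f (1 / ((z.2.2.1 : ℝ) + 1)) (γ + 1) ∩ common z.2.2.2 = ∅) :
    ∃ i, ∀ m, Holds f (queryStep z i m) γ ∧ (queryStep z i m).1 ≠ 0 ∧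
      (queryStep z i m).1 ≠ 1 ∧ (queryStep z i m).2.1 = e := by
  have hb : ∀ x ∈ common z.2.2.2, x ∉ kwDeriv f (1 / ((z.2.2.1 : ℝ) + 1))
      (hierarchy f (1 / ((z.2.2.1 : ℝ) + 1)) γ) := by
    intro x hx hd
    rw [← hierarchy_succ] at hd
    exact eq_empty_iff_forall_notMem.1 h x ⟨hd, hx⟩
  choose! δ hδ hδ' using fun x hx =>
    exists_ball_of_notMem_kwDeriv (isClosed_hierarchy f _ γ) (hb x hx)
  obtain ⟨η, hη, hsub⟩ := lebesgue_number_lemma_of_metric (isCompact_common z.2.2.2)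
    (c := fun x : common z.2.2.2 => Metric.ball (x : ℝ) (δ x)) (fun x => Metric.isOpen_ball)
    (fun x hx => mem_iUnion.2 ⟨⟨x, hx⟩, Metric.mem_ball_self (hδ x hx)⟩)
  obtain ⟨N, hN⟩ := exists_nat_one_div_lt hη
  -- Nonzero, so that the step is a genuine reduction, and with `1 / (N + 1)` below the Lebesgue
  -- number.
  refine ⟨N + 1, fun m => ?_⟩
  rcases queryStep_of_ne h0 h1 N.succ_ne_zero m with ⟨c, ⟨p, q, r, s⟩, -, hs, hm⟩ | hm
  · rw [hm]
    refine ⟨?_, by norm_num, by norm_num, he⟩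
    obtain ⟨hc, hpq, hrs, hb⟩ := splitCond_iff.1 hs
    obtain ⟨⟨x, hx⟩, hx'⟩ := hsub c hc
    by_cases hn : (Icc (p : ℝ) q ∩ Icc (r : ℝ) s ∩
        hierarchy f (1 / ((z.2.2.1 : ℝ) + 1)) γ).Nonempty
    · right
      have hr : ∀ t ∈ ({p, q, r, s} : Set ℚ), 0 ≤ t ∧ t ≤ 1 := fun t ht => by
        have := (hb t ht).2
        exact ⟨by exact_mod_cast this.1, by exact_mod_cast this.2⟩
      refine ⟨rfl, (exists_slopeTest_iff (he ▸ hf)).2 ⟨⟨(hr p (by simp)).1, hpq,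
        (hr q (by simp)).2⟩, ⟨(hr r (by simp)).1, hrs, (hr s (by simp)).2⟩,
        hδ' x hx p q r s hpq hrs (fun t ht => ⟨hx' ?_, (hb t ht).2⟩) hn⟩⟩
      rw [Metric.mem_ball, dist_comm, Real.dist_eq]
      refine (hb t ht).1.trans ?_
      push_cast
      exact hN
    · left
      rw [eq_empty_iff_forall_notMem]
      exact fun y hy => hn ⟨y, hy.2.1, hy.1⟩
  · rw [hm]
    exact ⟨holds_empty _ _ _ _ _, by norm_num, by norm_num, he⟩

/-- The statement that `e` encodes a function of small rank. -/
def topQuery (e : ℕ) : Query := (0, e, 0, 0, 0, 0, 0)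

theorem queryStep_topQuery (e i m : ℕ) : queryStep (topQuery e) i m =
    bif m.unpair.1 == 0 then (1, e, m.unpair.2, 0, 0, 0, 0) else (2, e, m.unpair.2, 0, 1, 0, 1) :=
  rfl

theorem common_unit : common (0, 1, 0, 1) = Icc 0 1 := by simp [common]

theorem holds_unit_iff {f : ℝ → ℝ} {e j : ℕ} {α : Ordinal.{0}} :
    Holds f (2, e, j, 0, 1, 0, 1) α ↔ hierarchy f (1 / ((j : ℝ) + 1)) α = ∅ := by
  simp only [Holds, common_unit, inter_eq_left.2 (hierarchy_subset_Icc _ _ _)]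
  simp

section

variable {S : ℕ → Query → Prop}

/-- What the statements say, at the level `α` of the hierarchy. -/
def Meaning (z : Query) (α : Ordinal.{0}) : Prop :=
  (z.1 = 0 → (∀ m, ∃ w, encTest z.2.1 m w = true) ∧
    ∀ f, Encodes z.2.1 f → ∀ j : ℕ, hierarchy f (1 / ((j : ℝ) + 1)) α = ∅) ∧
  (z.1 = 1 → ∃ w, encTest z.2.1 z.2.2.1 w = true) ∧
  (z.1 ≠ 0 → z.1 ≠ 1 → ∀ f, Encodes z.2.1 f → Holds f z α)

/-- Soundness. The clauses on the hierarchy are conditional on `e` encoding a function, which the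
top statement itself asserts among its instances. -/
theorem IsSat.meaning (hS : IsSat queryTest queryStep S) {d : ℕ} (hd : d ∈ kleeneO) :
    ∀ z, S d z → Meaning z (nrank (2 ^ d)) := by
  refine hS.sound ?_ ?_ ?_ hd
  · intro z w h
    refine ⟨fun h0 => ?_, fun h1 => ⟨w, ?_⟩, fun h0 h1 f _ => ?_⟩
    · simp [queryTest, h0] at h
    · simpa [queryTest, h1] using h
    · exact (exists_queryTest_iff h0 h1).1 ⟨w, h⟩
  · intro z α β hαβ h
    refine ⟨fun h0 => ⟨(h.1 h0).1, fun f hf j => ?_⟩, h.2.1, fun h0 h1 f hf => ?_⟩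
    · exact subset_eq_empty (hierarchy_antitone _ _ hαβ) ((h.1 h0).2 f hf j)
    · exact (h.2.2 h0 h1 f hf).mono hαβ
  · rintro d - ih z ⟨i, hi⟩
    have hM := fun m => ih _ (hi m)
    refine ⟨fun h0 => ?_, fun h1 => ?_, fun h0 h1 f hf => ?_⟩
    · obtain ⟨κ, e, j, x⟩ := z
      obtain rfl : κ = 0 := h0
      refine ⟨fun m => ?_, fun f hf j => ?_⟩
      · have := hM (Nat.pair 0 m)
        simp only [queryStep, Nat.unpair_pair] at this
        exact this.2.1 rfl
      · have := hM (Nat.pair 1 j)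
        simp only [queryStep, Nat.unpair_pair] at this
        have hz : Meaning (2, e, j, 0, 1, 0, 1) (nrank (2 ^ d)) := this
        have := holds_unit_iff.1 (hz.2.2 (by simp) (by simp) f hf)
        exact subset_eq_empty (hierarchy_antitone _ _ le_self_add) this
    · have := hM 0
      have hz : queryStep z i 0 = z := by simp [queryStep, h1]
      rw [hz] at this
      exact this.2.1 h1
    · have he : ∀ m, (queryStep z i m).2.1 = z.2.1 ∧ (queryStep z i m).1 ≠ 0 ∧
          (queryStep z i m).1 ≠ 1 := by
        intro m
        rcases Nat.eq_zero_or_pos i with rfl | hi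
        · rw [queryStep_zero h0]; exact ⟨rfl, h0, h1⟩
        · rcases queryStep_of_ne h0 h1 hi.ne' m with ⟨c, y, -, -, hm⟩ | hm <;> rw [hm] <;> simp
      exact Holds.of_step hf rfl h0 h1 fun m =>
        (hM m).2.2 (he m).2.1 (he m).2.2 f ((he m).1 ▸ hf)

/-- Completeness. The bottom level costs `1` and each derivative costs `2`. At a limit, compactness
supplies an earlier level at which the part in question is already empty. -/
theorem IsSat.of_holds (hS : IsSat queryTest queryStep S) {e : ℕ} {f : ℝ → ℝ} (hf : Encodes e f)
    (α : Ordinal.{0}) : ∀ z : Query, z.2.1 = e → z.1 ≠ 0 → z.1 ≠ 1 → Holds f z α →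
      ∀ d ∈ kleeneO, 2 * α + 1 ≤ nrank (2 ^ d) → S d z := by
  have base : ∀ z : Query, z.1 ≠ 0 → z.1 ≠ 1 → Holds f z 0 → ∀ d ∈ kleeneO, S d z :=
    fun z h0 h1 h d hd =>
      hS.of_persistent ((exists_queryTest_iff h0 h1).2 h) (queryStep_zero h0) hd
  induction α using Ordinal.limitRecOn with
  | zero => exact fun z _ h0 h1 h d hd _ => base z h0 h1 h d hd
  | add_one γ ih =>
    intro z he h0 h1 h d hd hα
    rcases h with h | h
    · refine hS.of_step (fun d hd hγ => ?_) hd hα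
      obtain ⟨i, hi⟩ := Holds.exists_step hf he h0 h1 h
      exact ⟨i, fun m => ih _ (hi m).2.2.2 (hi m).2.1 (hi m).2.2.1 (hi m).1 d hd hγ⟩
    · exact base z h0 h1 (Or.inr h) d hd
  | limit l hl ih =>
    intro z he h0 h1 h d hd hα
    rcases h with h | h
    · obtain ⟨β, hβ, h⟩ := exists_hierarchy_inter_eq_empty hl (isCompact_common _) h
      refine ih β hβ z he h0 h1 (Or.inl h) d hd (le_trans ?_ hα)
      gcongr
    · exact base z h0 h1 (Or.inr h) d hd

theorem IsSat.topQuery (hS : IsSat queryTest queryStep S) {e : ℕ} {f : ℝ → ℝ} (hf : Encodes e f)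
    {β : Ordinal.{0}} (h : ∀ ε : ℝ, 0 < ε → hierarchy f ε β = ∅) {d : ℕ} (hd : d ∈ kleeneO)
    (hβ : 2 * (β + 1) + 1 ≤ nrank (2 ^ d)) : S d (topQuery e) := by
  refine hS.of_step (fun d hd hγ => ⟨0, fun m => ?_⟩) hd hβ
  rw [queryStep_topQuery]
  cases hm : m.unpair.1 == 0 with
  | true =>
    rw [cond_true]
    refine hS.of_persistent ?_ (queryStep_zero (by simp)) hd
    simpa [queryTest] using forall_encTest_of_encodes hf m.unpair.2
  | false =>
    rw [cond_false]
    exact hS.of_holds hf β _ rfl (by simp) (by simp) (holds_unit_iff.2 (h _ (by positivity))) d hd hγ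

/-- Below a limit the exact cost does not matter: an empty level `β` needs about `2 * β` jumps, and
a statement true at a notation `d` reached by descent gives emptiness at the rank of `2 ^ d`; both
stay below the limit. It suffices to treat `ε = 1 / (j + 1)`, as levels shrink when `ε` grows. -/
theorem IsSat.mem_D_iff (hS : IsSat queryTest queryStep S) {e₀ : ℕ} {f₀ : ℕ → ℕ}
    (h₀ : IsFund e₀ f₀) (e : ℕ) : e ∈ D (nrank (3 * 5 ^ e₀)) ↔ S (3 * 5 ^ e₀) (KW.topQuery e) := by
  rw [KW.mem_D_iff]
  constructor
  · rintro ⟨f, hf, β, hβ, h⟩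
    refine hS.topQuery hf h h₀.mem ?_
    have h1 := two_mul_lt_of_isSuccLimit h₀.isSuccLimit (add_one_lt_of_isFund h₀ hβ)
    exact (add_one_lt_of_isFund h₀ h1).le.trans (nrank_lt (lt_two_pow_of_mem h₀.mem)).le
  · intro h
    obtain ⟨s, d, hs, hd, h⟩ := (hS.lim h₀ _).1 h
    have hM := (hS.meaning hd _ h).1 rfl
    obtain ⟨f, hf⟩ := exists_encodes_of_forall_encTest hM.1
    refine ⟨f, hf, _, nrank_lt (ltO_of_descend h₀ hs), fun ε hε => ?_⟩
    obtain ⟨j, hj⟩ := exists_nat_one_div_lt hε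
    exact subset_eq_empty (hierarchy_mono_eps hj.le _) (hM.2 f hf j)

end

theorem D_reducible {e₀ : ℕ} {f₀ : ℕ → ℕ} (h₀ : IsFund e₀ f₀) :
    (fun n => n ∈ D (nrank (3 * 5 ^ e₀))) ≤₁ fun n => n ∈ H (2 ^ (3 * 5 ^ e₀)) := by
  obtain ⟨g, hg, hi, hS⟩ := exists_isSat primrec_queryTest primrec_queryStep
  have ht : Primrec topQuery :=
    primrec_mk (primrec_const _) (primrec_mk primrec_id (primrec_const _))
  refine ⟨fun e => g (3 * 5 ^ e₀) (topQuery e), ((hg _).comp ht).to_comp, ?_,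
    fun e => hS.mem_D_iff h₀ e⟩
  intro e e' h
  exact congrArg (fun z : Query => z.2.1) (hi _ h)

end KW

theorem mainTheorem2 (l : Ordinal.{0}) (hl : Order.IsSuccLimit l) (hlt : l < KW.omega1CK) :
    KW.IsSigmaComplete l (KW.D l) := by
  intro a ha
  obtain ⟨e, f, rfl, hf⟩ := ha.eq_lim hl
  obtain rfl := ha.nrank_eq
  exact ⟨KW.D_reducible hf, KW.H_two_pow_reducible hf⟩
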